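/- **Setting.** Let $n\ge 1$, $m\ge 2$, and let $\Omega\subset\mathbb R^n$ be an open, bounded, connected set of class $C^1$ with outward unit normal $\eta$. Let $a,b,c>0$ satisfy $\cos\frac{\pi}{m+1}<\frac{a}{b+c}$ and put $$\lambda_\ell=a+2\sqrt{bc}\,\cos\frac{(m+1-\ell)\pi}{m+1},\qquad \ell=1,\dots,m .$$ Consider, for $W=(w_1,\dots,w_m)$, the system $$\partial_t w_\ell-\lambda_\ell\Delta w_\ell=F_\ell(W)\ \text{ in }\Omega\times(0,T_{\max}),\qquad \alpha w_\ell+(1-\alpha)\partial_\eta w_\ell=\Lambda_\ell\ \text{ on }\partial\Omega\times(0,T_{\max}),\qquad \ell=1,\dots,m, \tag{1}$$ where either $0<\alpha<1$ and all $\Lambda_\ell\ge0$ are constants, or $\alpha=0$ and $\Lambda=0$, or $\alpha=1$ and $\Lambda=0$. The function $F=(F_1,\dots,F_m):\mathbb R^m\to\mathbb R^m$ is locally Lipschitz and satisfies, with $\langle W,1\rangle=w_1+\dots+w_m$: * (A1) $F$ is continuously differentiable on $\mathbb R_+^m=[0,\infty)^m$, and $F_\ell(W)\ge0$ for all $W\in\mathbb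 R_+^m$ with $w_\ell=0$; * (A2) there are $C_1\ge 0$ and $N\in\mathbb N$ with $|F_\ell(W)|\le C_1(1+\langle W,1\rangle)^N$ on $(0,\infty)^m$ for all $\ell$; * (A3) there are constants $\bar d_1,\dots,\bar d_{m-1}$ such that for every $S=(d_1,\dots,d_{m-1},1)$ with $d_\ell\ge\bar d_\ell$ for all $\ell\le m-1$ there is a constant $C_2$ with $\langle S,F(W)\rangle\le C_2(1+\langle W,1\rangle)$ on $\mathbb R_+^m$. Let $p_m\ge1$ be an integer and $\theta_1,\dots,\theta_{m-1}>0$. For integers $0\le p_1\le\dots\le p_{m-1}\le p_m-2$ let $(a_{\ell\kappa})_{1\le\ell,\kappa\le m}$ be the symmetric matrix with $$a_{\ell\kappa}=\frac{\lambda_\ell+\lambda_\kappa}{2}\prod_{k=1}^{\ell-1}\theta_k^{p_k^2}\prod_{k=\ell}^{\kappa-1}\theta_k^{(p_k+1)^2}\prod_{k=\kappa}^{m-1}\theta_k^{(p_k+2)^2}\qquad(\ell\le\kappa),$$ let $\det[k]$ be its $k$-th leading principal minor, and put $$K_l^2=a_{11}a_{ll}-a_{1l}^2,\qquad K_l^r=K_{r-1}^{r-1}K_l^{r-1}-\big(H_l^{r-1}\big)^2\quad(3\le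 r\le l),$$ $$H_l^r=M_l^r\prod_{k=1}^{r-2}\det[k]^{2^{\,r-k-2}}\quad(2\le r<l),$$ where $M_l^r$ is the minor of $(a_{\ell\kappa})$ with rows $1,\dots,r$ and columns $1,\dots,r-1,l$. Assume that for all such $p_1,\dots,p_{m-1}$ $$K_l^l>0,\qquad l=2,\dots,m .$$ A solution of (1) on $(0,T_{\max})$, $0<T_{\max}\le\infty$, with initial data $W_0\in L^\infty(\Omega)^m$ is a function $W$ that is $C^{2,1}$ in $\Omega\times(0,T_{\max})$, continuous on $\overline\Omega\times(0,T_{\max})$ and, if $\alpha<1$, has a spatial gradient that is continuous up to $\partial\Omega$, that satisfies (1) pointwise, is bounded on $\Omega\times(0,T')$ for every finite $T'<T_{\max}$, and has $W(t)\to W_0$ in $L^1(\Omega)$ as $t\to0^+$. **Corollary.** Every solution of (1) on $(0,T_{\max})$ with nonnegative initial data in $L^\infty(\Omega)$ lies in $L^\infty(0,T^*;L^p(\Omega))$ with $p=p_m$, for every finite $T^*<T_{\max}$. More precisely, for all $M,T>0$ there is a constant $C$, which depends only on $M$, $T$ and the data $\Omega,m,a,b,c,\alpha,\Lambda,F,p_m,\theta$,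 such that every solution of (1) with $0\le W_0\le M$ almost everywhere satisfies $$\|w_\ell(t)\|_{L^{p}(\Omega)}\le C,\qquad p=p_m,\ \ \ell=1,\dots,m,\ \ 0<t<T^*,$$ for every $T^*\le T$ with $T^*<T_{\max}$. In particular, if $T_{\max}<\infty$, the bound holds on all of $(0,T_{\max})$. -/

import Mathlib

open MeasureTheory Filter Topology Set

noncomputable section

namespace ToeplitzRD

/-! ### The domain -/

/-- `g` is a `C¹` defining function of `Ω` in the ball of radius `r` around `x`: there `Ω` is
the set `{g < 0}`, `g x = 0`, and the gradient of `g` does not vanish at `x`. -/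
structure IsLocalDefiningFunction {n : ℕ} (Ω : Set (EuclideanSpace ℝ (Fin n)))
    (x : EuclideanSpace ℝ (Fin n)) (r : ℝ) (g : EuclideanSpace ℝ (Fin n) → ℝ) : Prop where
  pos : 0 < r
  contDiffOn : ContDiffOn ℝ 1 g (Metric.ball x r)
  eq_zero : g x = 0
  gradient_ne_zero : gradient g x ≠ 0
  mem_iff : ∀ y ∈ Metric.ball x r, (y ∈ Ω ↔ g y < 0)

/-- An open bounded connected set of class `C¹` in `ℝⁿ`. -/
structure IsBoundedC1Domain {n : ℕ} (Ω : Set (EuclideanSpace ℝ (Fin n))) : Prop where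
  isOpen : IsOpen Ω
  isConnected : IsConnected Ω
  isBounded : Bornology.IsBounded Ω
  boundary : ∀ x ∈ frontier Ω, ∃ r g, IsLocalDefiningFunction Ω x r g

/-- `ν` is the outward unit normal of `Ω` at the boundary point `x`. -/
def IsOutwardUnitNormal {n : ℕ} (Ω : Set (EuclideanSpace ℝ (Fin n)))
    (x ν : EuclideanSpace ℝ (Fin n)) : Prop :=
  ∃ r g, IsLocalDefiningFunction Ω x r g ∧ ν = ‖gradient g x‖⁻¹ • gradient g x

/-! ### The diffusion coefficients and the determinant condition

The indices `ℓ, κ = 1, …, m` and `k = 1, …, m - 1` are natural numbers that start at `1`. -/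

/-- The eigenvalues `λ_ℓ = a + 2 √(bc) cos ((m + 1 - ℓ) π / (m + 1))` of the tri-diagonal
Toeplitz matrix with diagonal `a` and off-diagonals `b`, `c`, in ascending order. -/
def eigenvalue (m : ℕ) (a b c : ℝ) (l : ℕ) : ℝ :=
  a + 2 * Real.sqrt (b * c) * Real.cos (((m : ℝ) + 1 - (l : ℝ)) * Real.pi / ((m : ℝ) + 1))

/-- The symmetric matrix with, for `ℓ ≤ κ`, the entries
`a_{ℓκ} = (λ_ℓ + λ_κ)/2 · ∏_{k<ℓ} θ_k^{p_k²} · ∏_{ℓ≤k<κ} θ_k^{(p_k+1)²} · ∏_{κ≤k<m} θ_k^{(p_k+2)²}`. -/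
def entry (m : ℕ) (lam θ : ℕ → ℝ) (p : ℕ → ℕ) (l κ : ℕ) : ℝ :=
  (lam l + lam κ) / 2
    * (∏ k ∈ Finset.Ico 1 (min l κ), θ k ^ (p k ^ 2))
    * (∏ k ∈ Finset.Ico (min l κ) (max l κ), θ k ^ ((p k + 1) ^ 2))
    * (∏ k ∈ Finset.Ico (max l κ) m, θ k ^ ((p k + 2) ^ 2))

/-- The `k`-th leading principal minor `det[k]` of `A`. -/
def leadingMinor (A : ℕ → ℕ → ℝ) (k : ℕ) : ℝ :=
  Matrix.det (Matrix.of fun i j : Fin k => A (i.val + 1) (j.val + 1))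

/-- The minor of `A` with the rows `1, …, r` and the columns `1, …, r - 1, l`: what remains of
`(a_{ℓκ})_{ℓ,κ ≤ l}` without the rows `r + 1, …, l` and the columns `r, …, l - 1`. -/
def mixedMinor (A : ℕ → ℕ → ℝ) (l r : ℕ) : ℝ :=
  Matrix.det (Matrix.of fun i j : Fin r =>
    A (i.val + 1) (if j.val + 1 = r then l else j.val + 1))

/-- `H_l^r`, for `2 ≤ r < l`; for `r = 2` it is `a_{11} a_{2l} - a_{12} a_{1l}`. -/
def coeffH (A : ℕ → ℕ → ℝ) (l r : ℕ) : ℝ :=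
  mixedMinor A l r * ∏ k ∈ Finset.Icc 1 (r - 2), leadingMinor A k ^ (2 ^ (r - k - 2))

/-- `coeffK A r l` is `K_l^r`, for `2 ≤ r ≤ l`: `K_l^2 = a_{11} a_{ll} - a_{1l}²` and
`K_l^r = K_{r-1}^{r-1} K_l^{r-1} - (H_l^{r-1})²` for `r ≥ 3` (values at `r < 2` are not used). -/
def coeffK (A : ℕ → ℕ → ℝ) : ℕ → ℕ → ℝ
  | 0, _ => 0
  | 1, _ => 0
  | 2, l => A 1 1 * A l l - A 1 l ^ 2
  | r + 3, l => coeffK A (r + 2) (r + 2) * coeffK A (r + 2) l - coeffH A l (r + 2) ^ 2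

/-- `K_l^l > 0` for `l = 2, …, m`, for all the indices
`0 ≤ p_1 ≤ p_2 ≤ … ≤ p_{m-1} ≤ p_m - 2` of the matrix `(a_{ℓκ})`. -/
def DetCondition (m : ℕ) (lam θ : ℕ → ℝ) (pm : ℕ) : Prop :=
  ∀ p : ℕ → ℕ, (∀ k, 1 ≤ k → k + 1 < m → p k ≤ p (k + 1)) → p (m - 1) + 2 ≤ pm →
    ∀ l, 2 ≤ l → l ≤ m → 0 < coeffK (entry m lam θ p) l l

/-! ### The reaction terms -/

/-- Condition (A1): continuously differentiable on `ℝ₊ᵐ`, with `F_ℓ ≥ 0` where `w_ℓ = 0`. -/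
def QuasiPositiveC1 {m : ℕ} (F : (Fin m → ℝ) → (Fin m → ℝ)) : Prop :=
  ContDiffOn ℝ 1 F {w | ∀ l, 0 ≤ w l} ∧
    ∀ l, ∀ w : Fin m → ℝ, (∀ k, 0 ≤ w k) → w l = 0 → 0 ≤ F w l

/-- Condition (A2): polynomial growth on `(0, ∞)ᵐ`. -/
def PolynomialGrowth {m : ℕ} (F : (Fin m → ℝ) → (Fin m → ℝ)) : Prop :=
  ∃ (C₁ : ℝ) (N : ℕ), ∀ l, ∀ w : Fin m → ℝ, (∀ k, 0 < w k) →
    |F w l| ≤ C₁ * (1 + ∑ k, w k) ^ N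

/-- Condition (A3) with the thresholds `dbar`: for every `S = (d_1, …, d_{m-1}, 1)` with
`d_ℓ ≥ dbar_ℓ` there is a constant `C₂` with `⟨S, F w⟩ ≤ C₂ (1 + ⟨w, 1⟩)` on `ℝ₊ᵐ`. -/
def LyapunovCondition {m : ℕ} (F : (Fin m → ℝ) → (Fin m → ℝ)) (dbar : Fin m → ℝ) : Prop :=
  ∀ S : Fin m → ℝ, (∀ l, l.val + 1 < m → dbar l ≤ S l) → (∀ l, l.val + 1 = m → S l = 1) →
    ∃ C₂ : ℝ, ∀ w : Fin m → ℝ, (∀ k, 0 ≤ w k) →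
      ∑ l, S l * F w l ≤ C₂ * (1 + ∑ k, w k)

/-! ### Boundary conditions and solutions -/

/-- The three kinds of boundary conditions: Robin with nonnegative data, homogeneous Neumann,
homogeneous Dirichlet. -/
def AdmissibleBoundary {m : ℕ} (α : ℝ) (Λ : Fin m → ℝ) : Prop :=
  (0 < α ∧ α < 1 ∧ ∀ l, 0 ≤ Λ l) ∨ (α = 0 ∧ ∀ l, Λ l = 0) ∨ (α = 1 ∧ ∀ l, Λ l = 0)

/-- The times `0 < t < Tmax`, where `Tmax` may be `∞`. -/
def times (Tmax : EReal) : Set ℝ := {t | 0 < t ∧ (t : EReal) < Tmax}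

/-- `w` is a classical solution on `(0, Tmax)` of
`∂ₜ w_ℓ - λ_ℓ Δ w_ℓ = F_ℓ(w)` in `Ω`, `α w_ℓ + (1 - α) ∂_η w_ℓ = Λ_ℓ` on `∂Ω`, with the
initial data `w₀`: it is `C^{2,1}` in `Ω × (0, Tmax)`, continuous up to `∂Ω` and, if the boundary
condition contains the normal derivative, `C¹` in `x` up to `∂Ω`; it is bounded on `(0, T') × Ω`
for all finite `T' < Tmax`, and `w(t) → w₀` in `L¹(Ω)` as `t → 0`. -/
structure IsClassicalSolution {n m : ℕ} (Ω : Set (EuclideanSpace ℝ (Fin n)))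
    (lam : Fin m → ℝ) (F : (Fin m → ℝ) → (Fin m → ℝ)) (α : ℝ) (Λ : Fin m → ℝ)
    (Tmax : EReal) (w₀ : EuclideanSpace ℝ (Fin n) → Fin m → ℝ)
    (w : ℝ → EuclideanSpace ℝ (Fin n) → Fin m → ℝ) : Prop where
  Tmax_pos : 0 < Tmax
  continuousOn : ∀ l, ContinuousOn (fun q : ℝ × EuclideanSpace ℝ (Fin n) => w q.1 q.2 l)
    (times Tmax ×ˢ closure Ω)
  differentiableAt_time : ∀ l, ∀ t ∈ times Tmax, ∀ x ∈ Ω,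
    DifferentiableAt ℝ (fun s => w s x l) t
  continuousOn_deriv_time : ∀ l, ContinuousOn
    (fun q : ℝ × EuclideanSpace ℝ (Fin n) => deriv (fun s => w s q.2 l) q.1) (times Tmax ×ˢ Ω)
  contDiffOn_space : ∀ l, ∀ t ∈ times Tmax, ContDiffOn ℝ 2 (fun x => w t x l) Ω
  continuousOn_fderiv : ∀ l, ContinuousOn
    (fun q : ℝ × EuclideanSpace ℝ (Fin n) => fderiv ℝ (fun x => w q.1 x l) q.2)
    (times Tmax ×ˢ Ω)
  continuousOn_fderiv_fderiv : ∀ l, ContinuousOn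
    (fun q : ℝ × EuclideanSpace ℝ (Fin n) => fderiv ℝ (fderiv ℝ (fun x => w q.1 x l)) q.2)
    (times Tmax ×ˢ Ω)
  differentiableOn_closure : α < 1 → ∀ l, ∀ t ∈ times Tmax,
    DifferentiableOn ℝ (fun x => w t x l) (closure Ω)
  continuousOn_fderiv_closure : α < 1 → ∀ l, ContinuousOn
    (fun q : ℝ × EuclideanSpace ℝ (Fin n) =>
      fderivWithin ℝ (fun x => w q.1 x l) (closure Ω) q.2) (times Tmax ×ˢ closure Ω)
  equation : ∀ l, ∀ t ∈ times Tmax, ∀ x ∈ Ω,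
    deriv (fun s => w s x l) t - lam l * Laplacian.laplacian (fun y => w t y l) x = F (w t x) l
  boundary : ∀ l, ∀ t ∈ times Tmax, ∀ x ∈ frontier Ω, ∀ ν, IsOutwardUnitNormal Ω x ν →
    α * w t x l + (1 - α) * fderivWithin ℝ (fun y => w t y l) (closure Ω) x ν = Λ l
  bounded : ∀ T' : ℝ, (T' : EReal) < Tmax → ∃ K : ℝ, ∀ l, ∀ t, 0 < t → t < T' → ∀ x ∈ Ω,
    |w t x l| ≤ K
  initial : ∀ l, Tendsto
    (fun t => eLpNorm (fun x => w t x l - w₀ x l) 1 (volume.restrict Ω)) (𝓝[>] 0) (𝓝 0)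

/-- `u` lies in `L^∞(0, T; L^p(Ω))`, with norm at most `C`. -/
def MemLInftyLpWithBound {n : ℕ} (Ω : Set (EuclideanSpace ℝ (Fin n))) (T : ℝ) (p : ENNReal)
    (C : NNReal) (u : ℝ → EuclideanSpace ℝ (Fin n) → ℝ) : Prop :=
  AEStronglyMeasurable (fun q : ℝ × EuclideanSpace ℝ (Fin n) => u q.1 q.2)
      ((volume.restrict (Ioo 0 T)).prod (volume.restrict Ω)) ∧
    ∀ t ∈ Ioo 0 T, AEStronglyMeasurable (u t) (volume.restrict Ω) ∧
      eLpNorm (u t) p (volume.restrict Ω) ≤ C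

end ToeplitzRD

end

/-! With q = p_m - 1, the Lyapunov functional is the integral over Ω of P(w), where P(w) is the sum
over |γ| = q + 1 of (multinomial coefficient) · c(γ) · w^γ, and c(γ) = ∏ θ^(γ_l²) d_l^(γ_l). The
base θ ≥ 1 and the scales d_l ≥ 1 are chosen in the proof. Since c ≥ 1, P dominates (∑ w_l)^(q+1),
so a bound for the integral of P(w) is an L^(q+1) bound.

Differentiating P lowers the degree and shifts the argument of c. Linear inequalities between P, its
gradient and its Hessian on the nonnegative orthant therefore reduce to the same inequalities
between shifted coefficients (`sum_mul_weightedPower_le`). Two of them matter.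

Diffusion: the coefficients c(γ + e_l + e_k) form a matrix c(γ) D (J + (θ² - 1) I) D with D positive
diagonal and J the all-ones matrix. After entrywise multiplication by (λ_l + λ_k)/2 it stays
positive semidefinite once (θ² - 1) min λ ≥ m max λ (`symmetrized_hessian_nonneg`). Thus diffusion
can increase the functional only through the boundary.

Reaction: the ratio of c(γ + e_l) to c(γ + e_m) is θ^(2γ_l - 2γ_m) d_l, which exceeds the threshold
of (A3) for large d_l. Then (A3) bounds the reaction term by a multiple of 1 + P (`exists_weights`).

The Robin boundary term is bounded above because its part of top degree has a negative sign; the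
Neumann term is zero. Gronwall's inequality finishes the estimate.

Second derivatives exist only inside Ω, so integration by parts is tested with cutoffs that tend to
1. The flux through the vanishing layer is controlled without surface measure: the mass of the layer
is bounded by comparison with a direction transversal to the boundary (`integral_layer_le`,
`Collar.eventually_flux_le`). Under Dirichlet conditions the gradient need not extend to the
boundary. There P is composed with a truncation that vanishes near 0, so that the flux vanishes near
the boundary, and the error is O(ε) (`exists_truncation_error`). All this needs w ≥ 0, which follows
from the same energy inequality for the density ∑ ((w_l + ε)⁻)⁴ (`IsClassicalSolution.nonneg`). -/

noncomputable section

namespace ToeplitzRD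

section

/-! ### Homogeneous polynomials with weighted multinomial coefficients -/

section WeightedPower

variable {ι : Type*} [Fintype ι]

lemma finite_setOf_sum_eq (N : ℕ) : {γ : ι → ℕ | ∑ l, γ l = N}.Finite := by
  refine (Set.Finite.pi' (fun _ : ι => Set.finite_Iic N)).subset fun γ hγ l => ?_
  rw [Set.mem_Iic, ← (hγ : _ = N)]
  exact Finset.single_le_sum (f := γ) (fun _ _ => Nat.zero_le _) (Finset.mem_univ l)

/-- The weights `θ^{∑ γ_l²} ∏ d_l^{γ_l}`. -/
def gaussWeight (θ : ℝ) (d : ι → ℝ) (γ : ι → ℕ) : ℝ :=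
  ∏ l, (θ ^ (γ l ^ 2) * d l ^ γ l)

lemma one_le_gaussWeight {θ : ℝ} (hθ : 1 ≤ θ) {d : ι → ℝ} (hd : ∀ l, 1 ≤ d l) (γ : ι → ℕ) :
    1 ≤ gaussWeight θ d γ := by
  refine Finset.prod_induction _ (fun x : ℝ => 1 ≤ x) (fun a b => one_le_mul_of_one_le_of_one_le)
    le_rfl fun l _ => ?_
  exact one_le_mul_of_one_le_of_one_le (one_le_pow₀ hθ) (one_le_pow₀ (hd l))

variable [DecidableEq ι]

/-- The polynomial `∑ c (γ + e_{s 1} + ⋯ + e_{s q}) w_{s 1} ⋯ w_{s q}`, where the sum is over all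
`s : {1, …, q} → ι`. -/
def weightedPower (c : (ι → ℕ) → ℝ) : ℕ → (ι → ℕ) → (ι → ℝ) → ℝ
  | 0, γ, _ => c γ
  | q + 1, γ, w => ∑ l, w l * weightedPower c q (γ + Pi.single l 1) w

/-- Since `c` sees only the sum of the unit vectors, each of the `q` factors contributes equally to
a partial derivative, which is again a polynomial of this kind with `γ` shifted. The truncated `q -
1` is harmless at `q = 0` because of the factor `q`. -/
lemma weightedPower_hasFDerivAt (c : (ι → ℕ) → ℝ) (q : ℕ) (γ : ι → ℕ) (w : ι → ℝ) :
    HasFDerivAt (weightedPower c q γ)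
      (∑ l, ((q : ℝ) * weightedPower c (q - 1) (γ + Pi.single l 1) w) •
        (ContinuousLinearMap.proj l : (ι → ℝ) →L[ℝ] ℝ)) w := by
  induction q generalizing γ with
  | zero =>
    simp only [Nat.cast_zero, zero_mul, zero_smul, Finset.sum_const_zero]
    exact hasFDerivAt_const (c γ) w
  | succ q ih =>
    have h : HasFDerivAt (fun v : ι → ℝ => ∑ l, v l * weightedPower c q (γ + Pi.single l 1) v)
        (∑ l, (w l • (∑ k, ((q : ℝ) * weightedPower c (q - 1) (γ + Pi.single l 1 + Pi.single k 1) w) •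
          (ContinuousLinearMap.proj k : (ι → ℝ) →L[ℝ] ℝ))
          + weightedPower c q (γ + Pi.single l 1) w •
            (ContinuousLinearMap.proj l : (ι → ℝ) →L[ℝ] ℝ))) w := by
      refine HasFDerivAt.fun_sum fun l _ => ?_
      exact ((ContinuousLinearMap.proj (R := ℝ) (φ := fun _ : ι => ℝ) l).hasFDerivAt).mul (ih _)
    refine h.congr_fderiv ?_
    rw [Finset.sum_add_distrib]
    simp_rw [Finset.smul_sum]
    rw [Finset.sum_comm, ← Finset.sum_add_distrib]
    refine Finset.sum_congr rfl fun k _ => ?_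
    simp_rw [smul_smul]
    rw [← Finset.sum_smul, ← add_smul]
    congr 1
    rcases q with _ | q
    · simp
    · have : weightedPower c (q + 1) (γ + Pi.single k 1) w
          = ∑ l, w l * weightedPower c q (γ + Pi.single l 1 + Pi.single k 1) w := by
        simp only [weightedPower]
        refine Finset.sum_congr rfl fun l _ => ?_
        rw [add_right_comm]
      simp only [Nat.add_sub_cancel]
      rw [this]
      push_cast
      rw [Finset.mul_sum, ← Finset.sum_add_distrib]
      refine Finset.sum_congr rfl fun l _ => ?_
      ring

lemma weightedPower_continuous (c : (ι → ℕ) → ℝ) (q : ℕ) (γ : ι → ℕ) :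
    Continuous (weightedPower c q γ) :=
  continuous_iff_continuousAt.2 fun w => (weightedPower_hasFDerivAt c q γ w).continuousAt

/-- A linear inequality between the coefficients of degree `∑ γ + q` carries over to the
polynomials. -/
lemma sum_mul_weightedPower_le {J : Type*} [Fintype J] (c : (ι → ℕ) → ℝ) (a : J → ℝ)
    (β : J → ι → ℕ) {w : ι → ℝ} (hw : ∀ l, 0 ≤ w l) (R : ℝ) (q : ℕ) (γ : ι → ℕ)
    (h : ∀ γ' : ι → ℕ, ∑ l, γ' l = ∑ l, γ l + q → ∑ j, a j * c (γ' + β j) ≤ R) :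
    ∑ j, a j * weightedPower c q (γ + β j) w ≤ R * (∑ l, w l) ^ q := by
  induction q generalizing γ with
  | zero => simpa [weightedPower] using h γ (by simp)
  | succ q ih =>
    have h1 : ∀ l, ∑ j, a j * weightedPower c q (γ + Pi.single l 1 + β j) w
        ≤ R * (∑ l, w l) ^ q := by
      intro l
      refine ih _ fun γ' hγ' => h γ' ?_
      rw [hγ']
      simp [Finset.sum_add_distrib]
      ring
    calc ∑ j, a j * weightedPower c (q + 1) (γ + β j) w
        = ∑ l, w l * ∑ j, a j * weightedPower c q (γ + Pi.single l 1 + β j) w := by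
          simp only [weightedPower, Finset.mul_sum]
          rw [Finset.sum_comm]
          refine Finset.sum_congr rfl fun l _ => Finset.sum_congr rfl fun j _ => ?_
          rw [add_right_comm]; ring
      _ ≤ ∑ l, w l * (R * (∑ l, w l) ^ q) :=
          Finset.sum_le_sum fun l _ => mul_le_mul_of_nonneg_left (h1 l) (hw l)
      _ = R * (∑ l, w l) ^ (q + 1) := by rw [← Finset.sum_mul]; ring

lemma weightedPower_nonneg {c : (ι → ℕ) → ℝ} (hc : ∀ γ, 0 ≤ c γ) {w : ι → ℝ}
    (hw : ∀ l, 0 ≤ w l) (q : ℕ) (γ : ι → ℕ) : 0 ≤ weightedPower c q γ w := by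
  have := sum_mul_weightedPower_le (J := Unit) c (fun _ => -1) (fun _ => 0) hw 0 q γ
    (fun γ' _ => by simpa using hc γ')
  simpa using this

lemma sum_pow_le_weightedPower {c : (ι → ℕ) → ℝ} (hc : ∀ γ, 1 ≤ c γ) {w : ι → ℝ}
    (hw : ∀ l, 0 ≤ w l) (q : ℕ) (γ : ι → ℕ) : (∑ l, w l) ^ q ≤ weightedPower c q γ w := by
  have := sum_mul_weightedPower_le (J := Unit) c (fun _ => -1) (fun _ => 0) hw (-1) q γ
    (fun γ' _ => by simpa using hc γ')
  simpa using this

/-- Only the finitely many multi-indices of degree `∑ γ + q` enter, so the values of `c` that occur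
are bounded. -/
lemma exists_weightedPower_le (c : (ι → ℕ) → ℝ) (q : ℕ) (γ : ι → ℕ) :
    ∃ C, 0 ≤ C ∧ ∀ w : ι → ℝ, (∀ l, 0 ≤ w l) →
      weightedPower c q γ w ≤ C * (∑ l, w l) ^ q := by
  obtain ⟨C, hC⟩ := ((finite_setOf_sum_eq (∑ l, γ l + q)).image c).bddAbove
  refine ⟨max C 0, le_max_right _ _, fun w hw => ?_⟩
  have := sum_mul_weightedPower_le (J := Unit) c (fun _ => 1) (fun _ => 0) hw (max C 0) q γ
    (fun γ' hγ' => by simpa using Or.inl (hC (mem_image_of_mem c hγ')))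
  simpa using this

lemma gaussWeight_add_single (θ : ℝ) (d : ι → ℝ) (γ : ι → ℕ) (l : ι) :
    gaussWeight θ d (γ + Pi.single l 1) = gaussWeight θ d γ * (θ ^ (2 * γ l + 1) * d l) := by
  unfold gaussWeight
  rw [← Finset.mul_prod_erase _ _ (Finset.mem_univ l),
    ← Finset.mul_prod_erase (a := l) (f := fun l => θ ^ (γ l ^ 2) * d l ^ γ l) _
      (Finset.mem_univ l)]
  have : ∏ x ∈ Finset.univ.erase l, (θ ^ ((γ + Pi.single l 1 : ι → ℕ) x ^ 2) *
      d x ^ (γ + Pi.single l 1 : ι → ℕ) x) = ∏ x ∈ Finset.univ.erase l, (θ ^ (γ x ^ 2) * d x ^ γ x) := by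
    refine Finset.prod_congr rfl fun x hx => ?_
    simp [Pi.single_eq_of_ne (Finset.ne_of_mem_erase hx)]
  rw [this]
  simp only [Pi.add_apply, Pi.single_eq_same]
  ring

/-- The second difference of `x²` is 2, so a repeated direction gains an extra `θ ^ 2`. This gain on
the diagonal is what makes the Hessian positive semidefinite for large `θ`. -/
lemma gaussWeight_add_single_add_single (θ : ℝ) (d : ι → ℝ) (γ : ι → ℕ) (l k : ι) :
    gaussWeight θ d (γ + Pi.single l 1 + Pi.single k 1) = gaussWeight θ d γ *
      ((θ ^ (2 * γ l + 1) * d l) * (θ ^ (2 * γ k + 1) * d k)) * (if l = k then θ ^ 2 else 1) := by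
  rw [gaussWeight_add_single, gaussWeight_add_single]
  by_cases h : l = k
  · subst h
    simp only [Pi.add_apply, Pi.single_eq_same, if_true]
    ring
  · simp only [Pi.add_apply, Pi.single_eq_of_ne (Ne.symm h), if_neg h]
    ring

/-- The symmetrized product of a large multiple of the identity plus the all-ones matrix with
a positive diagonal matrix is positive semidefinite. -/
lemma symmetrized_form_nonneg {lam : ι → ℝ} {lmin lmax : ℝ} (hmin : ∀ l, lmin ≤ lam l)
    (hmax : ∀ l, lam l ≤ lmax) (hpos : 0 < lmin) {τ : ℝ}
    (hτ : (Fintype.card ι : ℝ) * lmax ≤ (τ - 1) * lmin) (hτ1 : 1 ≤ τ) (v : ι → ℝ) :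
    0 ≤ ∑ l, ∑ k, (lam l + lam k) / 2 * (if l = k then τ else 1) * (v l * v k) := by
  have e1 : ∑ l, ∑ k, (lam l + lam k) / 2 * (if l = k then τ else 1) * (v l * v k)
      = ∑ l, ∑ k, (lam l + lam k) / 2 * (v l * v k) + (τ - 1) * ∑ l, lam l * v l ^ 2 := by
    rw [Finset.mul_sum, ← Finset.sum_add_distrib]
    refine Finset.sum_congr rfl fun l _ => ?_
    have : (τ - 1) * (lam l * v l ^ 2)
        = ∑ k, if l = k then (τ - 1) * ((lam l + lam k) / 2 * (v l * v k)) else 0 := by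
      rw [Finset.sum_ite_eq, if_pos (Finset.mem_univ l)]
      ring
    rw [this, ← Finset.sum_add_distrib]
    refine Finset.sum_congr rfl fun k _ => ?_
    split_ifs <;> ring
  -- Termwise, `v l * v k ≥ -(v l ^ 2 + v k ^ 2) / 2` and the averaged coefficient is at most
  -- `lmax`.
  have e2 : -(Fintype.card ι * lmax * ∑ l, v l ^ 2)
      ≤ ∑ l, ∑ k, (lam l + lam k) / 2 * (v l * v k) := by
    have : ∑ l : ι, ∑ k : ι, (-(lmax * (v l ^ 2 + v k ^ 2) / 2))
        = -(Fintype.card ι * lmax * ∑ l, v l ^ 2) := by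
      have h1 : ∀ l k : ι, -(lmax * (v l ^ 2 + v k ^ 2) / 2)
        = (-(lmax / 2)) * v l ^ 2 + (-(lmax / 2)) * v k ^ 2 := fun l k => by ring
      simp_rw [h1, Finset.sum_add_distrib, ← Finset.mul_sum, Finset.sum_const, Finset.card_univ,
        nsmul_eq_mul, ← Finset.mul_sum]
      ring
    rw [← this]
    refine Finset.sum_le_sum fun l _ => Finset.sum_le_sum fun k _ => ?_
    nlinarith [sq_nonneg (v l + v k), sq_nonneg (v l - v k), hmin l, hmin k, hmax l, hmax k,
      mul_nonneg (by linarith [hmin l, hmin k] : 0 ≤ lam l + lam k) (sq_nonneg (v l + v k)),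
      mul_nonneg (by linarith [hmax l, hmax k] : 0 ≤ 2 * lmax - (lam l + lam k))
        (add_nonneg (sq_nonneg (v l)) (sq_nonneg (v k)))]
  have e3 : lmin * ∑ l, v l ^ 2 ≤ ∑ l, lam l * v l ^ 2 := by
    rw [Finset.mul_sum]
    exact Finset.sum_le_sum fun l _ => mul_le_mul_of_nonneg_right (hmin l) (sq_nonneg _)
  have e4 : 0 ≤ ∑ l, v l ^ 2 := Finset.sum_nonneg fun l _ => sq_nonneg _
  rw [e1]
  nlinarith [mul_le_mul_of_nonneg_left e3 (sub_nonneg.2 hτ1), mul_le_mul_of_nonneg_right hτ e4]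

/-- The Hessian of the polynomial with Gaussian weights, symmetrized with the diffusion
coefficients, is positive semidefinite on the nonnegative orthant. -/
lemma symmetrized_hessian_nonneg {lam : ι → ℝ} {lmin lmax : ℝ} (hmin : ∀ l, lmin ≤ lam l)
    (hmax : ∀ l, lam l ≤ lmax) (hpos : 0 < lmin) {θ : ℝ} (hθ : 1 ≤ θ)
    (hτ : (Fintype.card ι : ℝ) * lmax ≤ (θ ^ 2 - 1) * lmin) {d : ι → ℝ} (hd : ∀ l, 1 ≤ d l)
    {w : ι → ℝ} (hw : ∀ l, 0 ≤ w l) (q : ℕ) (γ : ι → ℕ) (z : ι → ℝ) :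
    0 ≤ ∑ l, ∑ k, (lam l + lam k) / 2 *
      weightedPower (gaussWeight θ d) q (γ + Pi.single l 1 + Pi.single k 1) w * (z l * z k) := by
  -- The form is linear in the shifted polynomials, so its sign is checked on coefficients, indexed
  -- by pairs `(l, k)`. The sign is reversed because the comparison yields upper bounds.
  have key := sum_mul_weightedPower_le (J := ι × ι) (gaussWeight θ d)
    (fun j => -((lam j.1 + lam j.2) / 2 * (z j.1 * z j.2)))
    (fun j => Pi.single j.1 1 + Pi.single j.2 1) hw 0 q γ ?_
  · rw [Fintype.sum_prod_type, zero_mul] at key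
    simp_rw [← add_assoc, neg_mul, Finset.sum_neg_distrib] at key
    refine (neg_nonpos.1 key).trans_eq ?_
    refine Finset.sum_congr rfl fun l _ => Finset.sum_congr rfl fun k _ => ?_
    ring
  · intro γ' _
    rw [Fintype.sum_prod_type]
    simp_rw [← add_assoc, gaussWeight_add_single_add_single, neg_mul, Finset.sum_neg_distrib]
    rw [neg_nonpos]
    have h := symmetrized_form_nonneg hmin hmax hpos hτ (one_le_pow₀ hθ)
      (fun l => θ ^ (2 * γ' l + 1) * d l * z l)
    have h0 : 0 ≤ gaussWeight θ d γ' := zero_le_one.trans (one_le_gaussWeight hθ hd γ')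
    refine (mul_nonneg h0 h).trans_eq ?_
    simp_rw [Finset.mul_sum]
    refine Finset.sum_congr rfl fun l _ => Finset.sum_congr rfl fun k _ => ?_
    ring

end WeightedPower

end

/-! ### Choice of the weights, the Robin boundary term, and positivity of the diffusion coefficients
-/

section

/-- A single choice of coefficients has to serve diffusion and reaction. The base of the Gaussian
weights is fixed first by the spread of the `lam l`, the scales afterwards by the thresholds `dbar`;
the Hessian condition holds for every choice of scales at least 1. -/
lemma exists_weights {m : ℕ} {lam : Fin m → ℝ} (hlam : ∀ l, 0 < lam l)
    {F : (Fin m → ℝ) → (Fin m → ℝ)} {dbar : Fin m → ℝ} (hF : LyapunovCondition F dbar) (q : ℕ)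
    (hm : 0 < m) :
    ∃ c : (Fin m → ℕ) → ℝ, (∀ γ, 1 ≤ c γ) ∧
      (∀ w : Fin m → ℝ, (∀ l, 0 ≤ w l) → ∀ (r : ℕ) (γ : Fin m → ℕ) (z : Fin m → ℝ),
        0 ≤ ∑ l, ∑ k, (lam l + lam k) / 2 *
          weightedPower c r (γ + Pi.single l 1 + Pi.single k 1) w * (z l * z k)) ∧
      ∃ K, 0 ≤ K ∧ ∀ w : Fin m → ℝ, (∀ l, 0 ≤ w l) →
        ∑ l, weightedPower c q (Pi.single l 1) w * F w l
          ≤ K * (1 + weightedPower c (q + 1) 0 w) := by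
  have : Nonempty (Fin m) := ⟨⟨0, hm⟩⟩
  obtain ⟨lmin, hmin0, hmin⟩ : ∃ lmin, 0 < lmin ∧ ∀ l, lmin ≤ lam l := by
    obtain ⟨i, hi⟩ := Finite.exists_min lam
    exact ⟨lam i, hlam i, hi⟩
  obtain ⟨i, hmax⟩ := Finite.exists_max lam
  set lmax := lam i
  have hmax0 : 0 < lmax := hlam i
  set θ : ℝ := 1 + m * lmax / lmin with hθdef
  have hA : 0 ≤ m * lmax / lmin := by positivity
  have hθ : 1 ≤ θ := by linarith
  have hτ : (Fintype.card (Fin m) : ℝ) * lmax ≤ (θ ^ 2 - 1) * lmin := by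
    rw [Fintype.card_fin]
    have h1 : m * lmax / lmin ≤ θ ^ 2 - 1 := by nlinarith
    have := mul_le_mul_of_nonneg_right h1 hmin0.le
    rwa [div_mul_cancel₀ _ hmin0.ne'] at this
  set last : Fin m := ⟨m - 1, by omega⟩
  -- The factor `θ ^ (2 * q)` absorbs the worst quotient `θ ^ (2 * γ l - 2 * γ last)`, since `γ last
  -- ≤ q`. The quotient by the last coefficient then stays above `dbar l` for every multi-index of
  -- degree `q`.
  set d : Fin m → ℝ := fun l => if l = last then 1 else max 1 (dbar l) * θ ^ (2 * q) with hd_def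
  have hd : ∀ l, 1 ≤ d l := by
    intro l
    simp only [hd_def]
    split_ifs
    · exact le_rfl
    · exact one_le_mul_of_one_le_of_one_le (le_max_left _ _) (one_le_pow₀ hθ)
  refine ⟨gaussWeight θ d, one_le_gaussWeight hθ hd,
    fun w hw r γ z => symmetrized_hessian_nonneg hmin hmax hmin0 hθ hτ hd hw r γ z, ?_⟩
  have hθ0 : 0 < θ := by linarith
  -- Condition (A3) is applied with `S` equal to the shifted coefficients divided by the last one.
  -- Its constant depends on `γ`, but only finitely many `γ` have degree `q`; the implication inside
  -- the existential allows a choice for all `γ`.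
  have h1 : ∀ γ : Fin m → ℕ, ∃ C : ℝ, ∑ l, γ l = q → ∀ w : Fin m → ℝ, (∀ l, 0 ≤ w l) →
      ∑ l, F w l * gaussWeight θ d (γ + Pi.single l 1) ≤ C * (1 + ∑ l, w l) := by
    intro γ
    by_cases hγ : ∑ l, γ l = q
    swap
    · exact ⟨0, fun h => (hγ h).elim⟩
    have hlast : γ last ≤ q := by
      rw [← hγ]
      exact Finset.single_le_sum (f := γ) (fun _ _ => Nat.zero_le _) (Finset.mem_univ _)
    have h2 : ∀ l : Fin m, l.val + 1 < m →
        dbar l ≤ θ ^ (2 * γ l + 1) * d l / θ ^ (2 * γ last + 1) := by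
      intro l hl
      have hne : l ≠ last := by
        rintro rfl
        simp [last] at hl
        omega
      simp only [hd_def, if_neg hne]
      rw [le_div_iff₀ (by positivity)]
      have e1 : θ ^ (2 * γ last + 1) ≤ θ ^ (2 * γ l + 1) * θ ^ (2 * q) := by
        rw [← pow_add]
        exact pow_le_pow_right₀ hθ (by omega)
      have e2 : dbar l ≤ max 1 (dbar l) := le_max_right _ _
      have e3 : (0 : ℝ) ≤ max 1 (dbar l) := zero_le_one.trans (le_max_left _ _)
      calc dbar l * θ ^ (2 * γ last + 1) ≤ max 1 (dbar l) * θ ^ (2 * γ last + 1) :=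
            mul_le_mul_of_nonneg_right e2 (by positivity)
        _ ≤ max 1 (dbar l) * (θ ^ (2 * γ l + 1) * θ ^ (2 * q)) :=
            mul_le_mul_of_nonneg_left e1 e3
        _ = _ := by ring
    have h3 : ∀ l : Fin m, l.val + 1 = m →
        θ ^ (2 * γ l + 1) * d l / θ ^ (2 * γ last + 1) = 1 := by
      intro l hl
      have : l = last := by
        ext
        simp only [last]
        omega
      subst this
      simp only [hd_def, if_true, mul_one]
      exact div_self (by positivity)
    obtain ⟨C, hC⟩ := hF (fun l => θ ^ (2 * γ l + 1) * d l / θ ^ (2 * γ last + 1)) h2 h3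
    refine ⟨gaussWeight θ d γ * θ ^ (2 * γ last + 1) * C, fun _ w hw => ?_⟩
    have hpos : 0 ≤ gaussWeight θ d γ * θ ^ (2 * γ last + 1) :=
      mul_nonneg (zero_le_one.trans (one_le_gaussWeight hθ hd γ)) (by positivity)
    rw [mul_assoc]
    refine le_trans (le_of_eq ?_) (mul_le_mul_of_nonneg_left (hC w hw) hpos)
    rw [Finset.mul_sum]
    refine Finset.sum_congr rfl fun l _ => ?_
    rw [gaussWeight_add_single]
    field_simp
  choose C hC using h1
  obtain ⟨K, hK⟩ := ((finite_setOf_sum_eq (ι := Fin m) q).image C).bddAbove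
  refine ⟨2 * max K 0, by positivity, fun w hw => ?_⟩
  set s := ∑ l, w l with hs
  have hs0 : 0 ≤ s := Finset.sum_nonneg fun l _ => hw l
  have key := sum_mul_weightedPower_le (gaussWeight θ d) (F w) (fun l => Pi.single l 1) hw
    (max K 0 * (1 + s)) q 0 fun γ hγ => by
      have hγ' : ∑ l, γ l = q := by simpa using hγ
      refine (hC γ hγ' w hw).trans (mul_le_mul_of_nonneg_right ?_ (by positivity))
      exact (hK (mem_image_of_mem C hγ')).trans (le_max_left _ _)
  simp only [zero_add] at key
  have hP := sum_pow_le_weightedPower (one_le_gaussWeight hθ hd) hw (q + 1) 0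
  -- The lower power from `(1 + s) * s ^ q` is absorbed, so that only 1 and the top power, hence the
  -- polynomial itself, remain.
  have hsq : s ^ q ≤ 1 + s ^ (q + 1) := by
    rcases le_total s 1 with h | h
    · exact (pow_le_one₀ hs0 h).trans (by linarith [pow_nonneg hs0 (q + 1)])
    · linarith [pow_le_pow_right₀ h (by omega : q ≤ q + 1)]
  calc ∑ l, weightedPower (gaussWeight θ d) q (Pi.single l 1) w * F w l
      = ∑ l, F w l * weightedPower (gaussWeight θ d) q (Pi.single l 1) w := by
        simp_rw [mul_comm]
    _ ≤ max K 0 * (1 + s) * s ^ q := key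
    _ = max K 0 * (s ^ q + s ^ (q + 1)) := by ring
    _ ≤ max K 0 * (2 * (1 + weightedPower (gaussWeight θ d) (q + 1) 0 w)) :=
        mul_le_mul_of_nonneg_left (by linarith) (le_max_right _ _)
    _ = _ := by ring

/-- With `s` the sum of the components, the boundary term is at most `A * s ^ q - e * s ^ (q + 1)`
with `e > 0`. This is nonpositive for `s ≥ A / e` and at most `A * (A / e) ^ q` otherwise. -/
lemma exists_robin_bound {m : ℕ} {lam : Fin m → ℝ} (hlam : ∀ l, 0 < lam l) (hm : 0 < m)
    {c : (Fin m → ℕ) → ℝ} (hc : ∀ γ, 1 ≤ c γ) {α : ℝ} (hα : 0 < α) {Λ : Fin m → ℝ}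
    (hΛ : ∀ l, 0 ≤ Λ l) (q : ℕ) :
    ∃ B, 0 ≤ B ∧ ∀ w : Fin m → ℝ, (∀ l, 0 ≤ w l) →
      ∑ l, lam l * weightedPower c q (Pi.single l 1) w * (Λ l - α * w l) ≤ B := by
  have : Nonempty (Fin m) := ⟨⟨0, hm⟩⟩
  obtain ⟨i, hi⟩ := Finite.exists_min lam
  choose C hC0 hC using fun l : Fin m => exists_weightedPower_le c q (Pi.single l 1)
  set A := ∑ l, lam l * C l * Λ l with hA
  have hA0 : 0 ≤ A :=
    Finset.sum_nonneg fun l _ => mul_nonneg (mul_nonneg (hlam l).le (hC0 l)) (hΛ l)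
  set e := α * lam i with he
  have he0 : 0 < e := mul_pos hα (hlam i)
  refine ⟨A * (A / e) ^ q, by positivity, fun w hw => ?_⟩
  set s := ∑ l, w l with hs
  have hs0 : 0 ≤ s := Finset.sum_nonneg fun l _ => hw l
  have hP := sum_pow_le_weightedPower hc hw (q + 1) 0
  have hnn : ∀ l, 0 ≤ weightedPower c q (Pi.single l 1) w := fun l =>
    weightedPower_nonneg (fun γ => zero_le_one.trans (hc γ)) hw q _
  have h1 : ∑ l, lam l * weightedPower c q (Pi.single l 1) w * (Λ l - α * w l)
      ≤ A * s ^ q - e * s ^ (q + 1) := by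
    have h2 : e * s ^ (q + 1) ≤ ∑ l, α * lam i * (w l * weightedPower c q (Pi.single l 1) w) := by
      rw [← Finset.mul_sum]
      refine mul_le_mul_of_nonneg_left ?_ he0.le
      simpa [weightedPower] using hP
    have h3 : A * s ^ q = ∑ l, lam l * (C l * s ^ q) * Λ l := by
      rw [hA, Finset.sum_mul]
      exact Finset.sum_congr rfl fun l _ => by ring
    refine le_trans ?_ (sub_le_sub_left h2 _)
    rw [h3, ← Finset.sum_sub_distrib]
    refine Finset.sum_le_sum fun l _ => ?_
    have e1 : lam l * weightedPower c q (Pi.single l 1) w * Λ l ≤ lam l * (C l * s ^ q) * Λ l :=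
      mul_le_mul_of_nonneg_right (mul_le_mul_of_nonneg_left (hC l w hw) (hlam l).le) (hΛ l)
    have e2 : α * lam i * (w l * weightedPower c q (Pi.single l 1) w)
        ≤ α * lam l * (w l * weightedPower c q (Pi.single l 1) w) :=
      mul_le_mul_of_nonneg_right (mul_le_mul_of_nonneg_left (hi l) hα.le)
        (mul_nonneg (hw l) (hnn l))
    linarith
  refine h1.trans ?_
  rcases le_total s (A / e) with h | h
  · have := mul_le_mul_of_nonneg_left (pow_le_pow_left₀ hs0 h q) hA0
    linarith [mul_nonneg he0.le (pow_nonneg hs0 (q + 1))]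
  · have h4 : A ≤ e * s := by
      rw [div_le_iff₀ he0] at h
      linarith
    have h5 := mul_le_mul_of_nonneg_right h4 (pow_nonneg hs0 q)
    have h6 : e * s ^ (q + 1) = e * s * s ^ q := by ring
    have : 0 ≤ A * (A / e) ^ q := by positivity
    linarith

/-- Every eigenvalue is at least `a - 2 √(bc) cos (π / (m + 1))`, and `2 √(bc) ≤ b + c` reduces its
positivity to the parabolicity condition. -/
lemma eigenvalue_pos {m : ℕ} (hm : 2 ≤ m) {a b c : ℝ} (hb : 0 < b) (hc : 0 < c)
    (hpar : Real.cos (Real.pi / ((m : ℝ) + 1)) < a / (b + c)) {l : ℕ} (hl : 1 ≤ l) (hlm : l ≤ m) :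
    0 < eigenvalue m a b c l := by
  have hm1 : (0 : ℝ) < (m : ℝ) + 1 := by positivity
  have hm2 : (2 : ℝ) ≤ m := by exact_mod_cast hm
  have hl1 : (1 : ℝ) ≤ l := by exact_mod_cast hl
  have hl2 : (l : ℝ) ≤ m := by exact_mod_cast hlm
  have hpi := Real.pi_pos
  set x := Real.pi / ((m : ℝ) + 1) with hx
  have hxm : x * ((m : ℝ) + 1) = Real.pi := div_mul_cancel₀ _ hm1.ne'
  have hx0 : 0 < x := by positivity
  have hcos : 0 < Real.cos x := Real.cos_pos_of_mem_Ioo ⟨by linarith, by nlinarith⟩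
  have h1 : -Real.cos x ≤ Real.cos (((m : ℝ) + 1 - (l : ℝ)) * Real.pi / ((m : ℝ) + 1)) := by
    rw [← Real.cos_pi_sub]
    have e : ((m : ℝ) + 1 - (l : ℝ)) * Real.pi / ((m : ℝ) + 1) = Real.pi - l * x := by
      rw [hx]; field_simp
    rw [e]
    exact Real.cos_le_cos_of_nonneg_of_le_pi (by nlinarith) (by nlinarith) (by nlinarith)
  have h2 : 2 * Real.sqrt (b * c) ≤ b + c := by
    rw [Real.sqrt_mul hb.le]
    nlinarith [sq_nonneg (Real.sqrt b - Real.sqrt c), Real.sq_sqrt hb.le, Real.sq_sqrt hc.le]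
  have h3 : Real.cos x * (b + c) < a := (lt_div_iff₀ (by positivity)).1 hpar
  have h4 : 0 ≤ 2 * Real.sqrt (b * c) := by positivity
  unfold eigenvalue
  nlinarith [mul_le_mul_of_nonneg_left h1 h4, mul_le_mul_of_nonneg_right h2 hcos.le]

end

section

/-! ### Cutoff functions -/

section Extension

variable {V : Type*} [NormedAddCommGroup V]

/-- No regularity of `h` outside `U` is needed: near a point off `tsupport φ` the product is
identically zero. -/
lemma continuous_mul_of_tsupport_subset {φ h : V → ℝ} {U : Set V} (hU : IsOpen U)
    (hφ : Continuous φ) (hh : ContinuousOn h U) (hs : tsupport φ ⊆ U) :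
    Continuous fun x => φ x * h x := by
  refine continuous_iff_continuousAt.2 fun x => ?_
  by_cases hx : x ∈ U
  · exact hφ.continuousAt.mul (hh.continuousAt (hU.mem_nhds hx))
  · have h0 : (fun _ : V => (0 : ℝ)) =ᶠ[𝓝 x] fun x => φ x * h x := by
      filter_upwards [(isClosed_tsupport φ).isOpen_compl.mem_nhds fun hx' => hx (hs hx')] with y hy
      rw [image_eq_zero_of_notMem_tsupport hy, zero_mul]
    exact continuousAt_const.congr h0

variable [NormedSpace ℝ V]

lemma contDiff_mul_of_tsupport_subset {φ h : V → ℝ} {U : Set V} (hU : IsOpen U)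
    (hφ : ContDiff ℝ 1 φ) (hh : ContDiffOn ℝ 1 h U) (hs : tsupport φ ⊆ U) :
    ContDiff ℝ 1 fun x => φ x * h x := by
  refine contDiff_iff_contDiffAt.2 fun x => ?_
  by_cases hx : x ∈ U
  · exact hφ.contDiffAt.mul (hh.contDiffAt (hU.mem_nhds hx))
  · have h0 : (fun x => φ x * h x) =ᶠ[𝓝 x] fun _ : V => (0 : ℝ) := by
      filter_upwards [(isClosed_tsupport φ).isOpen_compl.mem_nhds fun hx' => hx (hs hx')] with y hy
      rw [image_eq_zero_of_notMem_tsupport hy, zero_mul]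
    exact contDiffAt_const.congr_of_eventuallyEq h0

/-- Integration by parts against the constant 1. This is the only form of the divergence theorem on
which the argument relies. -/
lemma integral_fderiv_eq_zero [FiniteDimensional ℝ V] [MeasurableSpace V] [BorelSpace V]
    {μ : Measure V} [μ.IsAddHaarMeasure] {f : V → ℝ} (hf : ContDiff ℝ 1 f)
    (hc : HasCompactSupport f) (v : V) : ∫ x, fderiv ℝ f x v ∂μ = 0 := by
  have hi : Integrable (fun x => fderiv ℝ f x v) μ :=
    ((hf.continuous_fderiv one_ne_zero).clm_apply continuous_const).integrable_of_hasCompactSupport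
      (hc.fderiv_apply ℝ v)
  have := integral_mul_fderiv_eq_neg_fderiv_mul_of_integrable (μ := μ) (f := fun _ => (1 : ℝ))
    (g := f) (v := v) (by simp) (by simpa using hi)
    (by simpa using hf.continuous.integrable_of_hasCompactSupport hc)
    (fun x _ => differentiableAt_const _) (fun x _ => (hf.differentiable one_ne_zero) x)
  simpa using this

end Extension

/-- A smooth function that decreases from `1` on `(-∞, -1]` to `0` on `[-1/2, ∞)`. -/
def smoothStep (s : ℝ) : ℝ := Real.smoothTransition (-2 * s - 1)

lemma smoothStep_contDiff : ContDiff ℝ 1 smoothStep :=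
  (Real.smoothTransition.contDiff (n := 1)).comp (by fun_prop)

lemma smoothStep_nonneg (s : ℝ) : 0 ≤ smoothStep s := Real.smoothTransition.nonneg _

lemma smoothStep_le_one (s : ℝ) : smoothStep s ≤ 1 := Real.smoothTransition.le_one _

lemma smoothStep_eq_one {s : ℝ} (hs : s ≤ -1) : smoothStep s = 1 :=
  Real.smoothTransition.one_of_one_le (by linarith)

lemma smoothStep_eq_zero {s : ℝ} (hs : -1 / 2 ≤ s) : smoothStep s = 0 :=
  Real.smoothTransition.zero_of_nonpos (by linarith)

/-- After clearing denominators this is the product of the monotonicity of `expNegInvGlue` at `x`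
and at `1 - x`. -/
lemma monotone_smoothTransition : Monotone Real.smoothTransition := by
  intro x y hxy
  unfold Real.smoothTransition
  have hx := Real.smoothTransition.pos_denom x
  have hy := Real.smoothTransition.pos_denom y
  rw [div_le_div_iff₀ hx hy]
  have h1 := expNegInvGlue.monotone hxy
  have h2 := expNegInvGlue.monotone (by linarith : 1 - y ≤ 1 - x)
  nlinarith [expNegInvGlue.nonneg x, expNegInvGlue.nonneg y, expNegInvGlue.nonneg (1 - x),
    expNegInvGlue.nonneg (1 - y),
    mul_le_mul h1 h2 (expNegInvGlue.nonneg _) (expNegInvGlue.nonneg _)]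

lemma antitone_smoothStep : Antitone smoothStep := fun _ _ h =>
  monotone_smoothTransition (by linarith)

lemma deriv_smoothStep_nonpos (s : ℝ) : deriv smoothStep s ≤ 0 :=
  antitone_smoothStep.deriv_nonpos

lemma deriv_smoothStep_eq_zero {s : ℝ} (hs : s < -1) : deriv smoothStep s = 0 := by
  have : smoothStep =ᶠ[𝓝 s] fun _ => 1 := by
    filter_upwards [Iio_mem_nhds hs] with y hy using smoothStep_eq_one (le_of_lt hy)
  rw [this.deriv_eq, deriv_const]

variable {n : ℕ}

/-- Near a boundary point, a defining function that increases uniformly in some direction. -/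
lemma IsBoundedC1Domain.exists_patch {Ω : Set (EuclideanSpace ℝ (Fin n))}
    (hΩ : IsBoundedC1Domain Ω) {x : EuclideanSpace ℝ (Fin n)} (hx : x ∈ frontier Ω) :
    ∃ (r : ℝ) (g : EuclideanSpace ℝ (Fin n) → ℝ) (e : EuclideanSpace ℝ (Fin n)) (c G : ℝ),
      0 < r ∧ 0 < c ∧ 0 ≤ G ∧ ContDiffOn ℝ 1 g (Metric.ball x r) ∧
      (∀ y ∈ Metric.ball x r, (y ∈ Ω ↔ g y < 0)) ∧
      (∀ y ∈ Metric.ball x r, c ≤ fderiv ℝ g y e ∧ ‖gradient g y‖ ≤ G) ∧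
      ∀ y ∈ Metric.ball x r, y ∈ frontier Ω →
        gradient g y ≠ 0 ∧ IsOutwardUnitNormal Ω y (‖gradient g y‖⁻¹ • gradient g y) := by
  obtain ⟨r, g, hg⟩ := hΩ.boundary x hx
  have hgrad : ∀ y v, fderiv ℝ g y v = inner ℝ (gradient g y) v := by
    intro y v
    simp [gradient]
  have hcont : ContinuousOn (fderiv ℝ g) (Metric.ball x r) :=
    hg.contDiffOn.continuousOn_fderiv_of_isOpen Metric.isOpen_ball le_rfl
  have hcg : ContinuousAt (gradient g) x := by
    have := (hcont.continuousAt (Metric.ball_mem_nhds x hg.pos))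
    exact (InnerProductSpace.toDual ℝ (EuclideanSpace ℝ (Fin n))).symm.continuous.continuousAt.comp
      this
  -- The gradient at the centre serves as transversal direction; by continuity the derivative of `g`
  -- along it stays above half of its value at the centre.
  set e := gradient g x with he
  have he0 : 0 < ‖e‖ := norm_pos_iff.2 hg.gradient_ne_zero
  have h1 : ∀ᶠ y in 𝓝 x, ‖e‖ ^ 2 / 2 < inner ℝ (gradient g y) e := by
    have : ContinuousAt (fun y => inner ℝ (gradient g y) e) x := hcg.inner continuousAt_const
    refine this.eventually_const_lt ?_
    change _ < inner ℝ e e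
    rw [real_inner_self_eq_norm_sq]
    nlinarith [pow_pos he0 2]
  have h2 : ∀ᶠ y in 𝓝 x, ‖gradient g y‖ < ‖e‖ + 1 :=
    hcg.norm.eventually_lt_const (by linarith)
  obtain ⟨s, hs, hsub⟩ := Metric.eventually_nhds_iff_ball.1 (h1.and h2)
  have hmr : Metric.ball x (min r s) ⊆ Metric.ball x r := Metric.ball_subset_ball (min_le_left _ _)
  have hms : Metric.ball x (min r s) ⊆ Metric.ball x s := Metric.ball_subset_ball (min_le_right _ _)
  refine ⟨min r s, g, e, ‖e‖ ^ 2 / 2, ‖e‖ + 1, lt_min hg.pos hs, by positivity, by positivity,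
    hg.contDiffOn.mono hmr, fun y hy => hg.mem_iff y (hmr hy), fun y hy => ?_, fun y hy hyf => ?_⟩
  · rw [hgrad]
    exact ⟨(hsub y (hms hy)).1.le, (hsub y (hms hy)).2.le⟩
  · have hne : gradient g y ≠ 0 := by
      intro h0
      have := (hsub y (hms hy)).1
      rw [h0, inner_zero_left] at this
      nlinarith [pow_pos he0 2]
    -- The same `g`, on a smaller ball around `y`, is a defining function at `y`. Its zero at `y`
    -- follows from both sides: `y ∉ Ω` gives `g y ≥ 0`, and `g y > 0` would keep a neighbourhood of
    -- `y` away from `Ω`.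
    refine ⟨hne, r - dist y x, g, ⟨?_, ?_, ?_, hne, ?_⟩, rfl⟩
    · have := Metric.mem_ball.1 (hmr hy)
      linarith
    · exact hg.contDiffOn.mono (Metric.ball_subset_ball' (by linarith))
    · have hyo : y ∉ Ω := fun h => by
        rw [hΩ.isOpen.frontier_eq] at hyf
        exact hyf.2 h
      have hge : 0 ≤ g y := not_lt.1 fun h => hyo ((hg.mem_iff y (hmr hy)).2 h)
      refine le_antisymm ?_ hge
      by_contra hgt
      push Not at hgt
      have hca : ContinuousAt g y :=
        hg.contDiffOn.continuousOn.continuousAt (Metric.isOpen_ball.mem_nhds (hmr hy))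
      have hev : ∀ᶠ z in 𝓝 y, 0 < g z ∧ z ∈ Metric.ball x r :=
        (hca.eventually_const_lt hgt).and (Metric.isOpen_ball.mem_nhds (hmr hy))
      obtain ⟨z, hz, hzΩ⟩ := mem_closure_iff_nhds.1 (frontier_subset_closure hyf) _ hev
      exact absurd ((hg.mem_iff z hz.2).1 hzΩ) (not_lt.2 hz.1.le)
    · exact fun z hz => hg.mem_iff z (Metric.ball_subset_ball' (by linarith) hz)

lemma fderiv_mul_smoothStep {φ g : EuclideanSpace ℝ (Fin n) → ℝ}
    {U : Set (EuclideanSpace ℝ (Fin n))} (hU : IsOpen U) (hφ : ContDiff ℝ 1 φ)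
    (hφU : tsupport φ ⊆ U) (hg : ContDiffOn ℝ 1 g U) (δ : ℝ) (x e : EuclideanSpace ℝ (Fin n)) :
    fderiv ℝ (fun x => φ x * smoothStep (g x / δ)) x e
      = fderiv ℝ φ x e * smoothStep (g x / δ)
        + φ x * (deriv smoothStep (g x / δ) / δ) * fderiv ℝ g x e := by
  by_cases hx : x ∈ U
  · have h1 : HasFDerivAt φ (fderiv ℝ φ x) x := (hφ.differentiable one_ne_zero x).hasFDerivAt
    have h2 : HasFDerivAt g (fderiv ℝ g x) x :=
      ((hg.contDiffAt (hU.mem_nhds hx)).differentiableAt one_ne_zero).hasFDerivAt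
    have h3 : HasDerivAt smoothStep (deriv smoothStep (g x / δ)) (g x / δ) :=
      (smoothStep_contDiff.differentiable one_ne_zero _).hasDerivAt
    have h4 : HasFDerivAt (fun y => g y / δ) (δ⁻¹ • fderiv ℝ g x) x := by
      simpa [div_eq_inv_mul] using h2.const_mul δ⁻¹
    have h5 := h3.comp_hasFDerivAt x h4
    have h6 : HasFDerivAt (fun x => φ x * smoothStep (g x / δ)) _ x := h1.mul h5
    rw [h6.fderiv]
    simp only [add_apply, smul_apply, smul_eq_mul]
    ring
  · have hx' : x ∉ tsupport φ := fun h => hx (hφU h)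
    have h0 : (fun x => φ x * smoothStep (g x / δ)) =ᶠ[𝓝 x] fun _ => (0 : ℝ) := by
      filter_upwards [(isClosed_tsupport φ).isOpen_compl.mem_nhds hx'] with y hy
      rw [image_eq_zero_of_notMem_tsupport hy, zero_mul]
    have h1 : φ =ᶠ[𝓝 x] fun _ => (0 : ℝ) := by
      filter_upwards [(isClosed_tsupport φ).isOpen_compl.mem_nhds hx'] with y hy
      exact image_eq_zero_of_notMem_tsupport hy
    rw [h0.fderiv_eq, h1.fderiv_eq, image_eq_zero_of_notMem_tsupport hx']
    simp

/-- The mass of the layer in which a cutoff along a defining function decreases. -/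
lemma integral_layer_le {φ g : EuclideanSpace ℝ (Fin n) → ℝ} {U : Set (EuclideanSpace ℝ (Fin n))}
    (hU : IsOpen U) (hφ : ContDiff ℝ 1 φ) (hφ0 : ∀ x, 0 ≤ φ x) (hφc : HasCompactSupport φ)
    (hφU : tsupport φ ⊆ U) (hg : ContDiffOn ℝ 1 g U) {e : EuclideanSpace ℝ (Fin n)} {c : ℝ}
    (hc : 0 < c) (hge : ∀ x ∈ U, c ≤ fderiv ℝ g x e) {δ : ℝ} (hδ : 0 < δ) :
    Integrable (fun x => φ x * (-deriv smoothStep (g x / δ) / δ)) ∧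
    ∫ x, φ x * (-deriv smoothStep (g x / δ) / δ) ≤ c⁻¹ * ∫ x, |fderiv ℝ φ x e| := by
  have hσc : ContDiffOn ℝ 1 (fun x => smoothStep (g x / δ)) U :=
    smoothStep_contDiff.comp_contDiffOn (hg.div_const δ)
  have hcont : Continuous (fun x => φ x * (-deriv smoothStep (g x / δ) / δ)) := by
    refine continuous_mul_of_tsupport_subset hU hφ.continuous ?_ hφU
    refine ContinuousOn.div_const (ContinuousOn.neg ?_) _
    exact (smoothStep_contDiff.continuous_deriv le_rfl).comp_continuousOn
      (hg.continuousOn.div_const δ)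
  have hint : Integrable (fun x => φ x * (-deriv smoothStep (g x / δ) / δ)) :=
    hcont.integrable_of_hasCompactSupport hφc.mul_right
  refine ⟨hint, ?_⟩
  have hprod := contDiff_mul_of_tsupport_subset hU hφ hσc hφU
  -- The derivative of the localized cutoff along `e` has integral zero. Solved for the term with
  -- `deriv smoothStep`, whose factor `fderiv ℝ g x e` is at least `c`, this bounds the mass of the
  -- layer independently of `δ`.
  have hzero := integral_fderiv_eq_zero (μ := volume) hprod hφc.mul_right e
  have hd := fun x => fderiv_mul_smoothStep hU hφ hφU hg δ x e
  have hdφ : Continuous fun x => fderiv ℝ φ x e :=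
    (hφ.continuous_fderiv one_ne_zero).clm_apply continuous_const
  have hdφc : HasCompactSupport fun x => fderiv ℝ φ x e := hφc.fderiv_apply ℝ e
  have hi1 : Integrable fun x => fderiv ℝ (fun x => φ x * smoothStep (g x / δ)) x e :=
    ((hprod.continuous_fderiv one_ne_zero).clm_apply
      continuous_const).integrable_of_hasCompactSupport (hφc.mul_right.fderiv_apply ℝ e)
  have hi2 : Integrable fun x => |fderiv ℝ φ x e| :=
    (hdφ.integrable_of_hasCompactSupport hdφc).abs
  have hmono : ∫ x, c * (φ x * (-deriv smoothStep (g x / δ) / δ))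
      ≤ ∫ x, (|fderiv ℝ φ x e| - fderiv ℝ (fun x => φ x * smoothStep (g x / δ)) x e) := by
    refine integral_mono (hint.const_mul c) (hi2.sub hi1) fun x => ?_
    simp only [hd]
    have h1 : fderiv ℝ φ x e * smoothStep (g x / δ) ≤ |fderiv ℝ φ x e| := by
      refine (le_abs_self _).trans ?_
      rw [abs_mul, abs_of_nonneg (smoothStep_nonneg _)]
      exact mul_le_of_le_one_right (abs_nonneg _) (smoothStep_le_one _)
    have h2 : c * (φ x * (-deriv smoothStep (g x / δ) / δ))
        ≤ fderiv ℝ g x e * (φ x * (-deriv smoothStep (g x / δ) / δ)) := by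
      by_cases hx : x ∈ U
      · refine mul_le_mul_of_nonneg_right (hge x hx) (mul_nonneg (hφ0 x) (div_nonneg ?_ hδ.le))
        exact neg_nonneg.2 (deriv_smoothStep_nonpos _)
      · rw [image_eq_zero_of_notMem_tsupport fun h => hx (hφU h)]
        simp
    have h3 : fderiv ℝ g x e * (φ x * (-deriv smoothStep (g x / δ) / δ))
        = -(φ x * (deriv smoothStep (g x / δ) / δ) * fderiv ℝ g x e) := by ring
    linarith
  rw [integral_const_mul, integral_sub hi2 hi1, hzero, sub_zero] at hmono
  rwa [inv_mul_eq_div, le_div_iff₀ hc, mul_comm]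

end

/-! ### Partition of unity along the boundary and the flux through the boundary layer -/

section

open scoped Manifold in
lemma exists_partition {V : Type*} [NormedAddCommGroup V] [NormedSpace ℝ V] [FiniteDimensional ℝ V]
    {s : Set V} (hs : IsClosed s) {ι : Type*} [Fintype ι] (U : ι → Set V) (hU : ∀ i, IsOpen (U i))
    (hsU : s ⊆ ⋃ i, U i) :
    ∃ φ : ι → V → ℝ, (∀ i, ContDiff ℝ 1 (φ i)) ∧ (∀ i x, 0 ≤ φ i x) ∧ (∀ i, tsupport (φ i) ⊆ U i) ∧
      (∀ x, ∑ i, φ i x ≤ 1) ∧ ∀ x ∈ s, ∑ i, φ i x = 1 := by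
  obtain ⟨f, hf⟩ := SmoothPartitionOfUnity.exists_isSubordinate (𝓘(ℝ, V)) hs U hU hsU
  refine ⟨fun i => f i, fun i => (f i).contMDiff.contDiff.of_le (by simp), fun i x => f.nonneg i x,
    hf, fun x => ?_, fun x hx => ?_⟩
  · rw [← finsum_eq_sum_of_fintype]
    exact f.sum_le_one x
  · rw [← finsum_eq_sum_of_fintype]
    exact f.sum_eq_one hx

/-- A partition of unity on `Ω` subordinate to `Ω` and finitely many boundary patches, with
defining functions on the patches. -/
structure Collar {n : ℕ} (Ω : Set (EuclideanSpace ℝ (Fin n))) (J : Type) [Fintype J] where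
  /-- the interior part -/
  core : EuclideanSpace ℝ (Fin n) → ℝ
  /-- the boundary parts -/
  part : J → EuclideanSpace ℝ (Fin n) → ℝ
  /-- the patches -/
  dom : J → Set (EuclideanSpace ℝ (Fin n))
  /-- the defining functions -/
  g : J → EuclideanSpace ℝ (Fin n) → ℝ
  /-- the transversal directions -/
  e : J → EuclideanSpace ℝ (Fin n)
  /-- lower bounds for the derivative in these directions -/
  c : J → ℝ
  /-- upper bounds for the gradients -/
  G : J → ℝ
  core_contDiff : ContDiff ℝ 1 core
  core_nonneg : ∀ x, 0 ≤ core x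
  core_tsupport : tsupport core ⊆ Ω
  part_contDiff : ∀ i, ContDiff ℝ 1 (part i)
  part_nonneg : ∀ i x, 0 ≤ part i x
  part_tsupport : ∀ i, tsupport (part i) ⊆ dom i
  part_compact : ∀ i, HasCompactSupport (part i)
  sum_le_one : ∀ x, core x + ∑ i, part i x ≤ 1
  sum_eq_one : ∀ x ∈ Ω, core x + ∑ i, part i x = 1
  dom_isOpen : ∀ i, IsOpen (dom i)
  c_pos : ∀ i, 0 < c i
  G_nonneg : ∀ i, 0 ≤ G i
  g_contDiffOn : ∀ i, ContDiffOn ℝ 1 (g i) (dom i)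
  mem_iff : ∀ i, ∀ y ∈ dom i, (y ∈ Ω ↔ g i y < 0)
  le_fderiv : ∀ i, ∀ y ∈ dom i, c i ≤ fderiv ℝ (g i) y (e i)
  norm_gradient_le : ∀ i, ∀ y ∈ dom i, ‖gradient (g i) y‖ ≤ G i
  normal : ∀ i, ∀ y ∈ dom i, y ∈ frontier Ω → gradient (g i) y ≠ 0 ∧
    IsOutwardUnitNormal Ω y (‖gradient (g i) y‖⁻¹ • gradient (g i) y)

variable {n : ℕ} {Ω : Set (EuclideanSpace ℝ (Fin n))}

lemma IsBoundedC1Domain.exists_collar (hΩ : IsBoundedC1Domain Ω) :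
    ∃ (J : Type) (_ : Fintype J), Nonempty (Collar Ω J) := by
  choose r g e c G hr hc hG hg hmem hfd hnor using
    fun x : frontier Ω => hΩ.exists_patch x.2
  have hcomp : IsCompact (frontier Ω) :=
    Metric.isCompact_of_isClosed_isBounded isClosed_frontier
      (hΩ.isBounded.closure.subset frontier_subset_closure)
  obtain ⟨t, ht⟩ := hcomp.elim_finite_subcover (fun x : frontier Ω => Metric.ball x.1 (r x))
    (fun _ => Metric.isOpen_ball)
    (fun x hx => mem_iUnion.2 ⟨⟨x, hx⟩, Metric.mem_ball_self (hr _)⟩)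
  -- The index `none` stands for the interior piece `Ω`, the indices `some i` for finitely many
  -- boundary balls.
  let U : Option t → Set (EuclideanSpace ℝ (Fin n)) := fun o =>
    o.elim Ω fun i => Metric.ball i.1.1 (r i.1)
  obtain ⟨φ, h1, h2, h3, h4, h5⟩ := exists_partition (isClosed_closure (s := Ω)) U
    (fun o => by
      cases o with
      | none => exact hΩ.isOpen
      | some i => exact Metric.isOpen_ball)
    (fun x hx => by
      by_cases hxΩ : x ∈ Ω
      · exact mem_iUnion.2 ⟨none, hxΩ⟩
      · have hxf : x ∈ frontier Ω := by
          rw [hΩ.isOpen.frontier_eq]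
          exact ⟨hx, hxΩ⟩
        obtain ⟨i, hi, hxi⟩ := mem_iUnion₂.1 (ht hxf)
        exact mem_iUnion.2 ⟨some ⟨i, hi⟩, hxi⟩)
  refine ⟨t, inferInstance, ⟨{
    core := φ none
    part := fun i => φ (some i)
    dom := fun i => Metric.ball i.1.1 (r i.1)
    g := fun i => g i.1
    e := fun i => e i.1
    c := fun i => c i.1
    G := fun i => G i.1
    core_contDiff := h1 none
    core_nonneg := h2 none
    core_tsupport := h3 none
    part_contDiff := fun i => h1 _
    part_nonneg := fun i => h2 _
    part_tsupport := fun i => h3 (some i)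
    part_compact := fun i => Metric.isCompact_of_isClosed_isBounded (isClosed_tsupport _)
      (Metric.isBounded_ball.subset (h3 (some i)))
    sum_le_one := fun x => by simpa [Fintype.sum_option] using h4 x
    sum_eq_one := fun x hx => by simpa [Fintype.sum_option] using h5 x (subset_closure hx)
    dom_isOpen := fun i => Metric.isOpen_ball
    c_pos := fun i => hc _
    G_nonneg := fun i => hG _
    g_contDiffOn := fun i => hg _
    mem_iff := fun i => hmem _
    le_fderiv := fun i y hy => (hfd _ y hy).1
    norm_gradient_le := fun i y hy => (hfd _ y hy).2
    normal := fun i => hnor _ }⟩⟩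

namespace Collar

variable {J : Type} [Fintype J] (D : Collar Ω J)

/-- The cutoff function that decreases to zero in a layer of width `δ` along the boundary. -/
def cutoff (δ : ℝ) (x : EuclideanSpace ℝ (Fin n)) : ℝ :=
  D.core x + ∑ i, D.part i x * smoothStep (D.g i x / δ)

lemma part_mul_contDiff (i : J) (δ : ℝ) :
    ContDiff ℝ 1 fun x => D.part i x * smoothStep (D.g i x / δ) :=
  contDiff_mul_of_tsupport_subset (D.dom_isOpen i) (D.part_contDiff i)
    (smoothStep_contDiff.comp_contDiffOn ((D.g_contDiffOn i).div_const δ)) (D.part_tsupport i)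

lemma cutoff_contDiff (δ : ℝ) : ContDiff ℝ 1 (D.cutoff δ) :=
  D.core_contDiff.add (ContDiff.sum fun i _ => D.part_mul_contDiff i δ)

lemma cutoff_nonneg (δ : ℝ) (x : EuclideanSpace ℝ (Fin n)) : 0 ≤ D.cutoff δ x :=
  add_nonneg (D.core_nonneg x)
    (Finset.sum_nonneg fun i _ => mul_nonneg (D.part_nonneg i x) (smoothStep_nonneg _))

lemma cutoff_le_one (δ : ℝ) (x : EuclideanSpace ℝ (Fin n)) : D.cutoff δ x ≤ 1 := by
  refine le_trans ?_ (D.sum_le_one x)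
  refine add_le_add le_rfl (Finset.sum_le_sum fun i _ => ?_)
  exact mul_le_of_le_one_right (D.part_nonneg i x) (smoothStep_le_one _)

/-- Since `smoothStep` already vanishes from `-1/2` on, the support within a patch stays in the
closed set `g ≤ -δ/2`, strictly inside `Ω`. A step down to 0 only at 0 would not keep the support
off the boundary. -/
lemma cutoff_tsupport {δ : ℝ} (hδ : 0 < δ) : tsupport (D.cutoff δ) ⊆ Ω := by
  set K : J → Set (EuclideanSpace ℝ (Fin n)) :=
    fun i => tsupport (D.part i) ∩ D.g i ⁻¹' Iic (-δ / 2) with hK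
  have hKc : ∀ i, IsClosed (K i) := fun i =>
    ((D.g_contDiffOn i).continuousOn.mono (D.part_tsupport i)).preimage_isClosed_of_isClosed
      (isClosed_tsupport _) isClosed_Iic
  have hsub : tsupport (D.cutoff δ) ⊆ tsupport D.core ∪ ⋃ i, K i := by
    refine closure_minimal (fun x hx => ?_)
      ((isClosed_tsupport _).union (isClosed_iUnion_of_finite hKc))
    by_contra hcon
    rw [mem_union, not_or, mem_iUnion, not_exists] at hcon
    refine hx ?_
    unfold cutoff
    rw [image_eq_zero_of_notMem_tsupport hcon.1, zero_add]
    refine Finset.sum_eq_zero fun i _ => ?_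
    by_cases hxi : x ∈ tsupport (D.part i)
    · have : ¬ D.g i x ≤ -δ / 2 := fun h => hcon.2 i ⟨hxi, h⟩
      rw [smoothStep_eq_zero, mul_zero]
      rw [le_div_iff₀ hδ]
      linarith
    · rw [image_eq_zero_of_notMem_tsupport hxi, zero_mul]
  refine hsub.trans (union_subset D.core_tsupport (iUnion_subset fun i x hx => ?_))
  refine (D.mem_iff i x (D.part_tsupport i hx.1)).2 ?_
  have : D.g i x ≤ -δ / 2 := hx.2
  linarith

lemma eventually_smoothStep_eq_one {i : J} {x : EuclideanSpace ℝ (Fin n)} (hx : x ∈ Ω)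
    (hxi : x ∈ D.dom i) : ∀ᶠ δ in 𝓝[>] (0 : ℝ), smoothStep (D.g i x / δ) = 1 := by
  have hg : D.g i x < 0 := (D.mem_iff i x hxi).1 hx
  filter_upwards [Ioo_mem_nhdsGT (neg_pos.2 hg)] with δ hδ
  refine smoothStep_eq_one ?_
  rw [div_le_iff₀ hδ.1]
  linarith [hδ.2]

lemma cutoff_eventually_eq_one {x : EuclideanSpace ℝ (Fin n)} (hx : x ∈ Ω) :
    ∀ᶠ δ in 𝓝[>] (0 : ℝ), D.cutoff δ x = 1 := by
  have h : ∀ i, ∀ᶠ δ in 𝓝[>] (0 : ℝ), D.part i x * smoothStep (D.g i x / δ) = D.part i x := by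
    intro i
    by_cases hxi : x ∈ D.dom i
    · filter_upwards [D.eventually_smoothStep_eq_one hx hxi] with δ hδ
      rw [hδ, mul_one]
    · rw [image_eq_zero_of_notMem_tsupport fun h => hxi (D.part_tsupport i h)]
      simp
  filter_upwards [eventually_all.2 h] with δ hδ
  unfold cutoff
  simp_rw [hδ]
  exact D.sum_eq_one x hx

/-- The constant in the estimate of the boundary flux. -/
def fluxConst : ℝ := ∑ i, D.G i * ((D.c i)⁻¹ * ∫ x, |fderiv ℝ (D.part i) x (D.e i)|)

lemma fluxConst_nonneg : 0 ≤ D.fluxConst :=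
  Finset.sum_nonneg fun i _ => mul_nonneg (D.G_nonneg i)
    (mul_nonneg (inv_nonneg.2 (D.c_pos i).le) (integral_nonneg fun _ => abs_nonneg _))

/-- By compactness. On the boundary the flux along the gradient of `g` is at most `G B`, because the
gradient is a multiple, of size at most `G`, of the normal. The set where it reaches `G B + η` is
therefore a compact set without boundary points, and the maximum of `g` on it, if it is nonempty, is
negative; `δ₀` is minus this maximum. -/
lemma patch_flux_lt (i : J) {t₀ t₁ : ℝ}
    {X : ℝ → EuclideanSpace ℝ (Fin n) → EuclideanSpace ℝ (Fin n)}
    (hΩ : IsOpen Ω)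
    (hX : ContinuousOn (fun q : ℝ × EuclideanSpace ℝ (Fin n) => X q.1 q.2)
      (Icc t₀ t₁ ×ˢ closure Ω)) {B : ℝ} (hB : 0 ≤ B)
    (hXB : ∀ t ∈ Icc t₀ t₁, ∀ x ∈ frontier Ω, ∀ ν, IsOutwardUnitNormal Ω x ν →
      inner ℝ (X t x) ν ≤ B) {η : ℝ} (hη : 0 < η) :
    ∃ δ₀ > 0, ∀ t ∈ Icc t₀ t₁, ∀ x ∈ Ω, x ∈ tsupport (D.part i) → -δ₀ < D.g i x →
      fderiv ℝ (D.g i) x (X t x) ≤ D.G i * B + η := by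
  have hgrad : ∀ y v, fderiv ℝ (D.g i) y v = inner ℝ (gradient (D.g i) y) v := by
    intro y v
    simp [gradient]
  set S : Set (ℝ × EuclideanSpace ℝ (Fin n)) :=
    (Icc t₀ t₁ ×ˢ (closure Ω ∩ tsupport (D.part i))) with hS
  have hSc : IsCompact S := isCompact_Icc.prod ((D.part_compact i).inter_left isClosed_closure)
  have hf : ContinuousOn (fun q : ℝ × EuclideanSpace ℝ (Fin n) =>
      fderiv ℝ (D.g i) q.2 (X q.1 q.2)) S := by
    refine ContinuousOn.clm_apply ?_ (hX.mono fun q hq => ⟨hq.1, hq.2.1⟩)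
    refine ((D.g_contDiffOn i).continuousOn_fderiv_of_isOpen (D.dom_isOpen i) le_rfl).comp
      continuousOn_snd fun q hq => D.part_tsupport i hq.2.2
  set S' := S ∩ (fun q : ℝ × EuclideanSpace ℝ (Fin n) =>
      fderiv ℝ (D.g i) q.2 (X q.1 q.2)) ⁻¹' Ici (D.G i * B + η) with hS'
  have hS'c : IsCompact S' :=
    hSc.of_isClosed_subset (hf.preimage_isClosed_of_isClosed hSc.isClosed isClosed_Ici)
      inter_subset_left
  rcases S'.eq_empty_or_nonempty with hemp | hne
  · refine ⟨1, one_pos, fun t ht x hx hxi _ => ?_⟩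
    by_contra hcon
    have : ((t, x) : ℝ × EuclideanSpace ℝ (Fin n)) ∈ S' :=
      ⟨⟨ht, subset_closure hx, hxi⟩, (not_le.1 hcon).le⟩
    rw [hemp] at this
    exact this
  · have hgc : ContinuousOn (fun q : ℝ × EuclideanSpace ℝ (Fin n) => D.g i q.2) S' :=
      (D.g_contDiffOn i).continuousOn.comp continuousOn_snd
        fun q hq => D.part_tsupport i hq.1.2.2
    obtain ⟨q, hq, hmax⟩ := hS'c.exists_isMaxOn hne hgc
    have hqd : q.2 ∈ D.dom i := D.part_tsupport i hq.1.2.2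
    have hneg : D.g i q.2 < 0 := by
      by_cases hqΩ : q.2 ∈ Ω
      · exact (D.mem_iff i _ hqd).1 hqΩ
      · exfalso
        have hqf : q.2 ∈ frontier Ω := by
          rw [hΩ.frontier_eq]
          exact ⟨hq.1.2.1, hqΩ⟩
        obtain ⟨hg0, hν⟩ := D.normal i _ hqd hqf
        have h1 := hXB q.1 hq.1.1 q.2 hqf _ hν
        have h2 : D.G i * B + η ≤ fderiv ℝ (D.g i) q.2 (X q.1 q.2) := hq.2
        rw [inner_smul_right, real_inner_comm, ← hgrad] at h1
        have h3 : 0 < ‖gradient (D.g i) q.2‖ := norm_pos_iff.2 hg0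
        rw [inv_mul_le_iff₀ h3] at h1
        have h4 := mul_le_mul_of_nonneg_right (D.norm_gradient_le i _ hqd) hB
        linarith
    refine ⟨-D.g i q.2, neg_pos.2 hneg, fun t ht x hx hxi hgx => ?_⟩
    by_contra hcon
    have hmem : ((t, x) : ℝ × EuclideanSpace ℝ (Fin n)) ∈ S' :=
      ⟨⟨ht, subset_closure hx, hxi⟩, (not_le.1 hcon).le⟩
    have := hmax hmem
    simp only [mem_ofPred_eq] at this
    linarith

lemma tsupport_norm_fderiv_part (i : J) :
    tsupport (fun x => ‖fderiv ℝ (D.part i) x‖) ⊆ D.dom i := by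
  refine Subset.trans ?_ ((tsupport_fderiv_subset ℝ (f := D.part i)).trans (D.part_tsupport i))
  refine closure_mono fun x hx => ?_
  simpa using hx

lemma layer_continuous (i : J) (δ : ℝ) :
    Continuous fun x => ‖fderiv ℝ (D.part i) x‖ * (1 - smoothStep (D.g i x / δ)) :=
  continuous_mul_of_tsupport_subset (D.dom_isOpen i)
    ((D.part_contDiff i).continuous_fderiv one_ne_zero).norm
    (continuousOn_const.sub (smoothStep_contDiff.continuous.comp_continuousOn
      ((D.g_contDiffOn i).continuousOn.div_const δ))) (D.tsupport_norm_fderiv_part i)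

/-- Dominated convergence: at each fixed point of `Ω` the factor `1 - smoothStep (g / δ)` is zero
for small `δ`. -/
lemma layer_tendsto_zero (hΩ : IsOpen Ω) (i : J) :
    Tendsto (fun δ : ℝ => ∫ x in Ω, ‖fderiv ℝ (D.part i) x‖ * (1 - smoothStep (D.g i x / δ)))
      (𝓝[>] 0) (𝓝 0) := by
  have hdc : Continuous fun x => ‖fderiv ℝ (D.part i) x‖ :=
    ((D.part_contDiff i).continuous_fderiv one_ne_zero).norm
  have hcs : HasCompactSupport fun x => ‖fderiv ℝ (D.part i) x‖ :=
    ((D.part_compact i).fderiv ℝ).norm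
  have hsub := D.tsupport_norm_fderiv_part i
  have hcont := D.layer_continuous i
  have h0 : ∫ x in Ω, (0 : ℝ) = 0 := by simp
  have key : Tendsto (fun δ : ℝ => ∫ x in Ω,
      ‖fderiv ℝ (D.part i) x‖ * (1 - smoothStep (D.g i x / δ))) (𝓝[>] 0)
      (𝓝 (∫ x in Ω, (0 : ℝ))) := by
    refine tendsto_integral_filter_of_dominated_convergence
      (fun x => ‖fderiv ℝ (D.part i) x‖) (Eventually.of_forall fun δ =>
        (hcont δ).aestronglyMeasurable) (Eventually.of_forall fun δ => Eventually.of_forall fun x => ?_)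
      (hdc.integrable_of_hasCompactSupport hcs).integrableOn ?_
    · rw [Real.norm_of_nonneg (mul_nonneg (norm_nonneg _)
        (sub_nonneg.2 (smoothStep_le_one _)))]
      exact mul_le_of_le_one_right (norm_nonneg _) (by linarith [smoothStep_nonneg (D.g i x / δ)])
    · refine (ae_restrict_iff' hΩ.measurableSet).2 (Eventually.of_forall fun x hx => ?_)
      by_cases hxi : x ∈ D.dom i
      · refine tendsto_const_nhds.congr' ?_
        filter_upwards [D.eventually_smoothStep_eq_one hx hxi] with δ hδ
        rw [hδ, sub_self, mul_zero]
      · have : ‖fderiv ℝ (D.part i) x‖ = 0 :=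
          image_eq_zero_of_notMem_tsupport (f := fun x => ‖fderiv ℝ (D.part i) x‖)
            fun h => hxi (hsub h)
        simp [this]
  rwa [h0] at key

/-- The flux through the boundary layer of a vector field whose normal component is at most `B`
on the boundary. -/
lemma eventually_flux_le (hΩ : IsOpen Ω) (hΩb : Bornology.IsBounded Ω) {t₀ t₁ : ℝ}
    {X : ℝ → EuclideanSpace ℝ (Fin n) → EuclideanSpace ℝ (Fin n)}
    (hX : ContinuousOn (fun q : ℝ × EuclideanSpace ℝ (Fin n) => X q.1 q.2)
      (Icc t₀ t₁ ×ˢ closure Ω)) {B : ℝ} (hB : 0 ≤ B)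
    (hXB : ∀ t ∈ Icc t₀ t₁, ∀ x ∈ frontier Ω, ∀ ν, IsOutwardUnitNormal Ω x ν →
      inner ℝ (X t x) ν ≤ B) {ε : ℝ} (hε : 0 < ε) :
    ∀ᶠ δ in 𝓝[>] (0 : ℝ), ∀ t ∈ Icc t₀ t₁,
      -∫ x in Ω, fderiv ℝ (D.cutoff δ) x (X t x) ≤ D.fluxConst * B + ε := by
  set C : J → ℝ := fun i => (D.c i)⁻¹ * ∫ x, |fderiv ℝ (D.part i) x (D.e i)| with hC
  have hC0 : ∀ i, 0 ≤ C i := fun i =>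
    mul_nonneg (inv_nonneg.2 (D.c_pos i).le) (integral_nonneg fun x => abs_nonneg _)
  have hΩc : IsCompact (closure Ω) := hΩb.isCompact_closure
  obtain ⟨M, hM0, hM⟩ : ∃ M, 0 ≤ M ∧ ∀ t ∈ Icc t₀ t₁, ∀ x ∈ closure Ω, ‖X t x‖ ≤ M := by
    obtain ⟨M, hM⟩ := (isCompact_Icc.prod hΩc).exists_bound_of_continuousOn hX
    exact ⟨max M 0, le_max_right _ _, fun t ht x hx => (hM (t, x) ⟨ht, hx⟩).trans (le_max_left _ _)⟩
  -- `η` and `ρ` each spend half of `ε`: the first on the excess of the normal flux, weighted by the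
  -- layer masses `C i`, the second on the gradients of the partition.
  set η := ε / (2 * (∑ i, C i + 1)) with hη
  have hS0 : 0 ≤ ∑ i, C i := Finset.sum_nonneg fun i _ => hC0 i
  have hη0 : 0 < η := by positivity
  have hηS : (∑ i, C i) * η ≤ ε / 2 := by
    rw [hη, mul_div_assoc', div_le_div_iff₀ (by positivity) two_pos]
    nlinarith
  set ρ := ε / (2 * (Fintype.card J + 1)) with hρ
  have hρ0 : 0 < ρ := by positivity
  have hρS : Fintype.card J * ρ ≤ ε / 2 := by
    rw [hρ, mul_div_assoc', div_le_div_iff₀ (by positivity) two_pos]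
    nlinarith [(Nat.cast_nonneg (Fintype.card J) : (0 : ℝ) ≤ _)]
  choose δ₀ hδ₀ hflux using fun i => D.patch_flux_lt i hΩ hX hB hXB hη0
  have hlayer : ∀ i, ∀ᶠ δ in 𝓝[>] (0 : ℝ),
      M * ∫ x in Ω, ‖fderiv ℝ (D.part i) x‖ * (1 - smoothStep (D.g i x / δ)) < ρ := by
    intro i
    have := (D.layer_tendsto_zero hΩ i).const_mul M
    rw [mul_zero] at this
    exact this.eventually_lt_const hρ0
  have hsmall : ∀ i, ∀ᶠ δ in 𝓝[>] (0 : ℝ), δ < δ₀ i := fun i =>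
    (eventually_lt_nhds (hδ₀ i)).filter_mono nhdsWithin_le_nhds
  filter_upwards [eventually_all.2 hlayer, eventually_all.2 hsmall, self_mem_nhdsWithin]
    with δ hlayer hsmall hδ t ht
  have hδ : 0 < δ := hδ
  set R : J → EuclideanSpace ℝ (Fin n) → ℝ := fun i x =>
    M * (‖fderiv ℝ (D.part i) x‖ * (1 - smoothStep (D.g i x / δ)))
      + (D.G i * B + η) * (D.part i x * (-deriv smoothStep (D.g i x / δ) / δ)) with hR
  have hi1 : ∀ i, IntegrableOn
      (fun x => ‖fderiv ℝ (D.part i) x‖ * (1 - smoothStep (D.g i x / δ))) Ω := fun i =>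
    ((D.layer_continuous i δ).integrable_of_hasCompactSupport
      ((D.part_compact i).fderiv ℝ).norm.mul_right).integrableOn
  have hlay := fun i => integral_layer_le (D.dom_isOpen i) (D.part_contDiff i) (D.part_nonneg i)
    (D.part_compact i) (D.part_tsupport i) (D.g_contDiffOn i) (D.c_pos i) (D.le_fderiv i) hδ
  have hRi : ∀ i, IntegrableOn (R i) Ω := fun i =>
    ((hi1 i).const_mul M).add ((hlay i).1.integrableOn.const_mul _)
  have hpt : ∀ x ∈ Ω, -fderiv ℝ (D.cutoff δ) x (X t x) ≤ ∑ i, R i x := by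
    intro x hx
    have hd1 : ∀ i, DifferentiableAt ℝ (fun x => D.part i x * smoothStep (D.g i x / δ)) x :=
      fun i => (D.part_mul_contDiff i δ).differentiable one_ne_zero x
    have hd2 : ∀ i, DifferentiableAt ℝ (D.part i) x :=
      fun i => (D.part_contDiff i).differentiable one_ne_zero x
    have hd3 : DifferentiableAt ℝ D.core x := D.core_contDiff.differentiable one_ne_zero x
    have e1 : fderiv ℝ (D.cutoff δ) x (X t x) = fderiv ℝ D.core x (X t x)
        + ∑ i, (fderiv ℝ (D.part i) x (X t x) * smoothStep (D.g i x / δ)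
          + D.part i x * (deriv smoothStep (D.g i x / δ) / δ) * fderiv ℝ (D.g i) x (X t x)) := by
      have : fderiv ℝ (D.cutoff δ) x = fderiv ℝ D.core x
          + ∑ i, fderiv ℝ (fun x => D.part i x * smoothStep (D.g i x / δ)) x :=
        (hd3.hasFDerivAt.add (HasFDerivAt.fun_sum fun i _ => (hd1 i).hasFDerivAt)).fderiv
      rw [this, add_apply, sum_apply]
      congr 1
      exact Finset.sum_congr rfl fun i _ => fderiv_mul_smoothStep (D.dom_isOpen i)
        (D.part_contDiff i) (D.part_tsupport i) (D.g_contDiffOn i) δ x _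
    -- The partition sums to 1 on `Ω`, so the gradient of the interior part is minus the sum of the
    -- others. Each gradient of a boundary part then carries the factor `1 - smoothStep`, which
    -- vanishes outside the layer.
    have e2 : fderiv ℝ D.core x (X t x) = -∑ i, fderiv ℝ (D.part i) x (X t x) := by
      have h1 : HasFDerivAt (fun y => D.core y + ∑ i, D.part i y)
          (fderiv ℝ D.core x + ∑ i, fderiv ℝ (D.part i) x) x :=
        hd3.hasFDerivAt.add (HasFDerivAt.fun_sum fun i _ => (hd2 i).hasFDerivAt)
      have h2 : (fun y => D.core y + ∑ i, D.part i y) =ᶠ[𝓝 x] fun _ => (1 : ℝ) := by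
        filter_upwards [hΩ.mem_nhds hx] with y hy using D.sum_eq_one y hy
      have h3 := (h1.congr_of_eventuallyEq h2.symm).unique (hasFDerivAt_const (1 : ℝ) x)
      have h4 := congrArg (fun L => L (X t x)) h3
      simp only [add_apply, sum_apply, zero_apply] at h4
      linarith
    rw [e1, e2, neg_add_eq_sub, ← Finset.sum_sub_distrib, ← Finset.sum_neg_distrib]
    refine Finset.sum_le_sum fun i _ => ?_
    have hs1 := smoothStep_le_one (D.g i x / δ)
    have hX' := hM t ht x (subset_closure hx)
    have k1 : fderiv ℝ (D.part i) x (X t x) * (1 - smoothStep (D.g i x / δ))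
        ≤ M * (‖fderiv ℝ (D.part i) x‖ * (1 - smoothStep (D.g i x / δ))) := by
      have := (le_abs_self _).trans ((fderiv ℝ (D.part i) x).le_opNorm (X t x))
      have := this.trans (mul_le_mul_of_nonneg_left hX' (norm_nonneg _))
      have := mul_le_mul_of_nonneg_right this (sub_nonneg.2 hs1)
      linarith
    have k2 : D.part i x * (-deriv smoothStep (D.g i x / δ) / δ) * fderiv ℝ (D.g i) x (X t x)
        ≤ (D.G i * B + η) * (D.part i x * (-deriv smoothStep (D.g i x / δ) / δ)) := by
      by_cases hxi : x ∈ tsupport (D.part i)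
      -- The derivative of `smoothStep` lives only where `g ≥ -δ`, and `δ < δ₀` puts this layer
      -- within the reach of `patch_flux_lt`.
      · rcases lt_or_ge (D.g i x / δ) (-1) with hlt | hge
        · rw [deriv_smoothStep_eq_zero hlt]
          simp
        · rw [mul_comm]
          refine mul_le_mul_of_nonneg_right (hflux i t ht x hx hxi ?_)
            (mul_nonneg (D.part_nonneg i x) (div_nonneg
              (neg_nonneg.2 (deriv_smoothStep_nonpos _)) hδ.le))
          rw [le_div_iff₀ hδ] at hge
          linarith [hsmall i]
      · rw [image_eq_zero_of_notMem_tsupport hxi]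
        simp
    have k3 : D.part i x * (-deriv smoothStep (D.g i x / δ) / δ) * fderiv ℝ (D.g i) x (X t x)
        = -(D.part i x * (deriv smoothStep (D.g i x / δ) / δ) * fderiv ℝ (D.g i) x (X t x)) := by
      ring
    simp only [hR]
    linarith
  have hXi : IntegrableOn (fun x => fderiv ℝ (D.cutoff δ) x (X t x)) Ω := by
    refine IntegrableOn.mono_set ?_ subset_closure
    refine ContinuousOn.integrableOn_compact hΩc ?_
    refine ((D.cutoff_contDiff δ).continuous_fderiv one_ne_zero).continuousOn.clm_apply ?_
    exact hX.comp (f := fun x => (t, x)) (by fun_prop) fun x hx => ⟨ht, hx⟩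
  rw [← integral_neg]
  calc ∫ x in Ω, -fderiv ℝ (D.cutoff δ) x (X t x) ≤ ∫ x in Ω, ∑ i, R i x :=
        setIntegral_mono_on hXi.neg (integrable_finsetSum _ fun i _ => hRi i) hΩ.measurableSet hpt
    _ = ∑ i, ∫ x in Ω, R i x := integral_finsetSum _ fun i _ => hRi i
    _ ≤ ∑ i, (ρ + (D.G i * B + η) * C i) := by
        refine Finset.sum_le_sum fun i _ => ?_
        simp only [hR]
        rw [integral_add ((hi1 i).const_mul M) ((hlay i).1.integrableOn.const_mul _),
          integral_const_mul, integral_const_mul]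
        refine add_le_add (hlayer i).le (mul_le_mul_of_nonneg_left ?_
          (add_nonneg (mul_nonneg (D.G_nonneg i) hB) hη0.le))
        refine le_trans (setIntegral_le_integral (hlay i).1 (Eventually.of_forall fun x => ?_))
          (hlay i).2
        exact mul_nonneg (D.part_nonneg i x) (div_nonneg
          (neg_nonneg.2 (deriv_smoothStep_nonpos _)) hδ.le)
    _ = Fintype.card J * ρ + D.fluxConst * B + (∑ i, C i) * η := by
        simp only [fluxConst, hC]
        rw [Finset.sum_add_distrib, Finset.sum_const, Finset.card_univ, nsmul_eq_mul,
          Finset.sum_mul, Finset.sum_mul, add_assoc, ← Finset.sum_add_distrib]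
        congr 1
        exact Finset.sum_congr rfl fun i _ => by ring
    _ ≤ D.fluxConst * B + ε := by linarith

end Collar

end

section

/-! ### The energy inequality -/

/-- A twice continuously differentiable function on `ℝᵐ` together with its partial derivatives. -/
structure EnergyDensity (m : ℕ) where
  /-- the function -/
  val : (Fin m → ℝ) → ℝ
  /-- its first partial derivatives -/
  d1 : Fin m → (Fin m → ℝ) → ℝ
  /-- its second partial derivatives -/
  d2 : Fin m → Fin m → (Fin m → ℝ) → ℝ
  hasFDerivAt_val : ∀ v, HasFDerivAt val
    (∑ l, d1 l v • (ContinuousLinearMap.proj l : (Fin m → ℝ) →L[ℝ] ℝ)) v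
  hasFDerivAt_d1 : ∀ l v, HasFDerivAt (d1 l)
    (∑ k, d2 l k v • (ContinuousLinearMap.proj k : (Fin m → ℝ) →L[ℝ] ℝ)) v
  continuous_d2 : ∀ l k, Continuous (d2 l k)

namespace EnergyDensity

variable {m : ℕ} (E : EnergyDensity m)

lemma continuous_val : Continuous E.val :=
  continuous_iff_continuousAt.2 fun v => (E.hasFDerivAt_val v).continuousAt

lemma continuous_d1 (l : Fin m) : Continuous (E.d1 l) :=
  continuous_iff_continuousAt.2 fun v => (E.hasFDerivAt_d1 l v).continuousAt

lemma contDiff_d1 (l : Fin m) : ContDiff ℝ 1 (E.d1 l) := by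
  refine contDiff_one_iff_hasFDerivAt.2 ⟨_, ?_, E.hasFDerivAt_d1 l⟩
  exact continuous_finsetSum _ fun k _ => (E.continuous_d2 l k).smul continuous_const

lemma contDiff_val : ContDiff ℝ 1 E.val := by
  refine contDiff_one_iff_hasFDerivAt.2 ⟨_, ?_, E.hasFDerivAt_val⟩
  exact continuous_finsetSum _ fun k _ => (E.continuous_d1 k).smul continuous_const

end EnergyDensity

variable {n m : ℕ} {Ω : Set (EuclideanSpace ℝ (Fin n))}

lemma fderiv_apply_gradient (ζ f : EuclideanSpace ℝ (Fin n) → ℝ) (x : EuclideanSpace ℝ (Fin n)) :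
    fderiv ℝ ζ x (gradient f x) = ∑ j, fderiv ℝ ζ x (EuclideanSpace.basisFun (Fin n) ℝ j) *
      fderiv ℝ f x (EuclideanSpace.basisFun (Fin n) ℝ j) := by
  have h : gradient f x = ∑ j, (fderiv ℝ f x (EuclideanSpace.basisFun (Fin n) ℝ j)) •
      EuclideanSpace.basisFun (Fin n) ℝ j := by
    conv_lhs => rw [← (EuclideanSpace.basisFun (Fin n) ℝ).sum_repr' (gradient f x)]
    refine Finset.sum_congr rfl fun j _ => ?_
    congr 1
    rw [real_inner_comm]
    simp [gradient]
  conv_lhs => rw [h]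
  rw [map_sum]
  refine Finset.sum_congr rfl fun j _ => ?_
  rw [map_smul, smul_eq_mul, mul_comm]

lemma laplacian_eq_sum_fderiv (f : EuclideanSpace ℝ (Fin n) → ℝ) (x : EuclideanSpace ℝ (Fin n)) :
    Laplacian.laplacian f x = ∑ j, fderiv ℝ (fderiv ℝ f) x (EuclideanSpace.basisFun (Fin n) ℝ j)
      (EuclideanSpace.basisFun (Fin n) ℝ j) := by
  rw [InnerProductSpace.laplacian_eq_iteratedFDeriv_orthonormalBasis f
    (EuclideanSpace.basisFun (Fin n) ℝ)]
  refine Finset.sum_congr rfl fun j _ => ?_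
  rw [iteratedFDeriv_two_apply]
  simp

/-- The flux `∑ λ_l ∂_l E(u) ∇u_l`. -/
def energyFlux (lam : Fin m → ℝ) (E : EnergyDensity m) (u : EuclideanSpace ℝ (Fin n) → Fin m → ℝ)
    (x : EuclideanSpace ℝ (Fin n)) : EuclideanSpace ℝ (Fin n) :=
  ∑ l, (lam l * E.d1 l (u x)) • gradient (fun y => u y l) x

lemma integrableOn_mul_of_tsupport_subset {φ h : EuclideanSpace ℝ (Fin n) → ℝ} (hΩ : IsOpen Ω)
    (hφ : Continuous φ) (hφc : HasCompactSupport φ) (hφΩ : tsupport φ ⊆ Ω)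
    (hh : ContinuousOn h Ω) : IntegrableOn (fun x => φ x * h x) Ω :=
  ((continuous_mul_of_tsupport_subset hΩ hφ hh hφΩ).integrable_of_hasCompactSupport
    hφc.mul_right).integrableOn

/-- Green's formula for the diffusion term, tested with a cutoff function. -/
lemma integral_diffusion_le (hΩ : IsOpen Ω) {ζ : EuclideanSpace ℝ (Fin n) → ℝ}
    (hζ : ContDiff ℝ 1 ζ) (hζ0 : ∀ x, 0 ≤ ζ x) (hζc : HasCompactSupport ζ) (hζΩ : tsupport ζ ⊆ Ω)
    (lam : Fin m → ℝ) (E : EnergyDensity m) {u : EuclideanSpace ℝ (Fin n) → Fin m → ℝ}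
    (hu : ∀ l, ContDiffOn ℝ 2 (fun x => u x l) Ω)
    (hE : ∀ x ∈ Ω, ∀ z : Fin m → ℝ, 0 ≤ ∑ l, ∑ k, lam l * E.d2 l k (u x) * (z l * z k)) :
    IntegrableOn (fun x => ζ x * ∑ l, E.d1 l (u x) *
      (lam l * Laplacian.laplacian (fun y => u y l) x)) Ω ∧
    ∫ x in Ω, ζ x * ∑ l, E.d1 l (u x) * (lam l * Laplacian.laplacian (fun y => u y l) x)
      ≤ -∫ x in Ω, fderiv ℝ ζ x (energyFlux lam E u x) := by
  set b := EuclideanSpace.basisFun (Fin n) ℝ with hb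
  have huc : ContinuousOn u Ω := continuousOn_pi.2 fun l => (hu l).continuousOn
  have hdu : ∀ l, ContDiffOn ℝ 1 (fderiv ℝ fun x => u x l) Ω := fun l =>
    (hu l).fderiv_of_isOpen hΩ (by norm_num)
  have hddu : ∀ l, ContinuousOn (fderiv ℝ (fderiv ℝ fun x => u x l)) Ω := fun l =>
    (hdu l).continuousOn_fderiv_of_isOpen hΩ le_rfl
  have hu1 : ContDiffOn ℝ 1 u Ω := contDiffOn_pi.2 fun l => (hu l).of_le (by norm_num)
  have hE1u : ∀ l, ContDiffOn ℝ 1 (fun x => E.d1 l (u x)) Ω := fun l =>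
    (E.contDiff_d1 l).comp_contDiffOn hu1
  -- `Z j` is the `j`-th component of the flux. The field `ζ Z` is `C¹` with compact support in `Ω`,
  -- so its divergence has integral zero; the divergence splits into the flux against the gradient
  -- of `ζ`, the nonnegative Hessian form, and the diffusion term.
  set Z : Fin n → EuclideanSpace ℝ (Fin n) → ℝ := fun j x =>
    ∑ l, lam l * E.d1 l (u x) * fderiv ℝ (fun y => u y l) x (b j) with hZ
  have hZc : ∀ j, ContDiffOn ℝ 1 (Z j) Ω := fun j =>
    ContDiffOn.sum fun l _ => (contDiffOn_const.mul (hE1u l)).mul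
      ((hdu l).clm_apply contDiffOn_const)
  have hprod : ∀ j, ContDiff ℝ 1 fun x => ζ x * Z j x := fun j =>
    contDiff_mul_of_tsupport_subset hΩ hζ (hZc j) hζΩ
  have hzero : ∀ j, ∫ x, fderiv ℝ (fun x => ζ x * Z j x) x (b j) = 0 := fun j =>
    integral_fderiv_eq_zero (hprod j) hζc.mul_right _
  have hzi : ∀ j, Integrable fun x => fderiv ℝ (fun x => ζ x * Z j x) x (b j) := fun j =>
    (((hprod j).continuous_fderiv one_ne_zero).clm_apply
      continuous_const).integrable_of_hasCompactSupport (hζc.mul_right.fderiv_apply ℝ _)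
  have hsupp : ∀ j, ∀ x, x ∉ Ω → fderiv ℝ (fun x => ζ x * Z j x) x (b j) = 0 := by
    intro j x hx
    have : (fun x => ζ x * Z j x) =ᶠ[𝓝 x] fun _ => (0 : ℝ) := by
      filter_upwards [(isClosed_tsupport ζ).isOpen_compl.mem_nhds fun h => hx (hζΩ h)] with y hy
      rw [image_eq_zero_of_notMem_tsupport hy, zero_mul]
    rw [this.fderiv_eq]
    simp
  have hzeroΩ : ∫ x in Ω, ∑ j, fderiv ℝ (fun x => ζ x * Z j x) x (b j) = 0 := by
    rw [integral_finsetSum _ fun j _ => (hzi j).integrableOn]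
    refine Finset.sum_eq_zero fun j _ => ?_
    rw [setIntegral_eq_integral_of_forall_compl_eq_zero (hsupp j), hzero]
  have hdZ : ∀ j, ∀ x ∈ Ω, fderiv ℝ (fun x => ζ x * Z j x) x (b j)
      = fderiv ℝ ζ x (b j) * Z j x + ζ x * (∑ l, ∑ k, lam l * E.d2 l k (u x) *
          (fderiv ℝ (fun y => u y l) x (b j) * fderiv ℝ (fun y => u y k) x (b j))
        + ∑ l, E.d1 l (u x) * (lam l * fderiv ℝ (fderiv ℝ fun y => u y l) x (b j) (b j))) := by
    intro j x hx
    have h1 : ∀ l, HasFDerivAt (fun y => u y l) (fderiv ℝ (fun y => u y l) x) x := fun l =>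
      (((hu l).contDiffAt (hΩ.mem_nhds hx)).differentiableAt (by norm_num)).hasFDerivAt
    have h2 : ∀ l, HasFDerivAt (fun y => fderiv ℝ (fun y => u y l) y (b j))
        ((fderiv ℝ (fderiv ℝ fun y => u y l) x).flip (b j)) x := by
      intro l
      have := (((hdu l).contDiffAt (hΩ.mem_nhds hx)).differentiableAt one_ne_zero).hasFDerivAt
      have := this.clm_apply (hasFDerivAt_const (b j) x)
      simpa using this
    have h3 : HasFDerivAt u (ContinuousLinearMap.pi fun l => fderiv ℝ (fun y => u y l) x) x :=
      hasFDerivAt_pi.2 h1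
    have h4 : ∀ l, HasFDerivAt (fun y => E.d1 l (u y)) _ x := fun l =>
      (E.hasFDerivAt_d1 l (u x)).comp x h3
    have h5 : HasFDerivAt (Z j) _ x :=
      HasFDerivAt.fun_sum fun l _ => ((h4 l).const_mul (lam l)).mul (h2 l)
    have h6 : HasFDerivAt ζ (fderiv ℝ ζ x) x := (hζ.differentiable one_ne_zero x).hasFDerivAt
    have h7 : HasFDerivAt (fun x => ζ x * Z j x) _ x := h6.mul h5
    rw [h7.fderiv]
    simp only [add_apply, smul_apply, smul_eq_mul, sum_apply, ContinuousLinearMap.comp_apply,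
      ContinuousLinearMap.flip_apply, ContinuousLinearMap.proj_apply, ContinuousLinearMap.pi_apply]
    rw [add_comm, mul_comm (Z j x), ← Finset.sum_add_distrib]
    congr 2
    refine Finset.sum_congr rfl fun l _ => ?_
    rw [add_comm, Finset.mul_sum, Finset.mul_sum]
    congr 1
    · exact Finset.sum_congr rfl fun k _ => by ring
    · ring
  have hlap : ∀ l, ContinuousOn (fun x => Laplacian.laplacian (fun y => u y l) x) Ω := by
    intro l
    simp_rw [laplacian_eq_sum_fderiv]
    exact continuousOn_finsetSum _ fun j _ =>
      ((hddu l).clm_apply continuousOn_const).clm_apply continuousOn_const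
  have hint : IntegrableOn (fun x => ζ x * ∑ l, E.d1 l (u x) *
      (lam l * Laplacian.laplacian (fun y => u y l) x)) Ω := by
    refine integrableOn_mul_of_tsupport_subset hΩ hζ.continuous hζc hζΩ ?_
    exact continuousOn_finsetSum _ fun l _ =>
      (hE1u l).continuousOn.mul (continuousOn_const.mul (hlap l))
  refine ⟨hint, ?_⟩
  have hflux : ∀ x, fderiv ℝ ζ x (energyFlux lam E u x) = ∑ j, fderiv ℝ ζ x (b j) * Z j x := by
    intro x
    simp only [energyFlux, map_sum, map_smul, fderiv_apply_gradient, smul_eq_mul, hZ,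
      Finset.mul_sum]
    rw [Finset.sum_comm]
    exact Finset.sum_congr rfl fun j _ => Finset.sum_congr rfl fun l _ => by ring
  have hfluxi : IntegrableOn (fun x => fderiv ℝ ζ x (energyFlux lam E u x)) Ω := by
    simp_rw [hflux]
    refine integrable_finsetSum _ fun j _ => ?_
    refine integrableOn_mul_of_tsupport_subset hΩ
      ((hζ.continuous_fderiv one_ne_zero).clm_apply continuous_const) (hζc.fderiv_apply ℝ _) ?_
      (hZc j).continuousOn
    refine Subset.trans ?_ ((tsupport_fderiv_subset ℝ (f := ζ)).trans hζΩ)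
    refine closure_mono fun y hy h0 => hy ?_
    simp only [h0, zero_apply]
  have hpt : ∀ x ∈ Ω, ζ x * ∑ l, E.d1 l (u x) * (lam l * Laplacian.laplacian (fun y => u y l) x)
      ≤ ∑ j, fderiv ℝ (fun x => ζ x * Z j x) x (b j) - fderiv ℝ ζ x (energyFlux lam E u x) := by
    intro x hx
    rw [hflux, ← Finset.sum_sub_distrib]
    have e1 : ∑ l, E.d1 l (u x) * (lam l * Laplacian.laplacian (fun y => u y l) x)
        = ∑ j, ∑ l, E.d1 l (u x) * (lam l * fderiv ℝ (fderiv ℝ fun y => u y l) x (b j) (b j)) := by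
      rw [Finset.sum_comm]
      refine Finset.sum_congr rfl fun l _ => ?_
      rw [laplacian_eq_sum_fderiv, Finset.mul_sum, Finset.mul_sum]
    rw [e1, Finset.mul_sum]
    refine Finset.sum_le_sum fun j _ => ?_
    rw [hdZ j x hx]
    have := mul_nonneg (hζ0 x) (hE x hx fun l => fderiv ℝ (fun y => u y l) x (b j))
    linarith
  calc _ ≤ ∫ x in Ω, (∑ j, fderiv ℝ (fun x => ζ x * Z j x) x (b j)
        - fderiv ℝ ζ x (energyFlux lam E u x)) :=
        setIntegral_mono_on hint
          ((integrable_finsetSum _ fun j _ => (hzi j).integrableOn).sub hfluxi)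
          hΩ.measurableSet hpt
    _ = _ := by
        rw [integral_sub (integrable_finsetSum _ fun j _ => (hzi j).integrableOn) hfluxi, hzeroΩ,
          zero_sub]

end

/-! ### The energy inequality with a cutoff, integrated in time -/

section

lemma isOpen_times (Tmax : EReal) : IsOpen (times Tmax) :=
  isOpen_Ioi.inter (isOpen_Iio.preimage continuous_coe_real_ereal)

lemma Icc_subset_times {Tmax : EReal} {t₀ t₁ : ℝ} (h0 : 0 < t₀) (h1 : (t₁ : EReal) < Tmax) :
    Icc t₀ t₁ ⊆ times Tmax := fun _ ht =>
  ⟨h0.trans_le ht.1, lt_of_le_of_lt (EReal.coe_le_coe_iff.2 ht.2) h1⟩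

/-- A Gronwall inequality with constant coefficients. -/
lemma gronwall_of_hasDerivAt {y y' : ℝ → ℝ} {K D t₀ t₁ : ℝ} (hK : 0 < K) (ht : t₀ ≤ t₁)
    (hy : ∀ t ∈ Icc t₀ t₁, HasDerivAt y (y' t) t)
    (hle : ∀ t ∈ Icc t₀ t₁, y' t ≤ K * y t + D) :
    y t₁ + D / K ≤ Real.exp (K * (t₁ - t₀)) * (y t₀ + D / K) := by
  set f : ℝ → ℝ := fun t => Real.exp (-K * t) * (y t + D / K) with hf
  have hd : ∀ t ∈ Icc t₀ t₁, HasDerivAt f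
      (Real.exp (-K * t) * (-K) * (y t + D / K) + Real.exp (-K * t) * y' t) t := by
    intro t ht
    have h1 : HasDerivAt (fun t : ℝ => Real.exp (-K * t)) (Real.exp (-K * t) * (-K)) t := by
      simpa using ((hasDerivAt_id t).const_mul (-K)).exp
    exact h1.mul ((hy t ht).add_const _)
  have hanti : AntitoneOn f (Icc t₀ t₁) := by
    refine antitoneOn_of_deriv_nonpos (convex_Icc _ _)
      (fun t ht => (hd t ht).continuousAt.continuousWithinAt)
      (fun t ht => (hd t (interior_subset ht)).differentiableAt.differentiableWithinAt)
      fun t ht => ?_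
    rw [(hd t (interior_subset ht)).deriv]
    have h1 := hle t (interior_subset ht)
    have h2 : K * (D / K) = D := by field_simp
    have h3 : Real.exp (-K * t) * (-K) * (y t + D / K) + Real.exp (-K * t) * y' t
        = Real.exp (-K * t) * (y' t - (K * y t + K * (D / K))) := by ring
    rw [h3, h2]
    exact mul_nonpos_of_nonneg_of_nonpos (Real.exp_nonneg _) (by linarith)
  have h1 := hanti (left_mem_Icc.2 ht) (right_mem_Icc.2 ht) ht
  simp only [hf] at h1
  have h2 := mul_le_mul_of_nonneg_left h1 (Real.exp_nonneg (K * t₁))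
  rw [← mul_assoc, ← mul_assoc, ← Real.exp_add, ← Real.exp_add] at h2
  have e1 : K * t₁ + -K * t₁ = 0 := by ring
  have e2 : K * t₁ + -K * t₀ = K * (t₁ - t₀) := by ring
  rwa [e1, e2, Real.exp_zero, one_mul] at h2

variable {n m : ℕ} {Ω : Set (EuclideanSpace ℝ (Fin n))} {lam : Fin m → ℝ}
  {F : (Fin m → ℝ) → (Fin m → ℝ)} {α : ℝ} {Λ : Fin m → ℝ} {Tmax : EReal}
  {w₀ : EuclideanSpace ℝ (Fin n) → Fin m → ℝ} {w : ℝ → EuclideanSpace ℝ (Fin n) → Fin m → ℝ}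

namespace IsClassicalSolution

lemma continuousOn_pi (hw : IsClassicalSolution Ω lam F α Λ Tmax w₀ w) :
    ContinuousOn (fun q : ℝ × EuclideanSpace ℝ (Fin n) => w q.1 q.2)
    (times Tmax ×ˢ closure Ω) :=
  _root_.continuousOn_pi.2 hw.continuousOn

lemma continuousOn_slice (hw : IsClassicalSolution Ω lam F α Λ Tmax w₀ w)
    {t : ℝ} (ht : t ∈ times Tmax) : ContinuousOn (w t) (closure Ω) :=
  hw.continuousOn_pi.comp (f := fun x => (t, x)) (by fun_prop) fun _ hx => ⟨ht, hx⟩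

/-- The time derivative is continuous only inside `Ω`. On the compact support of `ζ`, over a compact
time interval around `t`, it is bounded, which justifies differentiation under the integral. -/
lemma hasDerivAt_integral_cutoff (hw : IsClassicalSolution Ω lam F α Λ Tmax w₀ w)
    (hΩ : IsOpen Ω) (hΩb : Bornology.IsBounded Ω)
    {ζ : EuclideanSpace ℝ (Fin n) → ℝ} (hζ : Continuous ζ) (hζc : HasCompactSupport ζ)
    (hζΩ : tsupport ζ ⊆ Ω) (E : EnergyDensity m) {t : ℝ} (ht : t ∈ times Tmax) :
    HasDerivAt (fun t => ∫ x in Ω, ζ x * E.val (w t x))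
      (∫ x in Ω, ζ x * ∑ l, E.d1 l (w t x) * deriv (fun s => w s x l) t) t := by
  obtain ⟨ε, hε, hball⟩ := Metric.nhds_basis_closedBall.mem_iff.1
    ((isOpen_times Tmax).mem_nhds ht)
  have hG : ContinuousOn (fun q : ℝ × EuclideanSpace ℝ (Fin n) =>
      ζ q.2 * ∑ l, E.d1 l (w q.1 q.2) * deriv (fun s => w s q.2 l) q.1) (times Tmax ×ˢ Ω) := by
    refine (hζ.comp continuous_snd).continuousOn.mul (continuousOn_finsetSum _ fun l _ => ?_)
    refine ContinuousOn.mul ?_ (hw.continuousOn_deriv_time l)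
    exact (E.continuous_d1 l).comp_continuousOn
      (hw.continuousOn_pi.mono (prod_mono_right subset_closure))
  have hcomp : IsCompact (Metric.closedBall t ε ×ˢ tsupport ζ) :=
    (isCompact_closedBall t ε).prod hζc
  obtain ⟨C, hC⟩ := hcomp.exists_bound_of_continuousOn (hG.mono (prod_mono hball hζΩ))
  have hfin : IsFiniteMeasure (volume.restrict Ω) := ⟨by
    rw [Measure.restrict_apply_univ]
    exact hΩb.measure_lt_top⟩
  have hslice : ∀ s ∈ times Tmax, ContinuousOn (fun x => E.val (w s x)) Ω := fun s hs =>
    E.continuous_val.comp_continuousOn ((hw.continuousOn_slice hs).mono subset_closure)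
  refine (hasDerivAt_integral_of_dominated_loc_of_deriv_le (𝕜 := ℝ) (E := ℝ)
    (μ := volume.restrict Ω) (bound := fun _ => max C 0)
    (F := fun t x => ζ x * E.val (w t x))
    (F' := fun t x => ζ x * ∑ l, E.d1 l (w t x) * deriv (fun s => w s x l) t)
    (s := Metric.closedBall t ε) (Metric.closedBall_mem_nhds t hε) ?_ ?_ ?_ ?_
    (integrable_const _) ?_).2
  · filter_upwards [(isOpen_times Tmax).mem_nhds ht] with s hs
    exact (integrableOn_mul_of_tsupport_subset hΩ hζ hζc hζΩ (hslice s hs)).aestronglyMeasurable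
  · exact integrableOn_mul_of_tsupport_subset hΩ hζ hζc hζΩ (hslice t ht)
  · refine ContinuousOn.aestronglyMeasurable ?_ hΩ.measurableSet
    exact hG.comp (f := fun x => (t, x)) (by fun_prop) fun x hx => ⟨ht, hx⟩
  · refine Eventually.of_forall fun x s hs => ?_
    by_cases hx : x ∈ tsupport ζ
    · exact (hC (s, x) ⟨hs, hx⟩).trans (le_max_left _ _)
    · rw [image_eq_zero_of_notMem_tsupport hx, zero_mul, norm_zero]
      exact le_max_right _ _
  · refine (ae_restrict_iff' hΩ.measurableSet).2 (Eventually.of_forall fun x hx s hs => ?_)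
    have h1 : HasDerivAt (fun s => w s x) (fun l => deriv (fun s => w s x l) s) s :=
      hasDerivAt_pi.2 fun l => (hw.differentiableAt_time l s (hball hs) x hx).hasDerivAt
    have h2 := ((E.hasFDerivAt_val (w s x)).comp_hasDerivAt s h1).const_mul (ζ x)
    refine h2.congr_deriv ?_
    simp [sum_apply]

/-- The energy inequality, tested with a cutoff function. -/
lemma cutoff_energy_le (hw : IsClassicalSolution Ω lam F α Λ Tmax w₀ w)
    (hΩ : IsOpen Ω) (hΩb : Bornology.IsBounded Ω)
    {ζ : EuclideanSpace ℝ (Fin n) → ℝ} (hζ : ContDiff ℝ 1 ζ) (hζ0 : ∀ x, 0 ≤ ζ x)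
    (hζ1 : ∀ x, ζ x ≤ 1) (hζc : HasCompactSupport ζ) (hζΩ : tsupport ζ ⊆ Ω) (E : EnergyDensity m)
    {t₀ t₁ K K₀ D : ℝ} (h0 : 0 < t₀) (h01 : t₀ ≤ t₁) (h1 : (t₁ : EReal) < Tmax) (hK : 0 < K)
    (hK₀ : 0 ≤ K₀)
    (hE : ∀ t ∈ Icc t₀ t₁, ∀ x ∈ Ω, ∀ z : Fin m → ℝ,
      0 ≤ ∑ l, ∑ k, lam l * E.d2 l k (w t x) * (z l * z k))
    (hEF : ∀ t ∈ Icc t₀ t₁, ∀ x ∈ Ω,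
      ∑ l, E.d1 l (w t x) * F (w t x) l ≤ K * E.val (w t x) + K₀)
    (hD : ∀ t ∈ Icc t₀ t₁, -∫ x in Ω, fderiv ℝ ζ x (energyFlux lam E (w t) x) ≤ D) :
    (∫ x in Ω, ζ x * E.val (w t₁ x)) + (K₀ * volume.real Ω + D) / K
      ≤ Real.exp (K * (t₁ - t₀)) *
        ((∫ x in Ω, ζ x * E.val (w t₀ x)) + (K₀ * volume.real Ω + D) / K) := by
  have hsub := Icc_subset_times h0 h1
  refine gronwall_of_hasDerivAt (y := fun t => ∫ x in Ω, ζ x * E.val (w t x)) hK h01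
    (fun t ht => hw.hasDerivAt_integral_cutoff hΩ hΩb hζ.continuous hζc hζΩ E (hsub ht))
    fun t ht => ?_
  obtain ⟨hi1, hle1⟩ := integral_diffusion_le hΩ hζ hζ0 hζc hζΩ lam E
    (fun l => hw.contDiffOn_space l t (hsub ht)) (hE t ht)
  have hval : IntegrableOn (fun x => ζ x * E.val (w t x)) Ω :=
    integrableOn_mul_of_tsupport_subset hΩ hζ.continuous hζc hζΩ
      (E.continuous_val.comp_continuousOn ((hw.continuousOn_slice (hsub ht)).mono subset_closure))
  have hζi : IntegrableOn ζ Ω := (hζ.continuous.integrable_of_hasCompactSupport hζc).integrableOn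
  have hdt : IntegrableOn
      (fun x => ζ x * ∑ l, E.d1 l (w t x) * deriv (fun s => w s x l) t) Ω := by
    refine integrableOn_mul_of_tsupport_subset hΩ hζ.continuous hζc hζΩ ?_
    refine continuousOn_finsetSum _ fun l _ => ContinuousOn.mul ?_ ?_
    · exact (E.continuous_d1 l).comp_continuousOn
        ((hw.continuousOn_slice (hsub ht)).mono subset_closure)
    · exact (hw.continuousOn_deriv_time l).comp (f := fun x => (t, x)) (by fun_prop)
        fun x hx => ⟨hsub ht, hx⟩
  have hpt : ∀ x ∈ Ω, ζ x * ∑ l, E.d1 l (w t x) * deriv (fun s => w s x l) t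
      ≤ ζ x * ∑ l, E.d1 l (w t x) * (lam l * Laplacian.laplacian (fun y => w t y l) x)
        + (K * (ζ x * E.val (w t x)) + K₀ * ζ x) := by
    intro x hx
    have e1 : ∑ l, E.d1 l (w t x) * deriv (fun s => w s x l) t
        = ∑ l, E.d1 l (w t x) * (lam l * Laplacian.laplacian (fun y => w t y l) x)
          + ∑ l, E.d1 l (w t x) * F (w t x) l := by
      rw [← Finset.sum_add_distrib]
      refine Finset.sum_congr rfl fun l _ => ?_
      rw [← hw.equation l t (hsub ht) x hx]
      ring
    rw [e1]
    have := mul_le_mul_of_nonneg_left (hEF t ht x hx) (hζ0 x)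
    linarith
  have hsum : IntegrableOn (fun x => K * (ζ x * E.val (w t x)) + K₀ * ζ x) Ω :=
    (hval.const_mul K).add (hζi.const_mul K₀)
  have hζ2 : ∫ x in Ω, ζ x ≤ volume.real Ω := by
    have hfin : IsFiniteMeasure (volume.restrict Ω) := ⟨by
      rw [Measure.restrict_apply_univ]
      exact hΩb.measure_lt_top⟩
    calc ∫ x in Ω, ζ x ≤ ∫ x in Ω, (1 : ℝ) := integral_mono hζi (integrable_const _) hζ1
      _ = volume.real Ω := by simp
  calc ∫ x in Ω, ζ x * ∑ l, E.d1 l (w t x) * deriv (fun s => w s x l) t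
      ≤ ∫ x in Ω, (ζ x * ∑ l, E.d1 l (w t x) * (lam l * Laplacian.laplacian (fun y => w t y l) x)
        + (K * (ζ x * E.val (w t x)) + K₀ * ζ x)) :=
        setIntegral_mono_on hdt (hi1.add hsum) hΩ.measurableSet hpt
    _ = (∫ x in Ω, ζ x *
          ∑ l, E.d1 l (w t x) * (lam l * Laplacian.laplacian (fun y => w t y l) x))
        + (K * (∫ x in Ω, ζ x * E.val (w t x)) + K₀ * ∫ x in Ω, ζ x) := by
        rw [integral_add hi1 hsum, integral_add (hval.const_mul K) (hζi.const_mul K₀), integral_const_mul,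
          integral_const_mul]
    _ ≤ D + (K * (∫ x in Ω, ζ x * E.val (w t x)) + K₀ * volume.real Ω) := by
        refine add_le_add (hle1.trans (hD t ht)) (add_le_add le_rfl ?_)
        exact mul_le_mul_of_nonneg_left hζ2 hK₀
    _ = _ := by ring

end IsClassicalSolution

end

/-! ### Removal of the cutoff, the flux at the boundary, and the initial time -/

section

variable {n m : ℕ} {Ω : Set (EuclideanSpace ℝ (Fin n))} {lam : Fin m → ℝ}
  {F : (Fin m → ℝ) → (Fin m → ℝ)} {α : ℝ} {Λ : Fin m → ℝ} {Tmax : EReal}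
  {w₀ : EuclideanSpace ℝ (Fin n) → Fin m → ℝ} {w : ℝ → EuclideanSpace ℝ (Fin n) → Fin m → ℝ}

lemma isFiniteMeasure_restrict_of_isBounded (hΩb : Bornology.IsBounded Ω) :
    IsFiniteMeasure (volume.restrict Ω) := ⟨by
  rw [Measure.restrict_apply_univ]
  exact hΩb.measure_lt_top⟩

lemma Collar.tendsto_integral_cutoff {J : Type} [Fintype J] (D : Collar Ω J) (hΩ : IsOpen Ω)
    (hΩb : Bornology.IsBounded Ω) {h : EuclideanSpace ℝ (Fin n) → ℝ}
    (hh : ContinuousOn h (closure Ω)) :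
    Tendsto (fun δ => ∫ x in Ω, D.cutoff δ x * h x) (𝓝[>] 0) (𝓝 (∫ x in Ω, h x)) := by
  have hhi : IntegrableOn h Ω :=
    (hh.integrableOn_compact hΩb.isCompact_closure).mono_set subset_closure
  refine tendsto_integral_filter_of_dominated_convergence (fun x => ‖h x‖)
    (Eventually.of_forall fun δ => ?_) (Eventually.of_forall fun δ => ?_) hhi.norm ?_
  · exact (D.cutoff_contDiff δ).continuous.aestronglyMeasurable.mul hhi.aestronglyMeasurable
  · refine Eventually.of_forall fun x => ?_
    rw [norm_mul, Real.norm_of_nonneg (D.cutoff_nonneg δ x)]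
    exact mul_le_of_le_one_left (norm_nonneg _) (D.cutoff_le_one δ x)
  · refine (ae_restrict_iff' hΩ.measurableSet).2 (Eventually.of_forall fun x hx => ?_)
    refine tendsto_const_nhds.congr' ?_
    filter_upwards [D.cutoff_eventually_eq_one hx] with δ hδ
    rw [hδ, one_mul]

namespace IsClassicalSolution

/-- The flux enters as a separate field `X`, because `energyFlux` is built from full derivatives,
which say nothing on the boundary itself. For fixed `ε` the cutoff is removed first by `δ → 0`; then
`ε → 0`. -/
lemma energy_le_of_flux (hw : IsClassicalSolution Ω lam F α Λ Tmax w₀ w)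
    (hΩ : IsOpen Ω) (hΩb : Bornology.IsBounded Ω) {J : Type} [Fintype J] (D : Collar Ω J)
    (E : EnergyDensity m) {t₀ t₁ K K₀ B : ℝ} (h0 : 0 < t₀) (h01 : t₀ ≤ t₁)
    (h1 : (t₁ : EReal) < Tmax) (hK : 0 < K) (hK₀ : 0 ≤ K₀) (hB : 0 ≤ B)
    (hE : ∀ t ∈ Icc t₀ t₁, ∀ x ∈ Ω, ∀ z : Fin m → ℝ,
      0 ≤ ∑ l, ∑ k, lam l * E.d2 l k (w t x) * (z l * z k))
    (hEF : ∀ t ∈ Icc t₀ t₁, ∀ x ∈ Ω,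
      ∑ l, E.d1 l (w t x) * F (w t x) l ≤ K * E.val (w t x) + K₀)
    {X : ℝ → EuclideanSpace ℝ (Fin n) → EuclideanSpace ℝ (Fin n)}
    (hX : ContinuousOn (fun q : ℝ × EuclideanSpace ℝ (Fin n) => X q.1 q.2)
      (Icc t₀ t₁ ×ˢ closure Ω))
    (hXE : ∀ t ∈ Icc t₀ t₁, ∀ x ∈ Ω, X t x = energyFlux lam E (w t) x)
    (hXB : ∀ t ∈ Icc t₀ t₁, ∀ x ∈ frontier Ω, ∀ ν, IsOutwardUnitNormal Ω x ν →
      inner ℝ (X t x) ν ≤ B) :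
    (∫ x in Ω, E.val (w t₁ x)) + (K₀ * volume.real Ω + D.fluxConst * B) / K
      ≤ Real.exp (K * (t₁ - t₀)) *
        ((∫ x in Ω, E.val (w t₀ x)) + (K₀ * volume.real Ω + D.fluxConst * B) / K) := by
  have hsub := Icc_subset_times h0 h1
  have hlim : ∀ t ∈ Icc t₀ t₁, Tendsto (fun δ => ∫ x in Ω, D.cutoff δ x * E.val (w t x)) (𝓝[>] 0)
      (𝓝 (∫ x in Ω, E.val (w t x))) := fun t ht =>
    D.tendsto_integral_cutoff hΩ hΩb
      (E.continuous_val.comp_continuousOn (hw.continuousOn_slice (hsub ht)))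
  have key : ∀ ε > 0, (∫ x in Ω, E.val (w t₁ x))
      + (K₀ * volume.real Ω + (D.fluxConst * B + ε)) / K
      ≤ Real.exp (K * (t₁ - t₀)) * ((∫ x in Ω, E.val (w t₀ x))
        + (K₀ * volume.real Ω + (D.fluxConst * B + ε)) / K) := by
    intro ε hε
    refine le_of_tendsto_of_tendsto ((hlim t₁ (right_mem_Icc.2 h01)).add_const _)
      (((hlim t₀ (left_mem_Icc.2 h01)).add_const _).const_mul _) ?_
    filter_upwards [D.eventually_flux_le hΩ hΩb hX hB hXB hε, self_mem_nhdsWithin] with δ hδ hδ0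
    have hts := D.cutoff_tsupport hδ0
    refine hw.cutoff_energy_le hΩ hΩb (D.cutoff_contDiff δ) (D.cutoff_nonneg δ)
      (D.cutoff_le_one δ) ?_ hts E h0 h01 h1 hK hK₀ hE hEF fun t ht => ?_
    · exact Metric.isCompact_of_isClosed_isBounded (isClosed_tsupport _) (hΩb.subset hts)
    · have hcongr : ∫ x in Ω, fderiv ℝ (D.cutoff δ) x (energyFlux lam E (w t) x)
          = ∫ x in Ω, fderiv ℝ (D.cutoff δ) x (X t x) :=
        setIntegral_congr_fun hΩ.measurableSet fun x hx => by
          rw [hXE t ht x hx]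
      rw [hcongr]
      exact hδ t ht
  have hc1 : Tendsto (fun ε : ℝ => (∫ x in Ω, E.val (w t₁ x))
      + (K₀ * volume.real Ω + (D.fluxConst * B + ε)) / K) (𝓝[>] 0)
      (𝓝 ((∫ x in Ω, E.val (w t₁ x)) + (K₀ * volume.real Ω + (D.fluxConst * B + 0)) / K)) := by
    refine Tendsto.mono_left (Continuous.tendsto ?_ 0) nhdsWithin_le_nhds
    fun_prop
  have hc2 : Tendsto (fun ε : ℝ => Real.exp (K * (t₁ - t₀)) * ((∫ x in Ω, E.val (w t₀ x))
      + (K₀ * volume.real Ω + (D.fluxConst * B + ε)) / K)) (𝓝[>] 0)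
      (𝓝 (Real.exp (K * (t₁ - t₀)) * ((∫ x in Ω, E.val (w t₀ x))
        + (K₀ * volume.real Ω + (D.fluxConst * B + 0)) / K))) := by
    refine Tendsto.mono_left (Continuous.tendsto ?_ 0) nhdsWithin_le_nhds
    fun_prop
  have := le_of_tendsto_of_tendsto hc1 hc2 (by
    filter_upwards [self_mem_nhdsWithin] with ε hε using key ε hε)
  simpa using this

/-- The flux extends continuously to the boundary if the normal derivatives exist there. -/
lemma exists_flux_of_lt_one (hw : IsClassicalSolution Ω lam F α Λ Tmax w₀ w) (hΩ : IsOpen Ω)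
    (hα : α < 1) (E : EnergyDensity m) {t₀ t₁ B : ℝ} (hsub : Icc t₀ t₁ ⊆ times Tmax)
    (hb : ∀ t ∈ Icc t₀ t₁, ∀ x ∈ frontier Ω,
      ∑ l, lam l * E.d1 l (w t x) * (Λ l - α * w t x l) ≤ (1 - α) * B) :
    ∃ X : ℝ → EuclideanSpace ℝ (Fin n) → EuclideanSpace ℝ (Fin n),
      ContinuousOn (fun q : ℝ × EuclideanSpace ℝ (Fin n) => X q.1 q.2)
        (Icc t₀ t₁ ×ˢ closure Ω) ∧
      (∀ t ∈ Icc t₀ t₁, ∀ x ∈ Ω, X t x = energyFlux lam E (w t) x) ∧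
      ∀ t ∈ Icc t₀ t₁, ∀ x ∈ frontier Ω, ∀ ν, IsOutwardUnitNormal Ω x ν →
        inner ℝ (X t x) ν ≤ B := by
  refine ⟨fun t x => ∑ l, (lam l * E.d1 l (w t x)) •
    (InnerProductSpace.toDual ℝ (EuclideanSpace ℝ (Fin n))).symm
      (fderivWithin ℝ (fun y => w t y l) (closure Ω) x), ?_, ?_, ?_⟩
  · refine continuousOn_finsetSum _ fun l _ => ContinuousOn.fun_smul ?_ ?_
    · exact continuousOn_const.mul ((E.continuous_d1 l).comp_continuousOn
        (hw.continuousOn_pi.mono (prod_mono_left hsub)))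
    · exact (InnerProductSpace.toDual ℝ (EuclideanSpace ℝ (Fin n))).symm.continuous.comp_continuousOn
        ((hw.continuousOn_fderiv_closure hα l).mono (prod_mono_left hsub))
  · intro t ht x hx
    unfold energyFlux gradient
    refine Finset.sum_congr rfl fun l _ => ?_
    rw [fderivWithin_of_mem_nhds (mem_of_superset (hΩ.mem_nhds hx) subset_closure)]
  · intro t ht x hx ν hν
    have h1 : 0 < 1 - α := by linarith
    rw [sum_inner]
    have h2 : ∀ l, inner ℝ ((lam l * E.d1 l (w t x)) •
        (InnerProductSpace.toDual ℝ (EuclideanSpace ℝ (Fin n))).symm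
          (fderivWithin ℝ (fun y => w t y l) (closure Ω) x)) ν
        = (1 - α)⁻¹ * (lam l * E.d1 l (w t x) * (Λ l - α * w t x l)) := by
      intro l
      rw [real_inner_smul_left, InnerProductSpace.toDual_symm_apply,
        ← hw.boundary l t (hsub ht) x hx ν hν]
      field_simp
      ring
    simp_rw [h2]
    rw [← Finset.mul_sum, inv_mul_le_iff₀ h1]
    exact hb t ht x hx

/-- The flux extends by zero if the energy density does not depend on small components and the
solution vanishes on the boundary. -/
lemma exists_flux_of_eq_one (hw : IsClassicalSolution Ω lam F α Λ Tmax w₀ w)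
    (hΩ : IsBoundedC1Domain Ω) (hα : α = 1) (hΛ : ∀ l, Λ l = 0) (E : EnergyDensity m) {t₀ t₁ ε : ℝ}
    (hsub : Icc t₀ t₁ ⊆ times Tmax) (hε : 0 < ε) (hE : ∀ l v, |v l| < ε → E.d1 l v = 0) :
    ∃ X : ℝ → EuclideanSpace ℝ (Fin n) → EuclideanSpace ℝ (Fin n),
      ContinuousOn (fun q : ℝ × EuclideanSpace ℝ (Fin n) => X q.1 q.2)
        (Icc t₀ t₁ ×ˢ closure Ω) ∧
      (∀ t ∈ Icc t₀ t₁, ∀ x ∈ Ω, X t x = energyFlux lam E (w t) x) ∧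
      ∀ t ∈ Icc t₀ t₁, ∀ x ∈ frontier Ω, ∀ ν, IsOutwardUnitNormal Ω x ν →
        inner ℝ (X t x) ν ≤ 0 := by
  classical
  have hopen := hΩ.isOpen
  refine ⟨fun t x => if x ∈ Ω then energyFlux lam E (w t) x else 0, ?_, ?_, ?_⟩
  · rintro ⟨t, x⟩ ⟨ht, hx⟩
    by_cases hxΩ : x ∈ Ω
    · have h1 : ContinuousOn (fun q : ℝ × EuclideanSpace ℝ (Fin n) => energyFlux lam E (w q.1) q.2)
          (times Tmax ×ˢ Ω) := by
        refine continuousOn_finsetSum _ fun l _ => ContinuousOn.fun_smul ?_ ?_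
        · exact continuousOn_const.mul ((E.continuous_d1 l).comp_continuousOn
            (hw.continuousOn_pi.mono (prod_mono_right subset_closure)))
        · exact (InnerProductSpace.toDual ℝ
            (EuclideanSpace ℝ (Fin n))).symm.continuous.comp_continuousOn (hw.continuousOn_fderiv l)
      have h2 := h1.continuousAt (((isOpen_times Tmax).prod hopen).mem_nhds ⟨hsub ht, hxΩ⟩)
      refine (h2.congr ?_).continuousWithinAt
      filter_upwards [(isOpen_univ.prod hopen).mem_nhds (⟨trivial, hxΩ⟩ : (t, x) ∈ univ ×ˢ Ω)]
        with q hq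
      rw [if_pos hq.2]
    · have hxf : x ∈ frontier Ω := by
        rw [hopen.frontier_eq]
        exact ⟨hx, hxΩ⟩
      have hzero : ∀ l, w t x l = 0 := by
        intro l
        obtain ⟨r, g, hg⟩ := hΩ.boundary x hxf
        have := hw.boundary l t (hsub ht) x hxf _ ⟨r, g, hg, rfl⟩
        rw [hα, hΛ] at this
        simpa using this
      -- Near a boundary point all components are smaller than `ε`, so every `d1` vanishes and with
      -- it the flux, however large the gradients are.
      have hev : ∀ᶠ q in 𝓝[Icc t₀ t₁ ×ˢ closure Ω] (t, x), ∀ l, |w q.1 q.2 l| < ε := by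
        refine eventually_all.2 fun l => ?_
        have h1 : ContinuousWithinAt (fun q : ℝ × EuclideanSpace ℝ (Fin n) => |w q.1 q.2 l|)
            (Icc t₀ t₁ ×ˢ closure Ω) (t, x) :=
          (((hw.continuousOn l).mono (prod_mono_left hsub)) (t, x) ⟨ht, hx⟩).abs
        refine h1.eventually_lt_const ?_
        simpa [hzero l] using hε
      refine (continuousWithinAt_const (b := (0 : EuclideanSpace ℝ (Fin n)))).congr_of_eventuallyEq
        ?_ (if_neg hxΩ)
      filter_upwards [hev] with q hq
      by_cases hqΩ : q.2 ∈ Ω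
      · rw [if_pos hqΩ]
        exact Finset.sum_eq_zero fun l _ => by rw [hE l _ (hq l), mul_zero, zero_smul]
      · exact if_neg hqΩ
  · intro t _ x hx
    exact if_pos hx
  · intro t _ x hx ν _
    have : x ∉ Ω := by
      rw [hopen.frontier_eq] at hx
      exact hx.2
    simp only [if_neg this, inner_zero_left, le_refl]

/-- The integral of a function of the solution is continuous at the initial time. -/
lemma tendsto_integral_initial (hw : IsClassicalSolution Ω lam F α Λ Tmax w₀ w) (hΩ : IsOpen Ω)
    (hΩb : Bornology.IsBounded Ω) (E : EnergyDensity m)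
    (hm₀ : ∀ l, AEStronglyMeasurable (fun x => w₀ x l) (volume.restrict Ω)) {M : ℝ}
    (hM : ∀ l, ∀ᵐ x ∂(volume.restrict Ω), |w₀ x l| ≤ M) :
    Tendsto (fun t => ∫ x in Ω, E.val (w t x)) (𝓝[>] 0) (𝓝 (∫ x in Ω, E.val (w₀ x))) := by
  have hfin := isFiniteMeasure_restrict_of_isBounded hΩb
  obtain ⟨T, hT0, hT1⟩ : ∃ T : ℝ, 0 < T ∧ (T : EReal) < Tmax := by
    obtain ⟨T, h1, h2⟩ := EReal.lt_iff_exists_real_btwn.1 hw.Tmax_pos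
    exact ⟨T, by exact_mod_cast h1, h2⟩
  obtain ⟨K, hK⟩ := hw.bounded T hT1
  set R := max K M with hR
  -- The solution at small times and the initial data have values in a common box, on which the
  -- density is Lipschitz; the `L¹` convergence of `w` thus carries over to `E.val`.
  obtain ⟨L, hL⟩ := LocallyLipschitzOn.exists_lipschitzOnWith_of_compact
    (isCompact_Icc (a := fun _ : Fin m => -R) (b := fun _ => R))
    E.contDiff_val.locallyLipschitz.locallyLipschitzOn
  have hsub : Ioo 0 T ⊆ times Tmax := fun t ht =>
    ⟨ht.1, lt_trans (EReal.coe_lt_coe_iff.2 ht.2) hT1⟩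
  have hbox : ∀ t ∈ Ioo 0 T, ∀ x ∈ Ω, w t x ∈ Icc (fun _ : Fin m => -R) (fun _ => R) := by
    intro t ht x hx
    have h1 : ∀ l, |w t x l| ≤ R := fun l => (hK l t ht.1 ht.2 x hx).trans (le_max_left _ _)
    exact ⟨fun l => (abs_le.1 (h1 l)).1, fun l => (abs_le.1 (h1 l)).2⟩
  have hbox₀ : ∀ᵐ x ∂(volume.restrict Ω), w₀ x ∈ Icc (fun _ : Fin m => -R) (fun _ => R) := by
    filter_upwards [eventually_countable_forall.2 hM] with x hx
    have h1 : ∀ l, |w₀ x l| ≤ R := fun l => (hx l).trans (le_max_right _ _)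
    exact ⟨fun l => (abs_le.1 (h1 l)).1, fun l => (abs_le.1 (h1 l)).2⟩
  obtain ⟨C, hC⟩ := (isCompact_Icc (a := fun _ : Fin m => -R) (b := fun _ => R)).exists_bound_of_continuousOn
    E.continuous_val.continuousOn
  have hmeas₀ : AEStronglyMeasurable w₀ (volume.restrict Ω) :=
    (aemeasurable_pi_lambda _ fun l => (hm₀ l).aemeasurable).aestronglyMeasurable
  have hi₀ : Integrable (fun x => E.val (w₀ x)) (volume.restrict Ω) := by
    refine Integrable.of_bound (E.continuous_val.comp_aestronglyMeasurable hmeas₀) C ?_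
    filter_upwards [hbox₀] with x hx using hC _ hx
  have hmeas : ∀ t ∈ Ioo 0 T, AEStronglyMeasurable (w t) (volume.restrict Ω) := fun t ht =>
    ((hw.continuousOn_slice (hsub ht)).mono subset_closure).aestronglyMeasurable hΩ.measurableSet
  have hi : ∀ t ∈ Ioo 0 T, Integrable (fun x => E.val (w t x)) (volume.restrict Ω) := by
    intro t ht
    refine Integrable.of_bound (E.continuous_val.comp_aestronglyMeasurable (hmeas t ht)) C ?_
    exact (ae_restrict_iff' hΩ.measurableSet).2
      (Eventually.of_forall fun x hx => hC _ (hbox t ht x hx))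
  have hnear : ∀ᶠ t in 𝓝[>] (0 : ℝ), t ∈ Ioo 0 T := Ioo_mem_nhdsGT hT0
  refine tendsto_integral_of_L1' _ hi₀.aestronglyMeasurable (by filter_upwards [hnear] with t ht using hi t ht) ?_
  have hsum : Tendsto (fun t => (L : ENNReal) * ∑ l, eLpNorm (fun x => w t x l - w₀ x l) 1
      (volume.restrict Ω)) (𝓝[>] 0) (𝓝 0) := by
    have h1 := tendsto_finsetSum (Finset.univ : Finset (Fin m)) fun l _ => hw.initial l
    have h2 := ENNReal.Tendsto.const_mul (a := (L : ENNReal)) h1 (Or.inr ENNReal.coe_ne_top)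
    simpa using h2
  refine tendsto_of_tendsto_of_tendsto_of_le_of_le' tendsto_const_nhds hsum
    (Eventually.of_forall fun _ => zero_le) ?_
  filter_upwards [hnear] with t ht
  have hle : ∀ᵐ x ∂(volume.restrict Ω), ‖((fun x => E.val (w t x)) - fun x => E.val (w₀ x)) x‖ₑ
      ≤ L * ∑ l, ‖w t x l - w₀ x l‖ₑ := by
    filter_upwards [hbox₀, ae_restrict_mem hΩ.measurableSet] with x hx₀ hx
    have h1 := hL (hbox t ht x hx) hx₀
    rw [edist_eq_enorm_sub] at h1
    refine h1.trans (mul_le_mul_right ?_ _)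
    rw [edist_pi_def]
    refine Finset.sup_le fun l _ => ?_
    rw [edist_eq_enorm_sub]
    exact Finset.single_le_sum (f := fun l => ‖w t x l - w₀ x l‖ₑ) (fun _ _ => zero_le)
      (Finset.mem_univ l)
  simp only [eLpNorm_one_eq_lintegral_enorm]
  have hml : ∀ l, AEMeasurable (fun x => ‖w t x l - w₀ x l‖ₑ) (volume.restrict Ω) := fun l =>
    (((continuous_apply l).comp_aestronglyMeasurable (hmeas t ht)).sub (hm₀ l)).enorm
  calc _ ≤ ∫⁻ x in Ω, L * ∑ l, ‖w t x l - w₀ x l‖ₑ := lintegral_mono_ae hle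
    _ = L * ∑ l, ∫⁻ x in Ω, ‖w t x l - w₀ x l‖ₑ := by
        rw [lintegral_const_mul' _ _ ENNReal.coe_ne_top, lintegral_finsetSum' _ fun l _ => hml l]

end IsClassicalSolution

end

/-! ### The energy inequality from time zero -/

section

variable {n m : ℕ} {Ω : Set (EuclideanSpace ℝ (Fin n))} {lam : Fin m → ℝ}
  {F : (Fin m → ℝ) → (Fin m → ℝ)} {α : ℝ} {Λ : Fin m → ℝ} {Tmax : EReal}
  {w₀ : EuclideanSpace ℝ (Fin n) → Fin m → ℝ} {w : ℝ → EuclideanSpace ℝ (Fin n) → Fin m → ℝ}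

/-- The energy inequality up to the initial time. -/
lemma IsClassicalSolution.energy_le (hw : IsClassicalSolution Ω lam F α Λ Tmax w₀ w)
    (hΩ : IsBoundedC1Domain Ω) {J : Type} [Fintype J] (D : Collar Ω J) (E : EnergyDensity m)
    {t₁ K K₀ B : ℝ} (ht₁ : 0 < t₁) (h1 : (t₁ : EReal) < Tmax) (hK : 0 < K) (hK₀ : 0 ≤ K₀)
    (hB : 0 ≤ B)
    (hm₀ : ∀ l, AEStronglyMeasurable (fun x => w₀ x l) (volume.restrict Ω)) {M : ℝ}
    (hM : ∀ l, ∀ᵐ x ∂(volume.restrict Ω), |w₀ x l| ≤ M)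
    (hE : ∀ t ∈ Ioc 0 t₁, ∀ x ∈ Ω, ∀ z : Fin m → ℝ,
      0 ≤ ∑ l, ∑ k, lam l * E.d2 l k (w t x) * (z l * z k))
    (hEF : ∀ t ∈ Ioc 0 t₁, ∀ x ∈ Ω,
      ∑ l, E.d1 l (w t x) * F (w t x) l ≤ K * E.val (w t x) + K₀)
    (hbd : (α < 1 ∧ ∀ t ∈ Ioc 0 t₁, ∀ x ∈ frontier Ω,
        ∑ l, lam l * E.d1 l (w t x) * (Λ l - α * w t x l) ≤ (1 - α) * B) ∨
      (α = 1 ∧ (∀ l, Λ l = 0) ∧ ∃ ε > 0, ∀ l v, |v l| < ε → E.d1 l v = 0)) :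
    (∫ x in Ω, E.val (w t₁ x)) + (K₀ * volume.real Ω + D.fluxConst * B) / K
      ≤ Real.exp (K * t₁) *
        ((∫ x in Ω, E.val (w₀ x)) + (K₀ * volume.real Ω + D.fluxConst * B) / K) := by
  have key : ∀ t₀ ∈ Ioc 0 t₁, (∫ x in Ω, E.val (w t₁ x))
      + (K₀ * volume.real Ω + D.fluxConst * B) / K ≤ Real.exp (K * (t₁ - t₀)) *
        ((∫ x in Ω, E.val (w t₀ x)) + (K₀ * volume.real Ω + D.fluxConst * B) / K) := by
    intro t₀ ht₀
    have hsub := Icc_subset_times ht₀.1 h1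
    have hIoc : Icc t₀ t₁ ⊆ Ioc 0 t₁ := fun t ht => ⟨ht₀.1.trans_le ht.1, ht.2⟩
    obtain ⟨X, hX1, hX2, hX3⟩ : ∃ X : ℝ → EuclideanSpace ℝ (Fin n) → EuclideanSpace ℝ (Fin n),
        ContinuousOn (fun q : ℝ × EuclideanSpace ℝ (Fin n) => X q.1 q.2)
          (Icc t₀ t₁ ×ˢ closure Ω) ∧
        (∀ t ∈ Icc t₀ t₁, ∀ x ∈ Ω, X t x = energyFlux lam E (w t) x) ∧
        ∀ t ∈ Icc t₀ t₁, ∀ x ∈ frontier Ω, ∀ ν, IsOutwardUnitNormal Ω x ν →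
          inner ℝ (X t x) ν ≤ B := by
      rcases hbd with ⟨hα, hb⟩ | ⟨hα, hΛ, ε, hε, hEε⟩
      · exact hw.exists_flux_of_lt_one hΩ.isOpen hα E hsub fun t ht => hb t (hIoc ht)
      · obtain ⟨X, hX1, hX2, hX3⟩ := hw.exists_flux_of_eq_one hΩ hα hΛ E hsub hε hEε
        exact ⟨X, hX1, hX2, fun t ht x hx ν hν => (hX3 t ht x hx ν hν).trans hB⟩
    exact hw.energy_le_of_flux hΩ.isOpen hΩ.isBounded D E ht₀.1 ht₀.2 h1 hK hK₀ hB
      (fun t ht => hE t (hIoc ht)) (fun t ht => hEF t (hIoc ht)) hX1 hX2 hX3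
  have hexp : Tendsto (fun t₀ : ℝ => Real.exp (K * (t₁ - t₀))) (𝓝[>] 0)
      (𝓝 (Real.exp (K * (t₁ - 0)))) := by
    refine Tendsto.mono_left (Continuous.tendsto ?_ 0) nhdsWithin_le_nhds
    fun_prop
  rw [sub_zero] at hexp
  refine ge_of_tendsto
    (hexp.mul ((hw.tendsto_integral_initial hΩ.isOpen hΩ.isBounded E hm₀ hM).add_const _)) ?_
  filter_upwards [Ioc_mem_nhdsGT ht₁] with t₀ ht₀ using key t₀ ht₀

/-! ### Nonnegativity -/

/-- The energy density `∑ φ (v_l)`. -/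
def EnergyDensity.separable (m : ℕ) {φ φ' φ'' : ℝ → ℝ} (h1 : ∀ s, HasDerivAt φ (φ' s) s)
    (h2 : ∀ s, HasDerivAt φ' (φ'' s) s) (h3 : Continuous φ'') : EnergyDensity m where
  val v := ∑ l, φ (v l)
  d1 l v := φ' (v l)
  d2 l k v := if l = k then φ'' (v l) else 0
  hasFDerivAt_val v := HasFDerivAt.fun_sum fun l _ => (h1 (v l)).comp_hasFDerivAt v
    (ContinuousLinearMap.proj (R := ℝ) (φ := fun _ : Fin m => ℝ) l).hasFDerivAt
  hasFDerivAt_d1 l v := by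
    have := (h2 (v l)).comp_hasFDerivAt v
      (ContinuousLinearMap.proj (R := ℝ) (φ := fun _ : Fin m => ℝ) l).hasFDerivAt
    simp_rw [ite_smul, zero_smul]
    rw [Finset.sum_ite_eq, if_pos (Finset.mem_univ l)]
    exact this
  continuous_d2 l k := by
    split_ifs
    · exact h3.comp (continuous_apply l)
    · exact continuous_const

/-- Away from 0 both branches are explicit; at 0 the derivative is the limit of the derivatives
nearby. -/
lemma hasDerivAt_negPart_pow (k : ℕ) (s : ℝ) :
    HasDerivAt (fun s : ℝ => max (-s) 0 ^ (k + 2)) (-((k : ℝ) + 2) * max (-s) 0 ^ (k + 1)) s := by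
  have hne : ∀ y : ℝ, y ≠ 0 → HasDerivAt (fun s : ℝ => max (-s) 0 ^ (k + 2))
      (-((k : ℝ) + 2) * max (-y) 0 ^ (k + 1)) y := by
    intro y hy
    rcases lt_or_gt_of_ne hy with h | h
    · have h1 : HasDerivAt (fun s : ℝ => (-s) ^ (k + 2)) (-((k : ℝ) + 2) * (-y) ^ (k + 1)) y := by
        refine ((hasDerivAt_id y).neg.pow (k + 2)).congr_deriv ?_
        push_cast
        simp
        ring
      rw [max_eq_left (by linarith)]
      refine h1.congr_of_eventuallyEq ?_
      filter_upwards [Iio_mem_nhds h] with z hz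
      rw [max_eq_left (by linarith [mem_Iio.1 hz])]
    · rw [max_eq_right (by linarith)]
      refine ((hasDerivAt_const y (0 : ℝ)).congr_deriv (by simp)).congr_of_eventuallyEq ?_
      filter_upwards [Ioi_mem_nhds h] with z hz
      rw [max_eq_right (by linarith [mem_Ioi.1 hz])]
      simp
  rcases eq_or_ne s 0 with rfl | hs
  · exact hasDerivAt_of_hasDerivAt_of_ne (g := fun y => -((k : ℝ) + 2) * max (-y) 0 ^ (k + 1)) hne
      (Continuous.continuousAt (by fun_prop)) (Continuous.continuousAt (by fun_prop))
  · exact hne s hs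

/-- The density `∑ ((v_l + ε)⁻)⁴`. -/
def negEnergy (m : ℕ) (ε : ℝ) : EnergyDensity m :=
  EnergyDensity.separable m (φ := fun s => max (-(s + ε)) 0 ^ 4)
    (φ' := fun s => -4 * max (-(s + ε)) 0 ^ 3) (φ'' := fun s => 12 * max (-(s + ε)) 0 ^ 2)
    (fun s => ((hasDerivAt_negPart_pow 2 (s + ε)).comp_add_const s ε).congr_deriv (by norm_num))
    (fun s => (((hasDerivAt_negPart_pow 1 (s + ε)).comp_add_const s ε).const_mul (-4)).congr_deriv
      (by norm_num; ring))
    (by fun_prop)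

lemma pow_three_mul_le {a b : ℝ} (ha : 0 ≤ a) (hb : 0 ≤ b) : a ^ 3 * b ≤ a ^ 4 + b ^ 4 := by
  rcases le_total a b with h | h
  · have : a ^ 3 * b ≤ b ^ 3 * b := mul_le_mul_of_nonneg_right (pow_le_pow_left₀ ha h 3) hb
    nlinarith [pow_nonneg ha 4]
  · have : a ^ 3 * b ≤ a ^ 3 * a := mul_le_mul_of_nonneg_left h (pow_nonneg ha 3)
    nlinarith [pow_nonneg hb 4]

/-- A term is nonzero only if `v l < -ε`. Then the positive part of `v` has `l`-th component 0,
where `F` is quasi-positive, so `-F v l` is at most `L` times the distance from `v` to its positive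
part, which is at most `ε + ∑ q k`. The mixed products split into fourth powers. -/
lemma negEnergy_reaction_le {R ε : ℝ} {L : NNReal} (hε : 0 < ε)
    (hL : LipschitzOnWith L F (Icc (fun _ => -R) fun _ => R))
    (hF : ∀ l, ∀ v : Fin m → ℝ, (∀ k, 0 ≤ v k) → v l = 0 → 0 ≤ F v l) {v : Fin m → ℝ}
    (hv : ∀ l, |v l| ≤ R) :
    ∑ l, (negEnergy m ε).d1 l v * F v l
      ≤ (4 * L * (1 + 2 * m) + 1) * (negEnergy m ε).val v + 4 * L * m * ε ^ 4 := by
  change ∑ l, -4 * max (-(v l + ε)) 0 ^ 3 * F v l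
    ≤ (4 * L * (1 + 2 * m) + 1) * (∑ l, max (-(v l + ε)) 0 ^ 4) + 4 * L * m * ε ^ 4
  set q : Fin m → ℝ := fun l => max (-(v l + ε)) 0 with hq
  have hq0 : ∀ l, 0 ≤ q l := fun l => le_max_right _ _
  change ∑ l, -4 * q l ^ 3 * F v l ≤ (4 * L * (1 + 2 * m) + 1) * (∑ l, q l ^ 4) + 4 * L * m * ε ^ 4
  have hL0 : (0 : ℝ) ≤ L := L.2
  set v' : Fin m → ℝ := fun l => max (v l) 0 with hv'
  have hdist : dist v v' ≤ ε + ∑ k, q k := by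
    refine (dist_pi_le_iff (by positivity)).2 fun l => ?_
    have h1 : dist (v l) (v' l) ≤ ε + q l := by
      rw [Real.dist_eq]
      simp only [hv', hq]
      rcases le_total (v l) 0 with h | h
      · rw [max_eq_right h, sub_zero, abs_of_nonpos h]
        linarith [le_max_left (-(v l + ε)) 0]
      · rw [max_eq_left h, sub_self, abs_zero]
        linarith [le_max_right (-(v l + ε)) 0]
    have h2 : q l ≤ ∑ k, q k := Finset.single_le_sum (fun k _ => hq0 k) (Finset.mem_univ l)
    linarith
  have hmem : v ∈ Icc (fun _ : Fin m => -R) fun _ => R :=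
    ⟨fun l => (abs_le.1 (hv l)).1, fun l => (abs_le.1 (hv l)).2⟩
  have hmem' : v' ∈ Icc (fun _ : Fin m => -R) fun _ => R := by
    have hR : ∀ l : Fin m, 0 ≤ R := fun l => (abs_nonneg _).trans (hv l)
    exact ⟨fun l => (hmem.1 l).trans (le_max_left _ _), fun l => max_le (hmem.2 l) (hR l)⟩
  have h1 : ∀ l, -4 * q l ^ 3 * F v l ≤ 4 * L * (q l ^ 3 * ε + ∑ k, q l ^ 3 * q k) := by
    intro l
    rcases le_or_gt (-(v l + ε)) 0 with h | h
    · have : q l = 0 := max_eq_right h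
      simp [this]
    · have hvl : v' l = 0 := max_eq_right (by linarith)
      have hF0 := hF l v' (fun k => le_max_right _ _) hvl
      have h2 : |F v l - F v' l| ≤ L * (ε + ∑ k, q k) := by
        have := (dist_le_pi_dist (F v) (F v') l).trans (hL.dist_le_mul v hmem v' hmem')
        rw [Real.dist_eq] at this
        exact this.trans (mul_le_mul_of_nonneg_left hdist hL0)
      have h3 : -F v l ≤ L * (ε + ∑ k, q k) := by linarith [neg_abs_le (F v l - F v' l)]
      have h4 := mul_le_mul_of_nonneg_left h3 (mul_nonneg (by norm_num : (0 : ℝ) ≤ 4)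
        (pow_nonneg (hq0 l) 3))
      rw [← Finset.mul_sum]
      linarith
  have h2 : ∀ l, q l ^ 3 * ε + ∑ k, q l ^ 3 * q k
      ≤ q l ^ 4 + ε ^ 4 + (m * q l ^ 4 + ∑ k, q k ^ 4) := by
    intro l
    have e : ∑ k, (q l ^ 4 + q k ^ 4) = m * q l ^ 4 + ∑ k, q k ^ 4 := by
      rw [Finset.sum_add_distrib]
      simp
    rw [← e]
    exact add_le_add (pow_three_mul_le (hq0 l) hε.le)
      (Finset.sum_le_sum fun k _ => pow_three_mul_le (hq0 l) (hq0 k))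
  have hS : 0 ≤ ∑ l, q l ^ 4 := Finset.sum_nonneg fun l _ => pow_nonneg (hq0 l) 4
  calc ∑ l, -4 * q l ^ 3 * F v l
      ≤ ∑ l, 4 * L * (q l ^ 4 + ε ^ 4 + (m * q l ^ 4 + ∑ k, q k ^ 4)) :=
        Finset.sum_le_sum fun l _ => (h1 l).trans
          (mul_le_mul_of_nonneg_left (h2 l) (by positivity))
    _ = 4 * L * (1 + 2 * m) * (∑ l, q l ^ 4) + 4 * L * m * ε ^ 4 := by
        rw [← Finset.mul_sum, Finset.sum_add_distrib, Finset.sum_add_distrib,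
          Finset.sum_add_distrib, ← Finset.mul_sum]
        simp
        ring
    _ ≤ _ := by linarith

/-- Robin and Neumann conditions are treated alike, by solving for the normal derivative; only the
Dirichlet condition needs another argument. -/
lemma AdmissibleBoundary.cases (h : AdmissibleBoundary α Λ) :
    (α < 1 ∧ 0 ≤ α ∧ ∀ l, 0 ≤ Λ l) ∨ (α = 1 ∧ ∀ l, Λ l = 0) := by
  rcases h with ⟨h1, h2, h3⟩ | ⟨h1, h2⟩ | h
  · exact Or.inl ⟨h2, h1.le, h3⟩
  · exact Or.inl ⟨by linarith, h1.ge, fun l => (h2 l).ge⟩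
  · exact Or.inr h

/-- Solutions with nonnegative initial data are nonnegative. -/
lemma IsClassicalSolution.nonneg (hw : IsClassicalSolution Ω lam F α Λ Tmax w₀ w)
    (hΩ : IsBoundedC1Domain Ω) (hlam : ∀ l, 0 < lam l) (hbdry : AdmissibleBoundary α Λ)
    (hF : LocallyLipschitz F)
    (hFq : ∀ l, ∀ v : Fin m → ℝ, (∀ k, 0 ≤ v k) → v l = 0 → 0 ≤ F v l)
    (hm₀ : ∀ l, AEStronglyMeasurable (fun x => w₀ x l) (volume.restrict Ω)) {M : ℝ}
    (hM : ∀ l, ∀ᵐ x ∂(volume.restrict Ω), 0 ≤ w₀ x l ∧ w₀ x l ≤ M) {t : ℝ} (ht : t ∈ times Tmax) :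
    ∀ x ∈ closure Ω, ∀ l, 0 ≤ w t x l := by
  obtain ⟨J, _, ⟨D⟩⟩ := hΩ.exists_collar
  have hfin := isFiniteMeasure_restrict_of_isBounded hΩ.isBounded
  obtain ⟨T, hT0, hT1⟩ := EReal.lt_iff_exists_real_btwn.1 ht.2
  have hT0 : t < T := by exact_mod_cast hT0
  obtain ⟨R, hR⟩ := hw.bounded T hT1
  obtain ⟨L, hL⟩ := LocallyLipschitzOn.exists_lipschitzOnWith_of_compact
    (isCompact_Icc (a := fun _ : Fin m => -R) (b := fun _ => R)) hF.locallyLipschitzOn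
  set K : ℝ := 4 * L * (1 + 2 * m) + 1 with hKdef
  have hL0 : (0 : ℝ) ≤ L := L.2
  have hK : 0 < K := by positivity
  set A : ℝ := Real.exp (K * t) * (4 * L * m * volume.real Ω / K) with hA
  -- The shift by `ε` makes the density flat near 0, as the Dirichlet case requires. The energy
  -- vanishes at time zero, so only the error of order `ε ^ 4` from the reaction survives; `A` does
  -- not depend on `ε`.
  have key : ∀ ε > 0, ∫ x in Ω, (negEnergy m ε).val (w t x) ≤ A * ε ^ 4 := by
    intro ε hε
    have h := hw.energy_le hΩ D (negEnergy m ε) (K := K) (K₀ := 4 * L * m * ε ^ 4) (B := 0) ht.1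
      ht.2 hK (by positivity) le_rfl hm₀ (M := M) (fun l => ?_) ?_ ?_ ?_
    · have hzero : ∫ x in Ω, (negEnergy m ε).val (w₀ x) = 0 := by
        refine integral_eq_zero_of_ae ?_
        filter_upwards [eventually_countable_forall.2 hM] with x hx
        change ∑ l, max (-(w₀ x l + ε)) 0 ^ 4 = 0
        refine Finset.sum_eq_zero fun l _ => ?_
        rw [max_eq_right (by linarith [(hx l).1])]
        simp
      rw [hzero, mul_zero, add_zero, zero_add] at h
      have h2 : 0 ≤ 4 * L * m * ε ^ 4 * volume.real Ω / K := by positivity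
      calc _ ≤ Real.exp (K * t) * (4 * L * m * ε ^ 4 * volume.real Ω / K) := by linarith
        _ = A * ε ^ 4 := by rw [hA]; ring
    · filter_upwards [hM l] with x hx
      rw [abs_of_nonneg hx.1]
      exact hx.2
    · intro s _ x _ z
      refine Finset.sum_nonneg fun l _ => Finset.sum_nonneg fun k _ => ?_
      change 0 ≤ lam l * (if l = k then 12 * max (-(w s x l + ε)) 0 ^ 2 else 0) * (z l * z k)
      split_ifs with hlk
      · rw [← hlk]
        exact mul_nonneg (mul_nonneg (hlam l).le (by positivity)) (mul_self_nonneg _)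
      · simp
    · intro s hs x hx
      exact negEnergy_reaction_le hε hL hFq fun l => hR l s hs.1 (hs.2.trans_lt hT0) x hx
    · rcases hbdry.cases with ⟨h1, h2, h3⟩ | ⟨h1, h2⟩
      · refine Or.inl ⟨h1, fun s _ x _ => ?_⟩
        rw [mul_zero]
        refine Finset.sum_nonpos fun l _ => ?_
        change lam l * (-4 * max (-(w s x l + ε)) 0 ^ 3) * (Λ l - α * w s x l) ≤ 0
        rcases le_or_gt (-(w s x l + ε)) 0 with h | h
        · rw [max_eq_right h]
          simp
        · have h4 : 0 ≤ Λ l - α * w s x l := by nlinarith [h3 l]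
          have h5 : 0 ≤ lam l * max (-(w s x l + ε)) 0 ^ 3 :=
            mul_nonneg (hlam l).le (pow_nonneg (le_max_right _ _) 3)
          nlinarith [mul_nonneg h5 h4]
      · refine Or.inr ⟨h1, h2, ε, hε, fun l v hv => ?_⟩
        change -4 * max (-(v l + ε)) 0 ^ 3 = 0
        rw [max_eq_right (by linarith [(abs_lt.1 hv).1])]
        simp
  have hcont := hw.continuousOn_slice ht
  have hin : ∀ x ∈ Ω, ∀ l, 0 ≤ w t x l := by
    intro x hx l
    by_contra hneg
    push Not at hneg
    -- On a small ball `w t y l < -η`, so the energy is at least `(η - ε) ^ 4` times its volume.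
    -- This contradicts the bound `A * ε ^ 4` as `ε → 0`.
    set η := -(w t x l) / 2 with hη
    have hη0 : 0 < η := by linarith
    have hca : ContinuousAt (fun y => w t y l) x :=
      ((continuous_apply l).comp_continuousOn (hcont.mono subset_closure)).continuousAt
        (hΩ.isOpen.mem_nhds hx)
    have hev : ∀ᶠ y in 𝓝 x, w t y l < -η ∧ y ∈ Ω :=
      (hca.eventually_lt_const (by linarith)).and (hΩ.isOpen.mem_nhds hx)
    obtain ⟨r, hr, hball⟩ := Metric.eventually_nhds_iff_ball.1 hev
    have hsub : Metric.ball x r ⊆ Ω := fun y hy => (hball y hy).2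
    have hvol : 0 < volume.real (Metric.ball x r) :=
      ENNReal.toReal_pos (Metric.measure_ball_pos volume x hr).ne' measure_ball_lt_top.ne
    have hle : ∀ ε ∈ Ioo 0 η, (η - ε) ^ 4 * volume.real (Metric.ball x r) ≤ A * ε ^ 4 := by
      intro ε hε
      refine le_trans ?_ (key ε hε.1)
      have hi : IntegrableOn (fun y => (negEnergy m ε).val (w t y)) Ω :=
        (((negEnergy m ε).continuous_val.comp_continuousOn hcont).integrableOn_compact
          hΩ.isBounded.isCompact_closure).mono_set subset_closure
      have hnn : ∀ y, 0 ≤ (negEnergy m ε).val (w t y) := by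
        intro y
        change 0 ≤ ∑ l, max (-(w t y l + ε)) 0 ^ 4
        exact Finset.sum_nonneg fun k _ => pow_nonneg (le_max_right _ _) 4
      calc (η - ε) ^ 4 * volume.real (Metric.ball x r)
          = ∫ y in Metric.ball x r, (η - ε) ^ 4 := by simp [mul_comm]
        _ ≤ ∫ y in Metric.ball x r, (negEnergy m ε).val (w t y) := by
            refine setIntegral_mono_on (integrableOn_const measure_ball_lt_top.ne)
              (hi.mono_set hsub) measurableSet_ball fun y hy => ?_
            have h1 : (η - ε) ^ 4 ≤ max (-(w t y l + ε)) 0 ^ 4 := by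
              refine pow_le_pow_left₀ (by linarith [hε.2]) (le_max_of_le_left ?_) 4
              linarith [(hball y hy).1]
            exact h1.trans (Finset.single_le_sum
              (f := fun k => max (-(w t y k + ε)) 0 ^ 4)
              (fun k _ => pow_nonneg (le_max_right _ _) 4) (Finset.mem_univ l))
        _ ≤ _ := setIntegral_mono_set hi (Eventually.of_forall hnn) hsub.eventuallyLE
    have hlim1 : Tendsto (fun ε : ℝ => (η - ε) ^ 4 * volume.real (Metric.ball x r)) (𝓝[>] 0)
        (𝓝 ((η - 0) ^ 4 * volume.real (Metric.ball x r))) := by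
      refine Tendsto.mono_left (Continuous.tendsto ?_ 0) nhdsWithin_le_nhds
      fun_prop
    have hlim2 : Tendsto (fun ε : ℝ => A * ε ^ 4) (𝓝[>] 0) (𝓝 (A * 0 ^ 4)) := by
      refine Tendsto.mono_left (Continuous.tendsto ?_ 0) nhdsWithin_le_nhds
      fun_prop
    have := le_of_tendsto_of_tendsto hlim1 hlim2 (by
      filter_upwards [Ioo_mem_nhdsGT hη0] with ε hε using hle ε hε)
    have h5 : 0 < (η - 0) ^ 4 * volume.real (Metric.ball x r) := by
      rw [sub_zero]
      positivity
    norm_num at this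
    norm_num at h5
    linarith
  intro x hx l
  have hcl : MapsTo (fun y => w t y l) (closure Ω) (closure (Ici 0)) :=
    MapsTo.closure_of_continuousOn (fun y hy => hin y hy l)
      ((continuous_apply l).comp_continuousOn hcont)
  have := hcl hx
  rwa [isClosed_Ici.closure_eq] at this

end

section

/-! ### The Lyapunov functional -/

/-- A smooth convex function that vanishes on `[0, ε]` and has slope `1` on `[2ε, ∞)`. -/
def truncation (ε s : ℝ) : ℝ := ∫ r in (0 : ℝ)..s, Real.smoothTransition (r / ε - 1)

lemma continuous_truncation_deriv (ε : ℝ) :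
    Continuous fun s : ℝ => Real.smoothTransition (s / ε - 1) :=
  Real.smoothTransition.continuous.comp (by fun_prop)

lemma hasDerivAt_truncation (ε s : ℝ) :
    HasDerivAt (truncation ε) (Real.smoothTransition (s / ε - 1)) s :=
  intervalIntegral.integral_hasDerivAt_right
    ((continuous_truncation_deriv ε).intervalIntegrable _ _)
    (continuous_truncation_deriv ε).stronglyMeasurable.stronglyMeasurableAtFilter
    (continuous_truncation_deriv ε).continuousAt

lemma hasDerivAt_truncation_deriv (ε s : ℝ) :
    HasDerivAt (fun s : ℝ => Real.smoothTransition (s / ε - 1))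
      (deriv Real.smoothTransition (s / ε - 1) * ε⁻¹) s := by
  have h1 : HasDerivAt (fun s : ℝ => s / ε - 1) ε⁻¹ s := by
    simpa [div_eq_mul_inv] using ((hasDerivAt_id s).mul_const ε⁻¹).sub_const 1
  have h2 : HasDerivAt Real.smoothTransition (deriv Real.smoothTransition (s / ε - 1))
      (s / ε - 1) :=
    ((Real.smoothTransition.contDiff (n := 1)).differentiable one_ne_zero _).hasDerivAt
  exact h2.comp s h1

lemma continuous_truncation_deriv2 (ε : ℝ) :
    Continuous fun s : ℝ => deriv Real.smoothTransition (s / ε - 1) * ε⁻¹ :=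
  (((Real.smoothTransition.contDiff (n := 1)).continuous_deriv le_rfl).comp
    (by fun_prop : Continuous fun s : ℝ => s / ε - 1)).mul continuous_const

lemma truncation_deriv2_nonneg {ε : ℝ} (hε : 0 < ε) (s : ℝ) :
    0 ≤ deriv Real.smoothTransition (s / ε - 1) * ε⁻¹ :=
  mul_nonneg monotone_smoothTransition.deriv_nonneg (inv_nonneg.2 hε.le)

lemma truncation_nonneg (ε : ℝ) {s : ℝ} (hs : 0 ≤ s) : 0 ≤ truncation ε s :=
  intervalIntegral.integral_nonneg hs fun _ _ => Real.smoothTransition.nonneg _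

lemma truncation_le (ε : ℝ) {s : ℝ} (hs : 0 ≤ s) : truncation ε s ≤ s := by
  have := intervalIntegral.integral_mono_on hs
    ((continuous_truncation_deriv ε).intervalIntegrable (μ := volume) 0 s)
    ((continuous_const (y := (1 : ℝ))).intervalIntegrable 0 s)
    fun r _ => Real.smoothTransition.le_one (r / ε - 1)
  simpa [truncation] using this

lemma truncation_deriv_eq_one {ε s : ℝ} (hε : 0 < ε) (hs : 2 * ε ≤ s) :
    Real.smoothTransition (s / ε - 1) = 1 := by
  refine Real.smoothTransition.one_of_one_le ?_
  have : 2 ≤ s / ε := (le_div_iff₀ hε).2 hs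
  linarith

lemma truncation_deriv_eq_zero {ε s : ℝ} (hε : 0 < ε) (hs : s ≤ ε) :
    Real.smoothTransition (s / ε - 1) = 0 := by
  refine Real.smoothTransition.zero_of_nonpos ?_
  have : s / ε ≤ 1 := (div_le_one hε).2 hs
  linarith

lemma sub_le_truncation {ε s : ℝ} (hε : 0 < ε) (hs : 0 ≤ s) : s - 2 * ε ≤ truncation ε s := by
  rcases le_total s (2 * ε) with h | h
  · linarith [truncation_nonneg ε hs]
  · have hi := fun a b : ℝ => (continuous_truncation_deriv ε).intervalIntegrable (μ := volume) a b
    have h1 : truncation ε s = truncation ε (2 * ε)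
        + ∫ r in (2 * ε)..s, Real.smoothTransition (r / ε - 1) :=
      (intervalIntegral.integral_add_adjacent_intervals (hi _ _) (hi _ _)).symm
    have h2 : ∫ r in (2 * ε)..s, Real.smoothTransition (r / ε - 1) = ∫ r in (2 * ε)..s, (1 : ℝ) := by
      refine intervalIntegral.integral_congr fun r hr => ?_
      rw [uIcc_of_le h] at hr
      exact truncation_deriv_eq_one hε hr.1
    rw [h1, h2]
    have := truncation_nonneg ε (by positivity : 0 ≤ 2 * ε)
    simp
    linarith

lemma abs_truncation_sub_le {ε s : ℝ} (hε : 0 < ε) (hs : 0 ≤ s) :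
    |truncation ε s - s| ≤ 2 * ε := by
  rw [abs_le]
  constructor <;> linarith [sub_le_truncation hε hs, truncation_le ε hs]

variable {m : ℕ}

/-- The energy density given by a weighted power of the vector with the components `ψ (v_l)`. -/
def polyEnergy (c : (Fin m → ℕ) → ℝ) (q : ℕ) {ψ ψ' ψ'' : ℝ → ℝ} (h1 : ∀ s, HasDerivAt ψ (ψ' s) s)
    (h2 : ∀ s, HasDerivAt ψ' (ψ'' s) s) (h3 : Continuous ψ'') : EnergyDensity m where
  val v := weightedPower c (q + 1) 0 fun k => ψ (v k)
  d1 l v := ((q : ℝ) + 1) * weightedPower c q (Pi.single l 1) (fun k => ψ (v k)) * ψ' (v l)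
  d2 l k v := ((q : ℝ) + 1) * (q * weightedPower c (q - 1) (Pi.single l 1 + Pi.single k 1)
      (fun k => ψ (v k))) * (ψ' (v l) * ψ' (v k)) +
    if l = k then ((q : ℝ) + 1) * weightedPower c q (Pi.single l 1) (fun k => ψ (v k)) * ψ'' (v l)
      else 0
  hasFDerivAt_val v := by
    have hψ : HasFDerivAt (fun v : Fin m → ℝ => fun k => ψ (v k))
        (ContinuousLinearMap.pi fun k => ψ' (v k) •
          (ContinuousLinearMap.proj k : (Fin m → ℝ) →L[ℝ] ℝ)) v :=
      hasFDerivAt_pi.2 fun k => (h1 (v k)).comp_hasFDerivAt v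
        (ContinuousLinearMap.proj (R := ℝ) (φ := fun _ : Fin m => ℝ) k).hasFDerivAt
    refine ((weightedPower_hasFDerivAt c (q + 1) 0 _).comp v hψ).congr_fderiv ?_
    ext z
    simp only [ContinuousLinearMap.comp_apply, sum_apply, smul_apply, smul_eq_mul,
      ContinuousLinearMap.proj_apply, ContinuousLinearMap.pi_apply, Nat.add_sub_cancel, zero_add]
    push_cast
    exact Finset.sum_congr rfl fun l _ => by ring
  hasFDerivAt_d1 l v := by
    have hψ : HasFDerivAt (fun v : Fin m → ℝ => fun k => ψ (v k))
        (ContinuousLinearMap.pi fun k => ψ' (v k) •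
          (ContinuousLinearMap.proj k : (Fin m → ℝ) →L[ℝ] ℝ)) v :=
      hasFDerivAt_pi.2 fun k => (h1 (v k)).comp_hasFDerivAt v
        (ContinuousLinearMap.proj (R := ℝ) (φ := fun _ : Fin m => ℝ) k).hasFDerivAt
    have h4 := ((weightedPower_hasFDerivAt c q (Pi.single l 1) _).comp v hψ).const_mul ((q : ℝ) + 1)
    have h5 := (h2 (v l)).comp_hasFDerivAt v
        (ContinuousLinearMap.proj (R := ℝ) (φ := fun _ : Fin m => ℝ) l).hasFDerivAt
    refine (h4.mul h5).congr_fderiv ?_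
    ext z
    generalize (q : ℝ) + 1 = Q
    simp only [ContinuousLinearMap.comp_apply, sum_apply, smul_apply, smul_eq_mul, add_apply,
      ContinuousLinearMap.proj_apply, ContinuousLinearMap.pi_apply, Function.comp_apply, add_mul,
      Finset.sum_add_distrib, ite_mul, zero_mul, Finset.sum_ite_eq, Finset.mem_univ, if_true]
    rw [add_comm, Finset.mul_sum, Finset.mul_sum]
    congr 1
    · exact Finset.sum_congr rfl fun k _ => by ring
    · ring
  continuous_d2 l k := by
    have hψ : Continuous fun v : Fin m → ℝ => fun k => ψ (v k) := continuous_pi fun k =>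
      (continuous_iff_continuousAt.2 fun s => (h1 s).continuousAt).comp (continuous_apply k)
    have hψ' : Continuous ψ' := continuous_iff_continuousAt.2 fun s => (h2 s).continuousAt
    have hP := fun r γ => (weightedPower_continuous c r γ).comp hψ
    refine Continuous.add ?_ ?_
    · exact (continuous_const.mul (continuous_const.mul (hP _ _))).mul
        ((hψ'.comp (continuous_apply l)).mul (hψ'.comp (continuous_apply k)))
    · split_ifs
      · exact (continuous_const.mul (hP _ _)).mul (h3.comp (continuous_apply l))
      · exact continuous_const

/-- The chain rule gives the Hessian of the polynomial at `ψ (v)`, tested with `ψ' (v l) * z l`,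
plus a diagonal term that is nonnegative by convexity of `ψ`. As the Hessian is symmetric, the
weights `lam l` may be replaced by the averages `(lam l + lam k) / 2`. -/
lemma polyEnergy_hessian_nonneg {lam : Fin m → ℝ} (hlam : ∀ l, 0 < lam l)
    {c : (Fin m → ℕ) → ℝ} (hc : ∀ γ, 1 ≤ c γ)
    (hcH : ∀ w : Fin m → ℝ, (∀ l, 0 ≤ w l) → ∀ (r : ℕ) (γ : Fin m → ℕ) (z : Fin m → ℝ),
        0 ≤ ∑ l, ∑ k, (lam l + lam k) / 2 *
          weightedPower c r (γ + Pi.single l 1 + Pi.single k 1) w * (z l * z k)) (q : ℕ)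
    {ψ ψ' ψ'' : ℝ → ℝ} (h1 : ∀ s, HasDerivAt ψ (ψ' s) s) (h2 : ∀ s, HasDerivAt ψ' (ψ'' s) s)
    (h3 : Continuous ψ'') (hψ : ∀ s, 0 ≤ s → 0 ≤ ψ s) (hψ'' : ∀ s, 0 ≤ ψ'' s) {v : Fin m → ℝ}
    (hv : ∀ l, 0 ≤ v l) (z : Fin m → ℝ) :
    0 ≤ ∑ l, ∑ k, lam l * (polyEnergy c q h1 h2 h3).d2 l k v * (z l * z k) := by
  set u : Fin m → ℝ := fun k => ψ (v k) with hu
  have hu0 : ∀ k, 0 ≤ u k := fun k => hψ _ (hv k)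
  set S : Fin m → Fin m → ℝ := fun l k =>
    weightedPower c (q - 1) (Pi.single l 1 + Pi.single k 1) u with hS
  set y : Fin m → ℝ := fun l => ψ' (v l) * z l with hy
  have hsym : ∀ l k, S l k = S k l := fun l k => by
    simp only [hS]
    rw [add_comm]
  have e1 : ∑ l, ∑ k, lam l * S l k * (y l * y k)
      = ∑ l, ∑ k, (lam l + lam k) / 2 * S l k * (y l * y k) := by
    have hswap : ∑ l, ∑ k, lam l * S l k * (y l * y k) = ∑ l, ∑ k, lam k * S l k * (y l * y k) := by
      rw [Finset.sum_comm]
      refine Finset.sum_congr rfl fun k _ => Finset.sum_congr rfl fun l _ => ?_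
      rw [hsym]
      ring
    have : ∀ l k, (lam l + lam k) / 2 * S l k * (y l * y k)
        = 1 / 2 * (lam l * S l k * (y l * y k)) + 1 / 2 * (lam k * S l k * (y l * y k)) :=
      fun l k => by ring
    simp_rw [this, Finset.sum_add_distrib, ← Finset.mul_sum]
    rw [← hswap]
    ring
  have h4 : 0 ≤ ∑ l, ∑ k, lam l * S l k * (y l * y k) := by
    rw [e1]
    simpa only [zero_add] using hcH u hu0 (q - 1) 0 y
  have h5 : 0 ≤ ∑ l, ∑ k, lam l * (if l = k then ((q : ℝ) + 1) *
      weightedPower c q (Pi.single l 1) u * ψ'' (v l) else 0) * (z l * z k) := by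
    refine Finset.sum_nonneg fun l _ => Finset.sum_nonneg fun k _ => ?_
    split_ifs with hlk
    · rw [← hlk]
      have := weightedPower_nonneg (fun γ => zero_le_one.trans (hc γ)) hu0 q (Pi.single l 1)
      exact mul_nonneg (mul_nonneg (hlam l).le (mul_nonneg (mul_nonneg (by positivity) this)
        (hψ'' _))) (mul_self_nonneg _)
    · simp
  have e2 : ∑ l, ∑ k, lam l * (polyEnergy c q h1 h2 h3).d2 l k v * (z l * z k)
      = ((q : ℝ) + 1) * q * ∑ l, ∑ k, lam l * S l k * (y l * y k) +
        ∑ l, ∑ k, lam l * (if l = k then ((q : ℝ) + 1) *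
          weightedPower c q (Pi.single l 1) u * ψ'' (v l) else 0) * (z l * z k) := by
    rw [Finset.mul_sum, ← Finset.sum_add_distrib]
    refine Finset.sum_congr rfl fun l _ => ?_
    rw [Finset.mul_sum, ← Finset.sum_add_distrib]
    refine Finset.sum_congr rfl fun k _ => ?_
    change lam l * (((q : ℝ) + 1) * (q * S l k) * (ψ' (v l) * ψ' (v k)) + (if l = k then
      ((q : ℝ) + 1) * weightedPower c q (Pi.single l 1) u * ψ'' (v l) else 0)) * (z l * z k) = _
    simp only [hy]
    ring
  rw [e2]
  positivity

/-- The truncated energy density. -/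
def truncatedEnergy (c : (Fin m → ℕ) → ℝ) (q : ℕ) (ε : ℝ) : EnergyDensity m :=
  polyEnergy c q (hasDerivAt_truncation ε) (hasDerivAt_truncation_deriv ε)
    (continuous_truncation_deriv2 ε)

/-- The energy density `weightedPower c (q + 1) 0`. -/
def powerEnergy (c : (Fin m → ℕ) → ℝ) (q : ℕ) : EnergyDensity m :=
  polyEnergy c q (ψ := id) (ψ' := fun _ => 1) (ψ'' := fun _ => 0) hasDerivAt_id
    (fun s => hasDerivAt_const s 1) continuous_const

lemma exists_lipschitz_weightedPower (c : (Fin m → ℕ) → ℝ) (q : ℕ) (γ : Fin m → ℕ) (R : ℝ) :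
    ∃ L : NNReal, LipschitzOnWith L (weightedPower c q γ) (Icc (fun _ => -R) fun _ => R) := by
  refine LocallyLipschitzOn.exists_lipschitzOnWith_of_compact isCompact_Icc
    (ContDiff.locallyLipschitz (𝕂 := ℝ) ?_).locallyLipschitzOn
  refine contDiff_one_iff_hasFDerivAt.2 ⟨_, ?_, weightedPower_hasFDerivAt c q γ⟩
  exact continuous_finsetSum _ fun k _ =>
    (continuous_const.mul (weightedPower_continuous c _ _)).smul continuous_const

/-- On bounded sets the truncation changes the energy density and the reaction estimate by
`O(ε)`. -/
lemma exists_truncation_error {F : (Fin m → ℝ) → (Fin m → ℝ)} (hF : LocallyLipschitz F)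
    (hFq : ∀ l, ∀ v : Fin m → ℝ, (∀ k, 0 ≤ v k) → v l = 0 → 0 ≤ F v l)
    {c : (Fin m → ℕ) → ℝ} (hc : ∀ γ, 1 ≤ c γ) (q : ℕ) {K : ℝ} (hK : 0 ≤ K)
    (hKF : ∀ w : Fin m → ℝ, (∀ l, 0 ≤ w l) → ∑ l, weightedPower c q (Pi.single l 1) w * F w l
      ≤ K * (1 + weightedPower c (q + 1) 0 w)) (R : ℝ) :
    ∃ C, 0 ≤ C ∧ ∀ ε > 0, ∀ v : Fin m → ℝ, (∀ l, 0 ≤ v l) → (∀ l, v l ≤ R) →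
      |(truncatedEnergy c q ε).val v - weightedPower c (q + 1) 0 v| ≤ C * ε ∧
      ∑ l, (truncatedEnergy c q ε).d1 l v * F v l
        ≤ ((q : ℝ) + 1) * K * (1 + (truncatedEnergy c q ε).val v) + C * ε := by
  obtain ⟨L, hL⟩ := LocallyLipschitzOn.exists_lipschitzOnWith_of_compact
    (isCompact_Icc (a := fun _ : Fin m => -R) (b := fun _ => R)) hF.locallyLipschitzOn
  obtain ⟨A, hA⟩ := exists_lipschitz_weightedPower c (q + 1) 0 R
  choose A' hA' using fun l : Fin m => exists_lipschitz_weightedPower c q (Pi.single l 1) R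
  obtain ⟨CF, hCF⟩ := (isCompact_Icc (a := fun _ : Fin m => -R)
    (b := fun _ => R)).exists_bound_of_continuousOn hF.continuous.continuousOn
  choose CP hCP using fun l : Fin m => (isCompact_Icc (a := fun _ : Fin m => -R)
    (b := fun _ => R)).exists_bound_of_continuousOn
      (weightedPower_continuous c q (Pi.single l 1)).continuousOn
  set C₁ : ℝ := ∑ l, (A' l * 2 * |CF| + |CP l| * (L * 2)) with hC₁
  have hC₁0 : 0 ≤ C₁ := Finset.sum_nonneg fun l _ => by positivity
  refine ⟨A * 2 + ((q : ℝ) + 1) * (C₁ + K * (A * 2)), by positivity, fun ε hε v hv0 hvR => ?_⟩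
  set u : Fin m → ℝ := fun k => truncation ε (v k) with hu
  have hu0 : ∀ k, 0 ≤ u k := fun k => truncation_nonneg ε (hv0 k)
  have hvbox : v ∈ Icc (fun _ : Fin m => -R) fun _ => R :=
    ⟨fun l => by linarith [hv0 l, hvR l], hvR⟩
  have hubox : u ∈ Icc (fun _ : Fin m => -R) fun _ => R :=
    ⟨fun l => by linarith [hv0 l, hvR l, hu0 l], fun l => (truncation_le ε (hv0 l)).trans (hvR l)⟩
  have hdist : dist u v ≤ 2 * ε :=
    (dist_pi_le_iff (by positivity)).2 fun l => abs_truncation_sub_le hε (hv0 l)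
  have hval : |weightedPower c (q + 1) 0 u - weightedPower c (q + 1) 0 v| ≤ A * (2 * ε) :=
    (hA.dist_le_mul u hubox v hvbox).trans (mul_le_mul_of_nonneg_left hdist A.2)
  have hQ : 0 ≤ ((q : ℝ) + 1) * (C₁ + K * (A * 2)) * ε := by positivity
  change |weightedPower c (q + 1) 0 u - weightedPower c (q + 1) 0 v| ≤ _ ∧
    ∑ l, ((q : ℝ) + 1) * weightedPower c q (Pi.single l 1) u *
      Real.smoothTransition (v l / ε - 1) * F v l
      ≤ ((q : ℝ) + 1) * K * (1 + weightedPower c (q + 1) 0 u) + _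
  refine ⟨hval.trans (by linarith), ?_⟩
  -- Two errors: replacing `u` by `v` in the polynomial costs its Lipschitz constant times `2 ε`,
  -- and dropping the slope `σ ≤ 1` costs `(1 - σ) * -F v l`.
  have hterm : ∀ l, weightedPower c q (Pi.single l 1) u * Real.smoothTransition (v l / ε - 1) * F v l
      ≤ weightedPower c q (Pi.single l 1) v * F v l
        + (A' l * 2 * |CF| + |CP l| * (L * 2)) * ε := by
    intro l
    set σ := Real.smoothTransition (v l / ε - 1) with hσ
    have hσ0 : 0 ≤ σ := Real.smoothTransition.nonneg _
    have hσ1 : σ ≤ 1 := Real.smoothTransition.le_one _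
    have hPl : 0 ≤ weightedPower c q (Pi.single l 1) v :=
      weightedPower_nonneg (fun γ => zero_le_one.trans (hc γ)) hv0 q _
    have hFl : |F v l| ≤ |CF| := (norm_le_pi_norm (F v) l).trans ((hCF v hvbox).trans (le_abs_self _))
    have k1 : |weightedPower c q (Pi.single l 1) u - weightedPower c q (Pi.single l 1) v|
        ≤ A' l * (2 * ε) :=
      ((hA' l).dist_le_mul u hubox v hvbox).trans (mul_le_mul_of_nonneg_left hdist (A' l).2)
    have k2 : (weightedPower c q (Pi.single l 1) u - weightedPower c q (Pi.single l 1) v) *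
        (σ * F v l) ≤ A' l * 2 * |CF| * ε := by
      refine (le_abs_self _).trans ?_
      rw [abs_mul, abs_mul, abs_of_nonneg hσ0]
      calc _ ≤ A' l * (2 * ε) * (1 * |CF|) := by gcongr
        _ = _ := by ring
    have k3 : weightedPower c q (Pi.single l 1) v * ((1 - σ) * -F v l)
        ≤ |CP l| * (L * 2) * ε := by
      have hle : (1 - σ) * -F v l ≤ L * (2 * ε) := by
        rcases le_total (2 * ε) (v l) with h | h
        · rw [hσ, truncation_deriv_eq_one hε h]
          simp
          positivity
        -- The slope differs from 1 only if `v l < 2 ε`. Setting this component to zero moves `v` by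
        -- at most `2 ε` and reaches the face where `F · l` is nonnegative, so `-F v l` is `O(ε)`;
        -- no upper bound on `F v l` is needed, since that part has the favourable sign.
        · set v' := Function.update v l 0 with hv'
          have hv'0 : ∀ k, 0 ≤ v' k := by
            intro k
            rcases eq_or_ne k l with rfl | hk
            · simp [hv']
            · simpa [hv', hk] using hv0 k
          have hv'R : ∀ k, v' k ≤ v k := by
            intro k
            rcases eq_or_ne k l with rfl | hk
            · simpa [hv'] using hv0 k
            · simp [hv', hk]
          have hv'box : v' ∈ Icc (fun _ : Fin m => -R) fun _ => R :=
            ⟨fun k => by linarith [hv'0 k, hv0 k, hvR k], fun k => (hv'R k).trans (hvR k)⟩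
          have hd : dist v v' ≤ 2 * ε := by
            refine (dist_pi_le_iff (by positivity)).2 fun k => ?_
            rcases eq_or_ne k l with rfl | hk
            · simp only [hv', Function.update_self, dist_zero_right, Real.norm_eq_abs]
              rwa [abs_of_nonneg (hv0 k)]
            · simp [hv', hk]
              positivity
          have h1 : |F v l - F v' l| ≤ L * (2 * ε) :=
            (dist_le_pi_dist (F v) (F v') l).trans ((hL.dist_le_mul v hvbox v' hv'box).trans
              (mul_le_mul_of_nonneg_left hd L.2))
          have h2 : 0 ≤ F v' l := hFq l v' hv'0 (by simp [hv'])
          have h3 : -F v l ≤ L * (2 * ε) := by linarith [neg_abs_le (F v l - F v' l)]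
          have h4 : 0 ≤ L * (2 * ε) := by positivity
          calc (1 - σ) * -F v l ≤ (1 - σ) * (L * (2 * ε)) :=
                mul_le_mul_of_nonneg_left h3 (by linarith)
            _ ≤ 1 * (L * (2 * ε)) := mul_le_mul_of_nonneg_right (by linarith) h4
            _ = _ := one_mul _
      have hCPl : weightedPower c q (Pi.single l 1) v ≤ |CP l| :=
        (le_abs_self _).trans ((hCP l v hvbox).trans (le_abs_self _))
      calc _ ≤ weightedPower c q (Pi.single l 1) v * (L * (2 * ε)) :=
            mul_le_mul_of_nonneg_left hle hPl
        _ ≤ |CP l| * (L * (2 * ε)) := mul_le_mul_of_nonneg_right hCPl (by positivity)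
        _ = _ := by ring
    have e : weightedPower c q (Pi.single l 1) u * σ * F v l
        = weightedPower c q (Pi.single l 1) v * F v l
          + (weightedPower c q (Pi.single l 1) u - weightedPower c q (Pi.single l 1) v) *
            (σ * F v l) + weightedPower c q (Pi.single l 1) v * ((1 - σ) * -F v l) := by ring
    rw [e]
    linarith
  have hsum : ∑ l, weightedPower c q (Pi.single l 1) u * Real.smoothTransition (v l / ε - 1) * F v l
      ≤ K * (1 + weightedPower c (q + 1) 0 u) + (C₁ + K * (A * 2)) * ε := by
    calc _ ≤ ∑ l, (weightedPower c q (Pi.single l 1) v * F v l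
          + (A' l * 2 * |CF| + |CP l| * (L * 2)) * ε) := Finset.sum_le_sum fun l _ => hterm l
      _ = ∑ l, weightedPower c q (Pi.single l 1) v * F v l + C₁ * ε := by
          rw [Finset.sum_add_distrib, ← Finset.sum_mul]
      _ ≤ K * (1 + weightedPower c (q + 1) 0 v) + C₁ * ε := add_le_add (hKF v hv0) le_rfl
      _ ≤ K * (1 + (weightedPower c (q + 1) 0 u + A * (2 * ε))) + C₁ * ε := by
          refine add_le_add (mul_le_mul_of_nonneg_left ?_ hK) le_rfl
          linarith [neg_abs_le (weightedPower c (q + 1) 0 u - weightedPower c (q + 1) 0 v)]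
      _ = _ := by ring
  have e3 : ∑ l, ((q : ℝ) + 1) * weightedPower c q (Pi.single l 1) u *
      Real.smoothTransition (v l / ε - 1) * F v l = ((q : ℝ) + 1) *
      ∑ l, weightedPower c q (Pi.single l 1) u * Real.smoothTransition (v l / ε - 1) * F v l := by
    rw [Finset.mul_sum]
    exact Finset.sum_congr rfl fun l _ => by ring
  rw [e3]
  have h6 := mul_le_mul_of_nonneg_left hsum (by positivity : 0 ≤ (q : ℝ) + 1)
  have h7 : 0 ≤ A * 2 * ε := by positivity
  linarith

end

/-! ### The uniform bound of the Lyapunov functional and the theorem -/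

section

variable {n m : ℕ} {Ω : Set (EuclideanSpace ℝ (Fin n))}

/-- The factor `1 - α` on the right is the denominator that appears when the boundary condition is
solved for the normal derivative. The Dirichlet case is vacuous here. -/
lemma exists_boundary_flux_bound {lam : Fin m → ℝ} (hlam : ∀ l, 0 < lam l) (hm : 0 < m)
    {c : (Fin m → ℕ) → ℝ} (hc : ∀ γ, 1 ≤ c γ) {α : ℝ} {Λ : Fin m → ℝ}
    (hbdry : AdmissibleBoundary α Λ) (q : ℕ) :
    ∃ B, 0 ≤ B ∧ (α < 1 → ∀ v : Fin m → ℝ, (∀ l, 0 ≤ v l) →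
      ∑ l, lam l * (powerEnergy c q).d1 l v * (Λ l - α * v l) ≤ (1 - α) * B) := by
  have hd1 : ∀ l v, (powerEnergy c q).d1 l v
      = ((q : ℝ) + 1) * weightedPower c q (Pi.single l 1) v := fun l v => mul_one _
  rcases hbdry with ⟨h1, h2, h3⟩ | ⟨h1, h2⟩ | ⟨h1, _⟩
  · obtain ⟨B, hB0, hB⟩ := exists_robin_bound hlam hm hc h1 h3 q
    have hα : 0 < 1 - α := by linarith
    refine ⟨((q : ℝ) + 1) * B / (1 - α), by positivity, fun _ v hv => ?_⟩
    rw [mul_div_cancel₀ _ hα.ne']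
    refine le_trans (le_of_eq ?_) (mul_le_mul_of_nonneg_left (hB v hv)
      (by positivity : 0 ≤ (q : ℝ) + 1))
    rw [Finset.mul_sum]
    exact Finset.sum_congr rfl fun l _ => by rw [hd1]; ring
  · refine ⟨0, le_rfl, fun _ v _ => ?_⟩
    simp [h1, h2]
  · exact ⟨0, le_rfl, fun h => absurd h1 h.ne⟩

/-- The uniform bound of the Lyapunov functional along all solutions. -/
lemma exists_integral_bound (hΩ : IsBoundedC1Domain Ω) (hm : 0 < m) {lam : Fin m → ℝ}
    (hlam : ∀ l, 0 < lam l) {α : ℝ} {Λ : Fin m → ℝ} (hbdry : AdmissibleBoundary α Λ)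
    {F : (Fin m → ℝ) → (Fin m → ℝ)} (hF : LocallyLipschitz F)
    (hFq : ∀ l, ∀ v : Fin m → ℝ, (∀ k, 0 ≤ v k) → v l = 0 → 0 ≤ F v l)
    {dbar : Fin m → ℝ} (hA3 : LyapunovCondition F dbar) (q : ℕ) (M T : ℝ) :
    ∃ Y : ℝ, ∀ (Tmax : EReal) (w₀ : EuclideanSpace ℝ (Fin n) → Fin m → ℝ)
      (w : ℝ → EuclideanSpace ℝ (Fin n) → Fin m → ℝ),
      (∀ l, AEStronglyMeasurable (fun x => w₀ x l) (volume.restrict Ω)) →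
      (∀ l, ∀ᵐ x ∂(volume.restrict Ω), 0 ≤ w₀ x l ∧ w₀ x l ≤ M) →
      IsClassicalSolution Ω lam F α Λ Tmax w₀ w →
      ∀ t, 0 < t → t ≤ T → (t : EReal) < Tmax →
        ∫ x in Ω, (∑ l, w t x l) ^ (q + 1) ≤ Y := by
  obtain ⟨J, _, ⟨D⟩⟩ := hΩ.exists_collar
  have hopen := hΩ.isOpen
  have hfin := isFiniteMeasure_restrict_of_isBounded hΩ.isBounded
  obtain ⟨c, hc, hcH, Kw, hKw0, hKw⟩ := exists_weights hlam hA3 q hm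
  obtain ⟨B, hB0, hB⟩ := exists_boundary_flux_bound hlam hm hc hbdry q
  obtain ⟨CP, hCP0, hCP⟩ := exists_weightedPower_le c (q + 1) 0
  have hc0 : ∀ γ, 0 ≤ c γ := fun γ => zero_le_one.trans (hc γ)
  set K₀ : ℝ := ((q : ℝ) + 1) * Kw with hK₀
  -- The added 1 makes the rate positive, as the division by `K` in Gronwall's inequality requires.
  set K : ℝ := K₀ + 1 with hK
  have hK₀0 : 0 ≤ K₀ := by positivity
  have hKpos : 0 < K := by linarith
  set M' := max M 0 with hM'
  have hM'0 : 0 ≤ M' := le_max_right _ _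
  set I₀ : ℝ := CP * (m * M') ^ (q + 1) * volume.real Ω with hI₀
  have hI₀0 : 0 ≤ I₀ := by positivity
  set V := volume.real Ω with hV
  have hV0 : 0 ≤ V := measureReal_nonneg
  -- Every constant here is fixed before the solution is introduced, which makes the bound uniform
  -- over all solutions.
  refine ⟨Real.exp (K * T) * (I₀ + (K₀ * V + D.fluxConst * B) / K), ?_⟩
  intro Tmax w₀ w hm₀ hw₀ hw t ht0 htT htm
  have hflux0 : 0 ≤ D.fluxConst * B := mul_nonneg D.fluxConst_nonneg hB0
  have hwnn : ∀ s ∈ Ioc 0 t, ∀ x ∈ closure Ω, ∀ l, 0 ≤ w s x l := fun s hs =>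
    hw.nonneg hΩ hlam hbdry hF hFq hm₀ hw₀
      ⟨hs.1, lt_of_le_of_lt (EReal.coe_le_coe_iff.2 hs.2) htm⟩
  have hexp : Real.exp (K * t) ≤ Real.exp (K * T) :=
    Real.exp_le_exp.2 (mul_le_mul_of_nonneg_left htT hKpos.le)
  have hM₀ : ∀ l, ∀ᵐ x ∂(volume.restrict Ω), |w₀ x l| ≤ M' := by
    intro l
    filter_upwards [hw₀ l] with x hx
    rw [abs_of_nonneg hx.1]
    exact hx.2.trans (le_max_left _ _)
  have hslice := hw.continuousOn_slice ⟨ht0, htm⟩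
  have hcint : ∀ {h : (Fin m → ℝ) → ℝ}, Continuous h → IntegrableOn (fun x => h (w t x)) Ω :=
    fun hh => ((hh.comp_continuousOn hslice).integrableOn_compact
      hΩ.isBounded.isCompact_closure).mono_set subset_closure
  have hpow : ∫ x in Ω, (∑ l, w t x l) ^ (q + 1)
      ≤ ∫ x in Ω, weightedPower c (q + 1) 0 (w t x) := by
    refine setIntegral_mono_on (hcint (h := fun v => (∑ l, v l) ^ (q + 1)) (by fun_prop)) (hcint (weightedPower_continuous c _ _))
      hopen.measurableSet fun x hx => ?_
    exact sum_pow_le_weightedPower hc (hwnn t ⟨ht0, le_rfl⟩ x (subset_closure hx)) _ _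
  refine hpow.trans ?_
  have hinit : ∀ (h : (Fin m → ℝ) → ℝ) (a : ℝ), 0 ≤ a →
      (∀ v, (∀ l, 0 ≤ v l) → (∀ l, v l ≤ M') → h v ≤ weightedPower c (q + 1) 0 v + a) →
      ∫ x in Ω, h (w₀ x) ≤ I₀ + a * V := by
    intro h a ha hle
    have hae : ∀ᵐ x ∂(volume.restrict Ω), h (w₀ x) ≤ CP * (m * M') ^ (q + 1) + a := by
      filter_upwards [eventually_countable_forall.2 hw₀] with x hx
      have hx' : ∀ l, w₀ x l ≤ M' := fun l => (hx l).2.trans (le_max_left _ _)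
      refine (hle _ (fun l => (hx l).1) hx').trans (add_le_add ?_ le_rfl)
      refine (hCP _ fun l => (hx l).1).trans (mul_le_mul_of_nonneg_left ?_ hCP0)
      refine pow_le_pow_left₀ (Finset.sum_nonneg fun l _ => (hx l).1) ?_ _
      refine (Finset.sum_le_sum fun l _ => hx' l).trans_eq ?_
      simp
    -- Without integrability the integral is 0 by convention, and the bound is nonnegative.
    by_cases hi : Integrable (fun x => h (w₀ x)) (volume.restrict Ω)
    · refine (integral_mono_ae hi (integrable_const _) hae).trans_eq ?_
      simp only [integral_const, measureReal_restrict_apply_univ, smul_eq_mul, hI₀]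
      ring
    · rw [integral_undef hi]
      positivity
  rcases hbdry.cases with ⟨hα, -, -⟩ | ⟨hα, hΛ⟩
  · have h := hw.energy_le hΩ D (powerEnergy c q) (K := K) (K₀ := K₀) (B := B) ht0 htm hKpos hK₀0
      hB0 hm₀ hM₀ ?_ ?_ (Or.inl ⟨hα, fun s hs x hx => hB hα _ fun l =>
        hwnn s hs x (frontier_subset_closure hx) l⟩)
    · have h2 := hinit (powerEnergy c q).val 0 le_rfl fun v _ _ => by
        rw [add_zero]
        exact le_rfl
      have h3 : 0 ≤ (K₀ * V + D.fluxConst * B) / K := by positivity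
      calc ∫ x in Ω, weightedPower c (q + 1) 0 (w t x)
          = ∫ x in Ω, (powerEnergy c q).val (w t x) := rfl
        _ ≤ Real.exp (K * t) * ((∫ x in Ω, (powerEnergy c q).val (w₀ x))
            + (K₀ * V + D.fluxConst * B) / K) := by linarith
        _ ≤ Real.exp (K * t) * (I₀ + (K₀ * V + D.fluxConst * B) / K) := by
            refine mul_le_mul_of_nonneg_left ?_ (Real.exp_nonneg _)
            linarith
        _ ≤ _ := mul_le_mul_of_nonneg_right hexp (by positivity)
    · intro s hs x hx z
      exact polyEnergy_hessian_nonneg hlam hc hcH q _ _ _ (fun s hs => hs) (fun _ => le_rfl)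
        (hwnn s hs x (subset_closure hx)) z
    · intro s hs x hx
      have hnn := hwnn s hs x (subset_closure hx)
      have h1 := mul_le_mul_of_nonneg_left (hKw _ hnn) (by positivity : 0 ≤ (q : ℝ) + 1)
      have hP := weightedPower_nonneg hc0 hnn (q + 1) 0
      change ∑ l, ((q : ℝ) + 1) * weightedPower c q (Pi.single l 1) (w s x) * 1 * F (w s x) l
        ≤ K * weightedPower c (q + 1) 0 (w s x) + K₀
      have e : ∑ l, ((q : ℝ) + 1) * weightedPower c q (Pi.single l 1) (w s x) * 1 * F (w s x) l
          = ((q : ℝ) + 1) * ∑ l, weightedPower c q (Pi.single l 1) (w s x) * F (w s x) l := by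
        rw [Finset.mul_sum]
        exact Finset.sum_congr rfl fun l _ => by ring
      rw [e]
      linarith
  · obtain ⟨T', hT'0, hT'1⟩ := EReal.lt_iff_exists_real_btwn.1 htm
    have hT'0 : t < T' := by exact_mod_cast hT'0
    obtain ⟨R, hR⟩ := hw.bounded T' hT'1
    -- `C` depends on the solution through its bound `R`. It enters only in products with `ε`, so it
    -- disappears as `ε → 0` and leaves the uniform constant.
    obtain ⟨C, hC0, hC⟩ := exists_truncation_error hF hFq hc q hKw0 hKw (max R M')
    have hbox : ∀ s ∈ Ioc 0 t, ∀ x ∈ Ω, ∀ l, w s x l ≤ max R M' := fun s hs x hx l =>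
      ((le_abs_self _).trans (hR l s hs.1 (hs.2.trans_lt hT'0) x hx)).trans (le_max_left _ _)
    have key : ∀ ε > 0, ∫ x in Ω, weightedPower c (q + 1) 0 (w t x) ≤ C * ε * V +
        Real.exp (K * T) * (I₀ + C * ε * V + ((K₀ + C * ε) * V + D.fluxConst * B) / K) := by
      intro ε hε
      have hCε : 0 ≤ C * ε := by positivity
      have h := hw.energy_le hΩ D (truncatedEnergy c q ε) (K := K) (K₀ := K₀ + C * ε) (B := B) ht0
        htm hKpos (by positivity) hB0 hm₀ hM₀ ?_ ?_ (Or.inr ⟨hα, hΛ, ε, hε, fun l v hv => ?_⟩)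
      · have h2 := hinit (truncatedEnergy c q ε).val (C * ε) hCε fun v hv0 hvM => by
          have := (hC ε hε v hv0 fun l => (hvM l).trans (le_max_right _ _)).1
          linarith [le_abs_self ((truncatedEnergy c q ε).val v - weightedPower c (q + 1) 0 v)]
        have h3 : 0 ≤ ((K₀ + C * ε) * V + D.fluxConst * B) / K := by positivity
        have h4 : ∫ x in Ω, weightedPower c (q + 1) 0 (w t x)
            ≤ C * ε * V + ∫ x in Ω, (truncatedEnergy c q ε).val (w t x) := by
          calc _ ≤ ∫ x in Ω, (C * ε + (truncatedEnergy c q ε).val (w t x)) := by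
                refine setIntegral_mono_on (hcint (weightedPower_continuous c _ _))
                  (hcint (continuous_const.add (truncatedEnergy c q ε).continuous_val))
                  hopen.measurableSet fun x hx => ?_
                have := (hC ε hε _ (hwnn t ⟨ht0, le_rfl⟩ x (subset_closure hx))
                  (hbox t ⟨ht0, le_rfl⟩ x hx)).1
                linarith [neg_abs_le ((truncatedEnergy c q ε).val (w t x)
                  - weightedPower c (q + 1) 0 (w t x))]
            _ = _ := by
                rw [integral_add (integrable_const _) (hcint (truncatedEnergy c q ε).continuous_val)]
                simp [hV, mul_comm]
        refine h4.trans (add_le_add le_rfl ?_)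
        calc ∫ x in Ω, (truncatedEnergy c q ε).val (w t x)
            ≤ Real.exp (K * t) * ((∫ x in Ω, (truncatedEnergy c q ε).val (w₀ x))
              + ((K₀ + C * ε) * V + D.fluxConst * B) / K) := by linarith
          _ ≤ Real.exp (K * t) * (I₀ + C * ε * V
              + ((K₀ + C * ε) * V + D.fluxConst * B) / K) := by
              refine mul_le_mul_of_nonneg_left ?_ (Real.exp_nonneg _)
              linarith
          _ ≤ _ := mul_le_mul_of_nonneg_right hexp (by positivity)
      · intro s hs x hx z
        exact polyEnergy_hessian_nonneg hlam hc hcH q _ _ _ (fun s hs => truncation_nonneg ε hs)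
          (truncation_deriv2_nonneg hε) (hwnn s hs x (subset_closure hx)) z
      · intro s hs x hx
        have hnn := hwnn s hs x (subset_closure hx)
        have h1 := (hC ε hε _ hnn (hbox s hs x hx)).2
        have hP : 0 ≤ (truncatedEnergy c q ε).val (w s x) :=
          weightedPower_nonneg hc0 (fun k => truncation_nonneg ε (hnn k)) (q + 1) 0
        linarith
      · change _ * Real.smoothTransition (v l / ε - 1) = 0
        rw [truncation_deriv_eq_zero hε (abs_lt.1 hv).2.le, mul_zero]
    have hlim : Tendsto (fun ε : ℝ => C * ε * V +
        Real.exp (K * T) * (I₀ + C * ε * V + ((K₀ + C * ε) * V + D.fluxConst * B) / K)) (𝓝[>] 0)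
        (𝓝 (C * 0 * V +
        Real.exp (K * T) * (I₀ + C * 0 * V + ((K₀ + C * 0) * V + D.fluxConst * B) / K))) := by
      refine Tendsto.mono_left (Continuous.tendsto ?_ 0) nhdsWithin_le_nhds
      fun_prop
    have := ge_of_tendsto hlim (by filter_upwards [self_mem_nhdsWithin] with ε hε using key ε hε)
    simpa using this

end

end ToeplitzRD

end

theorem corollary1
    -- the domain
    (n : ℕ) (hn : 1 ≤ n) (Ω : Set (EuclideanSpace ℝ (Fin n)))
    (hΩ : ToeplitzRD.IsBoundedC1Domain Ω)
    -- the number of components, the entries of the diffusion matrix, and parabolicity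
    (m : ℕ) (hm : 2 ≤ m) (a b c : ℝ) (ha : 0 < a) (hb : 0 < b) (hc : 0 < c)
    (hpar : Real.cos (Real.pi / ((m : ℝ) + 1)) < a / (b + c))
    -- the boundary condition
    (α : ℝ) (Λ : Fin m → ℝ) (hbdry : ToeplitzRD.AdmissibleBoundary α Λ)
    -- the reaction terms
    (F : (Fin m → ℝ) → (Fin m → ℝ)) (hF : LocallyLipschitz F)
    (hA1 : ToeplitzRD.QuasiPositiveC1 F) (hA2 : ToeplitzRD.PolynomialGrowth F)
    (dbar : Fin m → ℝ) (hA3 : ToeplitzRD.LyapunovCondition F dbar)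
    -- the degree and the parameters of the Lyapunov functional
    (pm : ℕ) (hpm : 1 ≤ pm) (θ : ℕ → ℝ) (hθ : ∀ k, 1 ≤ k → k < m → 0 < θ k)
    (hK : ToeplitzRD.DetCondition m (ToeplitzRD.eigenvalue m a b c) θ pm)
    -- a bound for the initial data, and a time horizon
    (M T : ℝ) :
    ∃ C : NNReal, ∀ (Tmax : EReal) (w₀ : EuclideanSpace ℝ (Fin n) → Fin m → ℝ)
      (w : ℝ → EuclideanSpace ℝ (Fin n) → Fin m → ℝ),
      (∀ l, AEStronglyMeasurable (fun x => w₀ x l) (volume.restrict Ω)) →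
      (∀ l, ∀ᵐ x ∂(volume.restrict Ω), 0 ≤ w₀ x l ∧ w₀ x l ≤ M) →
      ToeplitzRD.IsClassicalSolution Ω (fun l => ToeplitzRD.eigenvalue m a b c (l.val + 1))
        F α Λ Tmax w₀ w →
      ∀ Tstar : ℝ, Tstar ≤ T → (Tstar : EReal) < Tmax →
        ∀ l, ToeplitzRD.MemLInftyLpWithBound Ω Tstar (pm : ENNReal) C (fun t x => w t x l) := by
  -- The exponent is written as `q + 1` because the polynomial has degree `q + 1` and its gradient
  -- degree `q`.
  obtain ⟨q, rfl⟩ : ∃ q, pm = q + 1 := ⟨pm - 1, by omega⟩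
  have hlam : ∀ l : Fin m, 0 < ToeplitzRD.eigenvalue m a b c (l.val + 1) := fun l =>
    ToeplitzRD.eigenvalue_pos hm hb hc hpar (by omega) (by omega)
  obtain ⟨Y, hY⟩ := ToeplitzRD.exists_integral_bound hΩ (by omega) hlam hbdry hF hA1.2 hA3 q M T
  have hfin := ToeplitzRD.isFiniteMeasure_restrict_of_isBounded hΩ.isBounded
  refine ⟨Real.toNNReal (Y ^ ((q : ℝ) + 1)⁻¹), fun Tmax w₀ w hm₀ hw₀ hw Tstar hT hTmax l => ?_⟩
  have hsub : Ioo 0 Tstar ⊆ ToeplitzRD.times Tmax := fun t ht =>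
    ⟨ht.1, lt_trans (EReal.coe_lt_coe_iff.2 ht.2) hTmax⟩
  have hmeasΩ := hΩ.isOpen.measurableSet
  constructor
  · rw [Measure.prod_restrict]
    exact ((hw.continuousOn l).mono (prod_mono hsub subset_closure)).aestronglyMeasurable
      (measurableSet_Ioo.prod hmeasΩ)
  · intro t ht
    have hslice := hw.continuousOn_slice (hsub ht)
    have hcl : ContinuousOn (fun x => w t x l) (closure Ω) :=
      (continuous_apply l).comp_continuousOn hslice
    have hmeas : AEStronglyMeasurable (fun x => w t x l) (volume.restrict Ω) :=
      (hcl.mono subset_closure).aestronglyMeasurable hmeasΩ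
    refine ⟨hmeas, ?_⟩
    have hnn := hw.nonneg hΩ hlam hbdry hF hA1.2 hm₀ hw₀ (hsub ht)
    obtain ⟨R, hR⟩ := hΩ.isBounded.isCompact_closure.exists_bound_of_continuousOn hcl
    have hLp : MemLp (fun x => w t x l) ((q + 1 : ℕ) : ENNReal) (volume.restrict Ω) :=
      MemLp.of_bound hmeas R ((ae_restrict_iff' hmeasΩ).2
        (Eventually.of_forall fun x hx => hR x (subset_closure hx)))
    rw [hLp.eLpNorm_eq_integral_rpow_norm (by simp) (ENNReal.natCast_ne_top _)]
    simp only [ENNReal.toReal_natCast, Real.rpow_natCast]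
    -- By nonnegativity a single component is at most the sum of all, whose power was estimated.
    have hle : ∫ x in Ω, ‖w t x l‖ ^ (q + 1) ≤ Y := by
      refine le_trans (setIntegral_mono_on ?_ ?_ hmeasΩ fun x hx => ?_)
        (hY Tmax w₀ w hm₀ hw₀ hw t ht.1 (ht.2.le.trans hT) (hsub ht).2)
      · exact ((hcl.norm.pow _).integrableOn_compact hΩ.isBounded.isCompact_closure).mono_set
          subset_closure
      · have hc2 : ContinuousOn (fun x => (∑ l, w t x l) ^ (q + 1)) (closure Ω) :=
          (by fun_prop : Continuous fun v : Fin m → ℝ => (∑ l, v l) ^ (q + 1)).comp_continuousOn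
            hslice
        exact (hc2.integrableOn_compact hΩ.isBounded.isCompact_closure).mono_set subset_closure
      · have hx' := hnn x (subset_closure hx)
        rw [Real.norm_of_nonneg (hx' l)]
        exact pow_le_pow_left₀ (hx' l)
          (Finset.single_le_sum (f := fun k => w t x k) (fun k _ => hx' k) (Finset.mem_univ l)) _
    have h0 : 0 ≤ ∫ x in Ω, ‖w t x l‖ ^ (q + 1) :=
      integral_nonneg fun x => pow_nonneg (norm_nonneg _) _
    push_cast
    exact ENNReal.ofReal_le_ofReal (Real.rpow_le_rpow h0 hle (by positivity))
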